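/- **Setting.** A principal delegates a search over $n$ boxes to an agent. The boxes are i.i.d.: each costs the agent $c\ge 0$ to open and, independently, contains prize $j\in\{0,1,\dots,m\}$ with known probability $q_j$ (where $\sum_j q_j=1$). Prize $j$ is worth $a_j\ge 0$ to the agent. Only prize $0$ can have positive value for the principal: it is worth $v\ge 0$ to her, and every other prize is worth $0$. A contract commits to a payment $t_{ij}$ to the agent if he selects prize $j$ from box $i$, with $0\le t_{ij}\le v$ for $j=0$ and $t_{ij}=0$ for $j\ge 1$; so it is given by payments $t_1,\dots,t_n\in[0,v]$ for prize $0$. A policy of the agent specifies, depending on the prizes seen so far, which box to open next or otherwise which prize of an opened box to select, if any. The agent's utility is his value plus payment for the selected prize ($0$ if none) minus the costs of the opened boxes; the principal's utility is her value minus payment for the selected prize ($0$ if none). An optimal policy under a contract is one that maximizes the principal's expected utility among the policies that maximize the agent's expected utility. A contract is optimal if it maximizes, among all contracts, the principal's expected utility when the agent executes an optimal policy under the contract. A fair cap of a box with payment $t$ for prize $0$ is a number $\varphi$ with $$q_0\max\{0,a_0+t-\varphi\}+\sum_{j=1}^m q_j\max\{0,a_j-\varphi\}=c$$ (unique if $c>0$);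 a fair cap for $t=0$ is called basic. **Theorem.** 1. There is an algorithm that, given $n,m$ and rational $c,v,a_j,q_j$ as above, computes the payments $t_1,\dots,t_n$ of an optimal contract in time polynomial in $n$, $m$ and the binary lengths of $c,v,a_j,q_j$. 2. For all real data as above there are an optimal contract $t_1,\dots,t_n$, a number $k\in\{0,\dots,n\}$, a basic fair cap $\varphi_0$ and numbers $\varphi\ge\varphi_0$ and $t$ such that: * (Phase 1) every box $i\le k$ has fair cap $\varphi$ and $a_0+t_i\ge\varphi$; if $k>0$, then $\varphi\in\{\varphi_0,0,a_1,\dots,a_m\}$; * (Phase 2) every box $i>k$ has fair cap $\varphi_0$ and the payment $t_i=t$, where $a_0+t<\varphi_0$; if $k<n$, then $t=0$ or $a_0+t\in\{a_1,\dots,a_m\}$; * some optimal policy under the contract opens the boxes in the order $1,2,\dots$ (possibly stopping early) and, whenever prize $0$ is found in a box $i\le k$, selects it immediately. So it suffices to enumerate $k$, $\varphi$ and $t$. -/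

import Mathlib

open scoped BigOperators

noncomputable section

/-! ## The exploration model -/

/-- `n` boxes, each holding one of `m` prizes.  Prize `j` in box `i` is worth `a i j` to the agent
and `b i j` to the principal, and is contained in box `i` with probability `p i j`, independently
of the other boxes.  Opening box `i` costs the agent `cost i`. -/
structure Boxes (n m : ℕ) where
  cost : Fin n → ℝ
  a : Fin n → Fin m → ℝ
  b : Fin n → Fin m → ℝ
  p : Fin n → Fin m → ℝ
  cost_nonneg : ∀ i, 0 ≤ cost i
  a_nonneg : ∀ i j, 0 ≤ a i j
  b_nonneg : ∀ i j, 0 ≤ b i j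
  p_nonneg : ∀ i j, 0 ≤ p i j
  p_sum : ∀ i, ∑ j, p i j = 1

/-- What has been seen so far: `none` for an unopened box, `some j` for an opened box that
contains prize `j`. -/
abbrev Seen (n m : ℕ) : Type := Fin n → Option (Fin m)

/-- Nothing has been opened yet. -/
def Seen.start (n m : ℕ) : Seen n m := fun _ => none

/-- A policy from the situation `s` on, as a decision tree: leave without a prize, select the
prize of an opened box, or open an unopened box and continue depending on the prize found. -/
inductive Policy {n m : ℕ} : Seen n m → Type
  | quit {s : Seen n m} : Policy s
  | select {s : Seen n m} (i : Fin n) (j : Fin m) (h : s i = some j) : Policy s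
  | inspect {s : Seen n m} (i : Fin n) (h : s i = none)
      (next : (j : Fin m) → Policy (Function.update s i (some j))) : Policy s

namespace Boxes

variable {n m : ℕ}

/-- The agent's expected utility from following a policy under the payments `T`: own value plus
payment for the selected prize, minus the costs of the boxes opened (the prize of an unopened
box is independent of what has been seen). -/
def agentUtility (B : Boxes n m) (T : Fin n → Fin m → ℝ) : {s : Seen n m} → Policy s → ℝ
  | _, .quit => 0
  | _, .select i j _ => B.a i j + T i j
  | _, .inspect i _ next => (∑ j, B.p i j * agentUtility B T (next j)) - B.cost i

/-- The principal's expected utility when the agent follows a policy under the payments `T`. -/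
def principalUtility (B : Boxes n m) (T : Fin n → Fin m → ℝ) : {s : Seen n m} → Policy s → ℝ
  | _, .quit => 0
  | _, .select i j _ => B.b i j - T i j
  | _, .inspect i _ next => ∑ j, B.p i j * principalUtility B T (next j)

/-- The policy maximizes the agent's expected utility under `T`. -/
def IsAgentOptimal (B : Boxes n m) (T : Fin n → Fin m → ℝ) (π : Policy (Seen.start n m)) : Prop :=
  ∀ π' : Policy (Seen.start n m), B.agentUtility T π' ≤ B.agentUtility T π

/-- An optimal policy under `T`: best for the principal among the agent-optimal policies. -/
def IsOptimalPolicy (B : Boxes n m) (T : Fin n → Fin m → ℝ) (π : Policy (Seen.start n m)) :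
    Prop :=
  B.IsAgentOptimal T π ∧
    ∀ π' : Policy (Seen.start n m), B.IsAgentOptimal T π' →
      B.principalUtility T π' ≤ B.principalUtility T π

/-- An exploration contract: for each prize in each box a payment between zero and the
principal's value for it. -/
def IsContract (B : Boxes n m) (T : Fin n → Fin m → ℝ) : Prop :=
  ∀ i j, 0 ≤ T i j ∧ T i j ≤ B.b i j

/-- An optimal contract: among all contracts, it maximizes the principal's expected utility when
the agent executes an optimal policy under the contract. -/
def IsOptimalContract (B : Boxes n m) (T : Fin n → Fin m → ℝ) : Prop :=
  B.IsContract T ∧ ∃ π : Policy (Seen.start n m), B.IsOptimalPolicy T π ∧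
    ∀ (T' : Fin n → Fin m → ℝ) (π' : Policy (Seen.start n m)),
      B.IsContract T' → B.IsOptimalPolicy T' π' →
        B.principalUtility T' π' ≤ B.principalUtility T π

/-- `x` is a fair cap of box `i` under the payments `T`. -/
def IsFairCap (B : Boxes n m) (T : Fin n → Fin m → ℝ) (i : Fin n) (x : ℝ) : Prop :=
  ∑ j, B.p i j * max 0 (B.a i j + T i j - x) = B.cost i

end Boxes

namespace Policy

variable {n m : ℕ}

/-- The policy opens the boxes in the order of their indices. -/
def InOrder : {s : Seen n m} → Policy s → Prop
  | _, .quit => True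
  | _, .select _ _ _ => True
  | s, .inspect i _ next => (∀ i' < i, s i' ≠ none) ∧ ∀ j, InOrder (next j)

/-- Whenever prize `0` is found in one of the first `k` boxes, it is selected at once. -/
def AcceptsZeroAtOnce (k : ℕ) : {s : Seen n (m + 1)} → Policy s → Prop
  | _, .quit => True
  | _, .select _ _ _ => True
  | _, .inspect i _ next =>
      ((i : ℕ) < k → next 0 = .select i 0 (by simp)) ∧ ∀ j, AcceptsZeroAtOnce k (next j)

end Policy

/-! ## Identically distributed boxes with a single positive prize for the principal -/

/-- `n` boxes with the same opening cost `c` and the same distribution `q` over the prizes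
`0, …, m`; prize `j` is worth `a j` to the agent, and only prize `0` has a (possibly) positive
value `v` for the principal.  The data are real or rational numbers. -/
structure IIDBoxes (K : Type) [Field K] [LinearOrder K] where
  n : ℕ
  m : ℕ
  c : K
  v : K
  a : Fin (m + 1) → K
  q : Fin (m + 1) → K
  c_nonneg : 0 ≤ c
  v_nonneg : 0 ≤ v
  a_nonneg : ∀ j, 0 ≤ a j
  q_nonneg : ∀ j, 0 ≤ q j
  q_sum : ∑ j, q j = 1

namespace IIDBoxes

/-- The instance as an instance of the general model. -/
def toBoxes (I : IIDBoxes ℝ) : Boxes I.n (I.m + 1) where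
  cost _ := I.c
  a _ j := I.a j
  b _ j := if j = 0 then I.v else 0
  p _ j := I.q j
  cost_nonneg _ := I.c_nonneg
  a_nonneg _ j := I.a_nonneg j
  b_nonneg _ j := by
    split_ifs
    · exact I.v_nonneg
    · exact le_rfl
  p_nonneg _ j := I.q_nonneg j
  p_sum _ := I.q_sum

/-- The payments `t i` for prize `0` in box `i`, and nothing for the other prizes. -/
def payments (I : IIDBoxes ℝ) (t : Fin I.n → ℝ) : Fin I.n → Fin (I.m + 1) → ℝ :=
  fun i j => if j = 0 then t i else 0

/-- A rational instance, viewed as a real one. -/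
def toReal (I : IIDBoxes ℚ) : IIDBoxes ℝ where
  n := I.n
  m := I.m
  c := (I.c : ℝ)
  v := (I.v : ℝ)
  a j := (I.a j : ℝ)
  q j := (I.q j : ℝ)
  c_nonneg := by exact_mod_cast I.c_nonneg
  v_nonneg := by exact_mod_cast I.v_nonneg
  a_nonneg j := by exact_mod_cast I.a_nonneg j
  q_nonneg j := by exact_mod_cast I.q_nonneg j
  q_sum := by exact_mod_cast I.q_sum

/-- The payments `t` for prize `0` form a two-phase contract: the first `k` boxes are Phase 1 and
the others are Phase 2, `base` is the basic fair cap (the fair cap without payment), `cap` is the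
fair cap of all boxes of Phase 1, and `pay` is the payment in all boxes of Phase 2.  Some optimal
policy opens the boxes in order and accepts prize `0` at once in Phase 1; in Phase 2, prize `0`
is worth less to the agent than the fair cap of the next box. -/
def IsTwoPhase (I : IIDBoxes ℝ) (t : Fin I.n → ℝ) : Prop :=
  ∃ (k : ℕ) (base cap pay : ℝ) (π : Policy (Seen.start I.n (I.m + 1))),
    k ≤ I.n ∧ base ≤ cap ∧
    (∀ i, I.toBoxes.IsFairCap (I.payments 0) i base) ∧
    (∀ i : Fin I.n, (i : ℕ) < k →
      I.toBoxes.IsFairCap (I.payments t) i cap ∧ cap ≤ I.a 0 + t i) ∧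
    (∀ i : Fin I.n, k ≤ (i : ℕ) →
      I.toBoxes.IsFairCap (I.payments t) i base ∧ t i = pay ∧ I.a 0 + pay < base) ∧
    (0 < k → cap = base ∨ cap = 0 ∨ ∃ j ≠ 0, cap = I.a j) ∧
    (k < I.n → pay = 0 ∨ ∃ j ≠ 0, I.a 0 + pay = I.a j) ∧
    I.toBoxes.IsOptimalPolicy (I.payments t) π ∧ π.InOrder ∧ π.AcceptsZeroAtOnce k

end IIDBoxes

/-! ## A random access machine with logarithmic cost

The memory consists of arrays of rational numbers.  Every operation is charged one unit plus the
binary lengths of the numbers that it handles, so that a polynomial bound on the cost is a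
polynomial bound on the running time in the bit model. -/

/-- The binary length of a rational number: numerator plus denominator in lowest terms. -/
def bitLength (x : ℚ) : ℕ := x.num.natAbs.size + x.den.size

/-- The memory: `μ k i` is cell `i` of array `k`. -/
abbrev Memory : Type := ℕ → ℕ → ℚ

/-- Expressions: constants, cells of an array with computed index, and arithmetic. -/
inductive Expr : Type
  | const (x : ℚ) : Expr
  | load (k : ℕ) (index : Expr) : Expr
  | add (e f : Expr) : Expr
  | sub (e f : Expr) : Expr
  | mul (e f : Expr) : Expr
  | div (e f : Expr) : Expr

namespace Expr

/-- The value of an expression.  An index is rounded down to a natural number, and division by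
zero yields zero. -/
def eval (μ : Memory) : Expr → ℚ
  | const x => x
  | load k e => μ k ⌊eval μ e⌋₊
  | add e f => eval μ e + eval μ f
  | sub e f => eval μ e - eval μ f
  | mul e f => eval μ e * eval μ f
  | div e f => eval μ e / eval μ f

/-- The cost of evaluating an expression: each node is charged one plus the binary length of its
value. -/
def cost (μ : Memory) : Expr → ℕ
  | const x => 1 + bitLength x
  | load k e => cost μ e + 1 + bitLength (eval μ (load k e))
  | add e f => cost μ e + cost μ f + 1 + bitLength (eval μ (add e f))
  | sub e f => cost μ e + cost μ f + 1 + bitLength (eval μ (sub e f))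
  | mul e f => cost μ e + cost μ f + 1 + bitLength (eval μ (mul e f))
  | div e f => cost μ e + cost μ f + 1 + bitLength (eval μ (div e f))

end Expr

/-- Programs.  `store k e f` writes the value of `f` to cell `e` of array `k`; a condition `e`
holds if its value is positive. -/
inductive Program : Type
  | skip : Program
  | store (k : ℕ) (index value : Expr) : Program
  | seq (P Q : Program) : Program
  | cond (e : Expr) (P Q : Program) : Program
  | loop (e : Expr) (P : Program) : Program

/-- The memory after writing `x` to cell `i` of array `k`. -/
def Memory.write (μ : Memory) (k i : ℕ) (x : ℚ) : Memory :=
  Function.update μ k (Function.update (μ k) i x)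

/-- `Runs P μ μ' w`: started in memory `μ`, program `P` halts in memory `μ'` at total cost `w`. -/
inductive Runs : Program → Memory → Memory → ℕ → Prop
  | skip (μ : Memory) : Runs .skip μ μ 1
  | store (k : ℕ) (e f : Expr) (μ : Memory) :
      Runs (.store k e f) μ (μ.write k ⌊e.eval μ⌋₊ (f.eval μ)) (e.cost μ + f.cost μ + 1)
  | seq {P Q : Program} {μ₁ μ₂ μ₃ : Memory} {w₁ w₂ : ℕ} :
      Runs P μ₁ μ₂ w₁ → Runs Q μ₂ μ₃ w₂ → Runs (.seq P Q) μ₁ μ₃ (w₁ + w₂ + 1)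
  | condTrue {e : Expr} {P Q : Program} {μ μ' : Memory} {w : ℕ} :
      0 < e.eval μ → Runs P μ μ' w → Runs (.cond e P Q) μ μ' (e.cost μ + w + 1)
  | condFalse {e : Expr} {P Q : Program} {μ μ' : Memory} {w : ℕ} :
      ¬ 0 < e.eval μ → Runs Q μ μ' w → Runs (.cond e P Q) μ μ' (e.cost μ + w + 1)
  | loopTrue {e : Expr} {P : Program} {μ₁ μ₂ μ₃ : Memory} {w₁ w₂ : ℕ} :
      0 < e.eval μ₁ → Runs P μ₁ μ₂ w₁ → Runs (.loop e P) μ₂ μ₃ w₂ →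
        Runs (.loop e P) μ₁ μ₃ (e.cost μ₁ + w₁ + w₂ + 1)
  | loopFalse {e : Expr} {P : Program} {μ : Memory} :
      ¬ 0 < e.eval μ → Runs (.loop e P) μ μ (e.cost μ + 1)

namespace IIDBoxes

/-- The input: array `0` holds `n, m, c, v`, array `1` holds the agent's values and array `2` the
probabilities.  All other cells are zero. -/
def input (I : IIDBoxes ℚ) : Memory := fun k i =>
  match k with
  | 0 => match i with
    | 0 => (I.n : ℚ)
    | 1 => (I.m : ℚ)
    | 2 => I.c
    | 3 => I.v
    | _ => 0
  | 1 => if h : i < I.m + 1 then I.a ⟨i, h⟩ else 0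
  | 2 => if h : i < I.m + 1 then I.q ⟨i, h⟩ else 0
  | _ => 0

/-- The size of the input: the number of boxes, the number of prizes, and the binary lengths of
all numbers. -/
def size (I : IIDBoxes ℚ) : ℕ :=
  I.n + (I.m + 1) + bitLength I.c + bitLength I.v +
    ∑ j, (bitLength (I.a j) + bitLength (I.q j))

/-- The output: array `3` holds the payment for prize `0` in each box. -/
def output (I : IIDBoxes ℚ) (μ : Memory) : Fin I.toReal.n → ℝ := fun i => ((μ 3 i : ℚ) : ℝ)

end IIDBoxes

end

/-!
The agent faces Pandora's problem, and by Weitzman's theorem his optimal utility is the expected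
largest capped payoff `min (payoff) (cap)`.  An optimal policy breaks ties in favour of the
principal, so the pair of both utilities, ordered lexicographically, is maximized.  Weitzman's bound
`Boxes.payoff_le` and his policy `Boxes.exists_policy` work for payoffs in any ordered real vector
space; applied to the lexicographic plane they give an optimal policy together with the principal's
utility (`Boxes.exists_optimalPolicy`).  The caps have to be fair in both coordinates.  The secondary
coordinate, called the bonus, is what makes this possible: it is positive only if prize `0` is
accepted at once (`IIDBoxes.isLexCap`).

For identically distributed boxes the payments may be sorted in decreasing order.  Then the first
box with a hit decides, and the revenue is a sum `∑ i, gain i (t i)` in which the `i`-th term depends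
on the `i`-th payment only (`IIDBoxes.weitzmanRevenue_eq`).  The first phase consists of the boxes in
which prize `0` is worth at least the basic cap.  Within each phase the gains are log-supermodular in
the position and the payment, whence a single payment per phase is best (`exists_sum_diagonal_le`).
The gain depends on the payment through the factor `v - t` and through step functions, so the
payments can be rounded down until a cap or the worth of prize `0` hits one of finitely many
values.  This leaves finitely many two-phase contracts (`IIDBoxes.exists_isPlan_ge`), and a best one
among them is optimal.

The algorithm enumerates these contracts.  All quantities involved are explicit: the smallest fair
cap is a maximum of linear expressions over the prizes (`IIDBoxes.cap`), and the payment that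
produces a given cap comes from the fairness equation (`IIDBoxes.payFor`).  The functions that random
access machines compute in polynomial time, `RAM.PolyTime`, contain the input and are closed under
arithmetic, case distinctions, sums, products and linear search.  The number lengths stay polynomial
since the terms of a sum have a common denominator of polynomial length (`bitLength_sum_le`).
-/

/-! ### Pandora's problem with payoffs in an ordered vector space -/

/-- The lexicographic plane is an ordered vector space, so that the results on Pandora's problem
below apply to it. -/
instance Prod.Lex.posSMulMono_real : PosSMulMono ℝ (ℝ ×ₗ ℝ) where
  smul_le_smul_of_nonneg_left r hr x y hxy := by
    rcases hr.eq_or_lt with rfl | hr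
    · simp
    · rw [Prod.Lex.le_iff] at hxy ⊢
      rcases hxy with h | ⟨h₁, h₂⟩
      · left
        simpa using mul_lt_mul_of_pos_left h hr
      · right
        exact ⟨by simpa using congrArg (r * ·) h₁, by simpa using mul_le_mul_of_nonneg_left h₂ hr.le⟩

namespace Boxes

variable {n m : ℕ} {L : Type*} [AddCommGroup L]

section Expectation

variable [Module ℝ L]

/-- The expected payoff of a policy if selecting prize `j` of box `i` yields `u i j` and opening
box `i` costs `c i`, with values in an arbitrary real vector space `L`.  With the lexicographic
plane for `L`, it records the utilities of both the agent and the principal. -/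
noncomputable def payoff (B : Boxes n m) (u : Fin n → Fin m → L) (c : Fin n → L) :
    {s : Seen n m} → Policy s → L
  | _, .quit => 0
  | _, .select i j _ => u i j
  | _, .inspect i _ next => (∑ j, B.p i j • payoff B u c (next j)) - c i

/-- The conditional probability, given what has been seen, that the boxes contain the prizes
`ω`. -/
noncomputable def weight (B : Boxes n m) (s : Seen n m) (ω : Fin n → Fin m) : ℝ :=
  ∏ i, (s i).elim (B.p i (ω i)) (fun j => if ω i = j then 1 else 0)

/-- The conditional expectation, given what has been seen, of a function of all the prizes. -/
noncomputable def expect (B : Boxes n m) (s : Seen n m) (f : (Fin n → Fin m) → L) : L :=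
  ∑ ω, B.weight s ω • f ω

theorem weight_nonneg (B : Boxes n m) (s : Seen n m) (ω : Fin n → Fin m) : 0 ≤ B.weight s ω := by
  refine Finset.prod_nonneg fun i _ => ?_
  cases s i with
  | none => exact B.p_nonneg _ _
  | some j => simp only [Option.elim]; split_ifs <;> norm_num

theorem weight_sum (B : Boxes n m) (s : Seen n m) : ∑ ω, B.weight s ω = 1 := by
  have := Finset.prod_univ_sum (fun _ : Fin n => (Finset.univ : Finset (Fin m)))
    (fun i j => (s i).elim (B.p i j) (fun j' => if j = j' then (1 : ℝ) else 0))
  rw [Fintype.piFinset_univ] at this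
  unfold weight
  rw [← this]
  refine Finset.prod_eq_one fun i _ => ?_
  cases s i with
  | none => exact B.p_sum i
  | some j => simp

theorem weight_eq_zero (B : Boxes n m) {s : Seen n m} {ω : Fin n → Fin m} {i : Fin n} {j : Fin m}
    (h : s i = some j) (hω : ω i ≠ j) : B.weight s ω = 0 :=
  Finset.prod_eq_zero (Finset.mem_univ i) (by simp [h, hω])

theorem weight_inspect (B : Boxes n m) {s : Seen n m} {i : Fin n} (h : s i = none)
    (ω : Fin n → Fin m) :
    B.weight s ω = ∑ j, B.p i j * B.weight (Function.update s i (some j)) ω := by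
  have key : ∀ j, B.weight (Function.update s i (some j)) ω = (if ω i = j then 1 else 0) *
      ∏ i' ∈ Finset.univ.erase i,
        (s i').elim (B.p i' (ω i')) (fun j => if ω i' = j then 1 else 0) := by
    intro j
    rw [weight, ← Finset.mul_prod_erase _ _ (Finset.mem_univ i)]
    congr 1
    · simp
    · refine Finset.prod_congr rfl fun i' hi' => ?_
      rw [Function.update_of_ne (Finset.ne_of_mem_erase hi')]
  simp_rw [key]
  rw [weight, ← Finset.mul_prod_erase _ _ (Finset.mem_univ i), h]
  simp

theorem expect_inspect (B : Boxes n m) {s : Seen n m} {i : Fin n} (h : s i = none)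
    (f : (Fin n → Fin m) → L) :
    B.expect s f = ∑ j, B.p i j • B.expect (Function.update s i (some j)) f := by
  simp only [expect, Finset.smul_sum, smul_smul]
  rw [Finset.sum_comm]
  refine Finset.sum_congr rfl fun ω _ => ?_
  rw [B.weight_inspect h, Finset.sum_smul]

variable [LinearOrder L] [IsOrderedAddMonoid L] [PosSMulMono ℝ L]

theorem expect_le (B : Boxes n m) {s : Seen n m} {f : (Fin n → Fin m) → L} {x : L}
    (h : ∀ ω : Fin n → Fin m, (∀ i j, s i = some j → ω i = j) → f ω ≤ x) : B.expect s f ≤ x := by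
  calc B.expect s f ≤ ∑ ω, B.weight s ω • x := by
        refine Finset.sum_le_sum fun ω _ => ?_
        by_cases hω : ∀ i j, s i = some j → ω i = j
        · exact smul_le_smul_of_nonneg_left (h ω hω) (B.weight_nonneg _ _)
        · push Not at hω
          obtain ⟨i, j, h₁, h₂⟩ := hω
          simp [B.weight_eq_zero h₁ h₂]
    _ = x := by rw [← Finset.sum_smul, B.weight_sum, one_smul]

theorem le_expect (B : Boxes n m) {s : Seen n m} {f : (Fin n → Fin m) → L} {x : L}
    (h : ∀ ω : Fin n → Fin m, (∀ i j, s i = some j → ω i = j) → x ≤ f ω) : x ≤ B.expect s f := by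
  have := B.expect_le (s := s) (f := fun ω => - f ω) (x := -x)
    fun ω hω => neg_le_neg (h ω hω)
  simpa [expect] using this

end Expectation

variable [LinearOrder L]

/-- The largest of the capped payoffs `min (u i (ω i)) (θ i)` of the boxes, or zero if all are
negative. -/
def maxCapped (u : Fin n → Fin m → L) (θ : Fin n → L) (ω : Fin n → Fin m) : L :=
  Finset.univ.fold max 0 (fun i => min (u i (ω i)) (θ i))

theorem zero_le_maxCapped (u : Fin n → Fin m → L) (θ : Fin n → L) (ω : Fin n → Fin m) :
    0 ≤ maxCapped u θ ω := (Finset.le_fold_max _).2 (Or.inl le_rfl)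

theorem le_maxCapped (u : Fin n → Fin m → L) (θ : Fin n → L) (ω : Fin n → Fin m) (i : Fin n) :
    min (u i (ω i)) (θ i) ≤ maxCapped u θ ω :=
  (Finset.le_fold_max _).2 (Or.inr ⟨i, Finset.mem_univ i, le_rfl⟩)

theorem maxCapped_le {u : Fin n → Fin m → L} {θ : Fin n → L} {ω : Fin n → Fin m} {x : L}
    (h₀ : 0 ≤ x) (h : ∀ i, min (u i (ω i)) (θ i) ≤ x) : maxCapped u θ ω ≤ x :=
  (Finset.fold_max_le _).2 ⟨h₀, fun i _ => h i⟩

theorem maxCapped_eq (u : Fin n → Fin m → L) (θ : Fin n → L) (ω : Fin n → Fin m) :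
    maxCapped u θ ω = 0 ∨ ∃ i, maxCapped u θ ω = min (u i (ω i)) (θ i) := by
  rcases (Finset.le_fold_max _).1 (le_refl (maxCapped u θ ω)) with h | ⟨i, _, h⟩
  · exact Or.inl (le_antisymm h (zero_le_maxCapped u θ ω))
  · exact Or.inr ⟨i, le_antisymm h (le_maxCapped u θ ω i)⟩

/-- The total amount by which the payoffs of the opened boxes exceed their caps. -/
def excess (u : Fin n → Fin m → L) (θ : Fin n → L) (s : Seen n m) : L :=
  ∑ i, (s i).elim 0 (fun j => max 0 (u i j - θ i))

theorem excess_update (u : Fin n → Fin m → L) (θ : Fin n → L) {s : Seen n m} {i : Fin n}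
    (h : s i = none) (j : Fin m) :
    excess u θ (Function.update s i (some j)) = max 0 (u i j - θ i) + excess u θ s := by
  unfold excess
  rw [← Finset.add_sum_erase _ _ (Finset.mem_univ i),
    ← Finset.add_sum_erase _ (fun i => (s i).elim 0 (fun j => max 0 (u i j - θ i)))
      (Finset.mem_univ i)]
  simp only [Function.update_self, h, Option.elim, zero_add]
  congr 1
  refine Finset.sum_congr rfl fun i' hi' => ?_
  rw [Function.update_of_ne (Finset.ne_of_mem_erase hi')]

variable [IsOrderedAddMonoid L]

theorem excess_nonneg (u : Fin n → Fin m → L) (θ : Fin n → L) (s : Seen n m) :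
    0 ≤ excess u θ s := by
  refine Finset.sum_nonneg fun i _ => ?_
  cases s i <;> simp

theorem le_excess (u : Fin n → Fin m → L) (θ : Fin n → L) {s : Seen n m} {i : Fin n} {j : Fin m}
    (h : s i = some j) : max 0 (u i j - θ i) ≤ excess u θ s := by
  have := Finset.single_le_sum (s := Finset.univ)
    (f := fun i => (s i).elim 0 (fun j => max 0 (u i j - θ i)))
    (fun i _ => by cases s i <;> simp) (Finset.mem_univ i)
  rwa [h] at this

variable [Module ℝ L] [PosSMulMono ℝ L]

/-- Weitzman's bound: with fair caps `θ`, no policy gains more than the expected largest capped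
payoff.  The excesses of the boxes opened already are sunk and enter as a correction. -/
theorem payoff_le (B : Boxes n m) {u : Fin n → Fin m → L} {c θ : Fin n → L}
    (hθ : ∀ i, ∑ j, B.p i j • max 0 (u i j - θ i) = c i) {s : Seen n m} (π : Policy s) :
    B.payoff u c π ≤ B.expect s (maxCapped u θ) + excess u θ s := by
  induction π with
  | @quit s =>
    exact add_nonneg (B.le_expect fun ω _ => zero_le_maxCapped u θ ω) (excess_nonneg u θ s)
  | @select s i j h =>
    calc u i j = min (u i j) (θ i) + max 0 (u i j - θ i) := by
          rcases le_total (u i j) (θ i) with h | h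
          · simp [h]
          · simp [h]
      _ ≤ _ := by
          refine add_le_add (B.le_expect fun ω hω => ?_) (le_excess u θ h)
          rw [← hω i j h]
          exact le_maxCapped u θ ω i
  | @inspect s i h next ih =>
    rw [payoff, sub_le_iff_le_add, B.expect_inspect h, ← hθ i]
    calc ∑ j, B.p i j • B.payoff u c (next j)
        ≤ ∑ j, B.p i j • (B.expect (Function.update s i (some j)) (maxCapped u θ) +
            (max 0 (u i j - θ i) + excess u θ s)) := by
          refine Finset.sum_le_sum fun j _ => smul_le_smul_of_nonneg_left ?_ (B.p_nonneg i j)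
          rw [← excess_update u θ h]
          exact ih j
      _ = _ := by
          simp only [smul_add, Finset.sum_add_distrib, ← Finset.sum_smul, B.p_sum, one_smul]
          abel

/-- If no opened box exceeds its cap and the best payoff in sight is above all caps of unopened
boxes, stopping is worth the expected largest capped payoff. -/
theorem exists_policy_of_quit (B : Boxes n (m + 1)) {u : Fin n → Fin (m + 1) → L} {c θ : Fin n → L}
    (s : Seen n (m + 1)) (hs : ∀ i j, s i = some j → u i j ≤ θ i)
    (hquit : ∀ i, s i = none → θ i < 0 ∨ ∃ i' j', s i' = some j' ∧ θ i < u i' j') (k : ℕ) :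
    ∃ π : Policy s, B.payoff u c π = B.expect s (maxCapped u θ) ∧ π.InOrder ∧
      π.AcceptsZeroAtOnce k := by
  by_cases hneg : ∀ i j, s i = some j → u i j ≤ 0
  · refine ⟨.quit, le_antisymm (B.le_expect fun ω _ => zero_le_maxCapped u θ ω)
      (B.expect_le fun ω hω => maxCapped_le le_rfl fun i => ?_), trivial, trivial⟩
    cases hi : s i with
    | none =>
      rcases hquit i hi with h | ⟨i', j', h₁, h₂⟩
      · exact (min_le_right _ _).trans h.le
      · exact (min_le_right _ _).trans (h₂.le.trans (hneg i' j' h₁))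
    | some j =>
      rw [hω i j hi]
      exact (min_le_left _ _).trans (hneg i j hi)
  · push Not at hneg
    obtain ⟨i₀, j₀, h₀, hpos₀⟩ := hneg
    -- a selectable prize with the largest payoff
    obtain ⟨⟨i₁, j₁⟩, hmem, hmax⟩ := (Finset.univ.filter fun x : Fin n × Fin (m + 1) =>
      s x.1 = some x.2).exists_max_image (fun x => u x.1 x.2) ⟨(i₀, j₀), by simp [h₀]⟩
    simp only [Finset.mem_filter, Finset.mem_univ, true_and, Prod.forall] at hmem hmax
    have hpos : 0 < u i₁ j₁ := hpos₀.trans_le (hmax i₀ j₀ h₀)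
    refine ⟨.select i₁ j₁ hmem, le_antisymm (B.le_expect fun ω hω => ?_)
      (B.expect_le fun ω hω => maxCapped_le hpos.le fun i => ?_), trivial, trivial⟩
    · refine le_trans ?_ (le_maxCapped u θ ω i₁)
      rw [hω _ _ hmem]
      exact le_min le_rfl (hs _ _ hmem)
    · cases hi : s i with
      | none =>
        rcases hquit i hi with h | ⟨i', j', h₁, h₂⟩
        · exact (min_le_right _ _).trans (h.trans hpos).le
        · exact (min_le_right _ _).trans (h₂.le.trans (hmax i' j' h₁))
      | some j =>
        rw [hω i j hi]
        exact (min_le_left _ _).trans (hmax i j hi)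

/-- Weitzman's policy: open an unopened box of largest cap as long as that cap is not exceeded by
what is in sight, and select a prize at once if it reaches the cap of its box.  It attains the
bound `Boxes.payoff_le`. -/
theorem exists_policy (B : Boxes n (m + 1)) {u : Fin n → Fin (m + 1) → L} {c θ : Fin n → L}
    (hθ : ∀ i, ∑ j, B.p i j • max 0 (u i j - θ i) = c i) (k : ℕ)
    (hk : ∀ i : Fin n, (i : ℕ) < k → θ i ≤ u i 0) (s : Seen n (m + 1))
    (hs : ∀ i j, s i = some j → u i j ≤ θ i) :
    ∃ π : Policy s, B.payoff u c π = B.expect s (maxCapped u θ) ∧ (Antitone θ → π.InOrder) ∧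
      π.AcceptsZeroAtOnce k := by
  obtain ⟨N, hN⟩ : ∃ N, (Finset.univ.filter fun i => s i = none).card = N := ⟨_, rfl⟩
  induction N generalizing s with
  | zero =>
    have hne : ∀ i, s i ≠ none := by simpa [Finset.filter_eq_empty_iff] using hN
    obtain ⟨π, h₁, h₂, h₃⟩ := B.exists_policy_of_quit (c := c) s hs
      (fun i hi => absurd hi (hne i)) k
    exact ⟨π, h₁, fun _ => h₂, h₃⟩
  | succ N ih =>
    have hne : (Finset.univ.filter fun i => s i = none).Nonempty := by
      rw [← Finset.card_pos]; omega
    obtain ⟨i, hi, hmax, hord⟩ : ∃ i, s i = none ∧ (∀ i', s i' = none → θ i' ≤ θ i) ∧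
        (Antitone θ → ∀ i' < i, s i' ≠ none) := by
      by_cases hanti : Antitone θ
      · refine ⟨_, (Finset.mem_filter.1 (Finset.min'_mem _ hne)).2, fun i' hi' => ?_,
          fun _ i' hi' h => ?_⟩
        · exact hanti (Finset.min'_le _ _ (by simp [hi']))
        · exact absurd (Finset.min'_le _ _ (by simp [h])) (not_le.2 hi')
      · obtain ⟨i, hi, hmax⟩ := Finset.exists_max_image _ θ hne
        simp only [Finset.mem_filter, Finset.mem_univ, true_and] at hi hmax
        exact ⟨i, hi, hmax, fun h => absurd h hanti⟩
    by_cases hquit : θ i < 0 ∨ ∃ i' j', s i' = some j' ∧ θ i < u i' j'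
    · obtain ⟨π, h₁, h₂, h₃⟩ := B.exists_policy_of_quit (c := c) s hs (fun i' hi' => by
        rcases hquit with h | ⟨i₁, j₁, h₁, h₂⟩
        · exact Or.inl ((hmax i' hi').trans_lt h)
        · exact Or.inr ⟨i₁, j₁, h₁, (hmax i' hi').trans_lt h₂⟩) k
      exact ⟨π, h₁, fun _ => h₂, h₃⟩
    push Not at hquit
    obtain ⟨hpos, hbest⟩ := hquit
    have hnext : ∀ j, ∃ π : Policy (Function.update s i (some j)),
        B.payoff u c π = B.expect (Function.update s i (some j)) (maxCapped u θ) +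
          max 0 (u i j - θ i) ∧ (Antitone θ → π.InOrder) ∧ π.AcceptsZeroAtOnce k ∧
        (θ i ≤ u i j → π = .select i j (by simp)) := by
      intro j
      have hsel : Function.update s i (some j) i = some j := by simp
      by_cases hj : θ i ≤ u i j
      · refine ⟨.select i j hsel, ?_, fun _ => trivial, trivial, fun _ => rfl⟩
        -- the largest capped payoff is certainly the cap of the box just opened
        have : B.expect (Function.update s i (some j)) (maxCapped u θ) = θ i := by
          refine le_antisymm (B.expect_le fun ω hω => maxCapped_le hpos fun i' => ?_)
            (B.le_expect fun ω hω => ?_)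
          · by_cases hii : i' = i
            · subst hii; exact min_le_right _ _
            cases hi' : s i' with
            | none => exact (min_le_right _ _).trans (hmax i' hi')
            | some j' =>
              rw [hω i' j' (by rw [Function.update_of_ne hii, hi'])]
              exact (min_le_left _ _).trans (hbest i' j' hi')
          · refine le_trans ?_ (le_maxCapped u θ ω i)
            rw [hω i j (by simp)]
            exact le_min hj le_rfl
        rw [this, payoff, max_eq_right (sub_nonneg.2 hj)]
        abel
      · push Not at hj
        obtain ⟨π, h₁, h₂, h₃⟩ := ih (Function.update s i (some j)) (by
          intro i' j' h'
          by_cases hii : i' = i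
          · subst hii
            simp only [Function.update_self, Option.some.injEq] at h'
            subst h'
            exact hj.le
          · rw [Function.update_of_ne hii] at h'
            exact hs i' j' h') (by
          have : (Finset.univ.filter fun i' => Function.update s i (some j) i' = none) =
              (Finset.univ.filter fun i' => s i' = none).erase i := by
            ext i'
            by_cases hii : i' = i
            · subst hii; simp
            · simp [hii]
          rw [this, Finset.card_erase_of_mem (by simp [hi]), hN]
          rfl)
        refine ⟨π, ?_, h₂, h₃, fun h => absurd h (not_le.2 hj)⟩
        rw [h₁, max_eq_left (sub_nonpos.2 hj.le), add_zero]
    choose next h₁ h₂ h₃ h₄ using hnext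
    refine ⟨.inspect i hi next, ?_, fun hanti => ⟨hord hanti, fun j => h₂ j hanti⟩,
      fun hik => h₄ 0 (hk i hik), h₃⟩
    rw [payoff, B.expect_inspect hi, ← hθ i]
    simp only [h₁, smul_add, Finset.sum_add_distrib, add_sub_cancel_right]

end Boxes

/-! ### Fair caps as functions of the payment -/

namespace IIDBoxes

section Definitions

variable {K : Type} [Field K] [LinearOrder K] (I : IIDBoxes K)

/-- The value of prize `j` to the agent when prize `0` carries the payment `t`. -/
def worth (t : K) (j : Fin (I.m + 1)) : K := I.a j + if j = 0 then t else 0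

/-- The expected amount by which the worth of the prize of a box exceeds `x`. -/
def overshoot (t x : K) : K := ∑ j, I.q j * max 0 (I.worth t j - x)

/-- The number `x` at which the prizes worth at least as much as prize `j` exceed `x` by the
opening cost in expectation.  If these prizes have probability zero, it is replaced by `-c`,
which is never above the fair cap. -/
def capBound (t : K) (j : Fin (I.m + 1)) : K :=
  if 0 < ∑ l, (if I.worth t j ≤ I.worth t l then I.q l else 0) then
    ((∑ l, if I.worth t j ≤ I.worth t l then I.q l * I.worth t l else 0) - I.c) /
      ∑ l, (if I.worth t j ≤ I.worth t l then I.q l else 0)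
  else -I.c

/-- The fair cap of a box with payment `t` for prize `0`: the smallest one, if the opening cost is
zero and fair caps are not unique. -/
def cap (t : K) : K := Finset.univ.sup' Finset.univ_nonempty (I.capBound t)

/-- The probability that a box contains a prize other than `0` worth at most `x`. -/
def below (x : K) : K := ∑ j, if j ≠ 0 ∧ I.a j ≤ x then I.q j else 0

/-- The contribution of the `i`-th box (counted from `0`) to the principal's expected utility, if
its payment is `t` and the payments decrease along the boxes.  The alternatives are the two
phases: if `a₀ + t` reaches the basic cap, prize `0` is accepted at once, and otherwise it has to
compete with the prizes of all later boxes.  A box with a negative cap is not opened. -/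
def gain (i : ℕ) (t : K) : K :=
  I.q 0 * (I.v - t) *
    if I.cap 0 ≤ I.a 0 + t then (if 0 ≤ I.cap t then I.below (I.cap t) ^ i else 0)
    else I.below (I.a 0 + t) ^ i * (I.below (I.a 0 + t) + I.q 0) ^ (I.n - 1 - i)

end Definitions

variable (I : IIDBoxes ℝ)

theorem worth_nonneg {t : ℝ} (ht : 0 ≤ t) (j : Fin (I.m + 1)) : 0 ≤ I.worth t j := by
  unfold worth
  have := I.a_nonneg j
  split_ifs <;> linarith

theorem overshoot_eq (t x : ℝ) : I.overshoot t x = I.q 0 * max 0 (I.a 0 + t - x) +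
    ∑ j : Fin I.m, I.q j.succ * max 0 (I.a j.succ - x) := by
  simp [overshoot, worth, Fin.sum_univ_succ, Fin.succ_ne_zero]

theorem overshoot_mono {t t' : ℝ} (h : t ≤ t') (x : ℝ) : I.overshoot t x ≤ I.overshoot t' x := by
  rw [overshoot_eq, overshoot_eq]
  gcongr
  exact I.q_nonneg 0

theorem overshoot_antitone (t : ℝ) : Antitone (I.overshoot t) := by
  intro x y h
  refine Finset.sum_le_sum fun j _ => mul_le_mul_of_nonneg_left ?_ (I.q_nonneg j)
  exact max_le_max le_rfl (by linarith)

/-- Any set of prizes contributes at most the whole overshoot. -/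
theorem partial_le_overshoot (t x : ℝ) (p : Fin (I.m + 1) → Prop) [DecidablePred p] :
    (∑ l, if p l then I.q l * I.worth t l else 0) - (∑ l, if p l then I.q l else 0) * x ≤
      I.overshoot t x := by
  rw [Finset.sum_mul, ← Finset.sum_sub_distrib]
  refine Finset.sum_le_sum fun j _ => ?_
  have h₁ := le_max_right 0 (I.worth t j - x)
  have h₂ := le_max_left 0 (I.worth t j - x)
  have := I.q_nonneg j
  split_ifs
  · nlinarith
  · simpa using mul_nonneg this h₂

/-- The cap is below all `x` whose overshoot does not exceed the opening cost. -/
theorem cap_le {t x : ℝ} (ht : 0 ≤ t) (h : I.overshoot t x ≤ I.c) : I.cap t ≤ x := by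
  refine Finset.sup'_le _ _ fun j _ => ?_
  unfold capBound
  split_ifs with hQ
  · rw [div_le_iff₀ hQ]
    have := I.partial_le_overshoot t x (fun l => I.worth t j ≤ I.worth t l)
    linarith
  · have h₁ := I.partial_le_overshoot t x (fun _ => True)
    have h₂ : 0 ≤ ∑ l, I.q l * I.worth t l :=
      Finset.sum_nonneg fun l _ => mul_nonneg (I.q_nonneg l) (I.worth_nonneg ht l)
    simp only [if_true, I.q_sum, one_mul] at h₁
    linarith

/-- The cap is fair. -/
theorem overshoot_cap {t : ℝ} (ht : 0 ≤ t) : I.overshoot t (I.cap t) = I.c := by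
  apply le_antisymm
  · by_cases hne : (Finset.univ.filter fun j => I.cap t < I.worth t j).Nonempty
    · obtain ⟨j, hj, hmin⟩ := Finset.exists_min_image _ (I.worth t) hne
      simp only [Finset.mem_filter, Finset.mem_univ, true_and] at hj hmin
      have hcap : I.capBound t j ≤ I.cap t := Finset.le_sup' _ (Finset.mem_univ j)
      have hset : ∀ l, I.worth t j ≤ I.worth t l ↔ I.cap t < I.worth t l :=
        fun l => ⟨fun h => hj.trans_le h, hmin l⟩
      -- the overshoot comes from the prizes worth at least as much as prize `j`
      have hsum : I.overshoot t (I.cap t) =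
          (∑ l, if I.worth t j ≤ I.worth t l then I.q l * I.worth t l else 0) -
            (∑ l, if I.worth t j ≤ I.worth t l then I.q l else 0) * I.cap t := by
        rw [Finset.sum_mul, ← Finset.sum_sub_distrib]
        refine Finset.sum_congr rfl fun l _ => ?_
        by_cases h : I.cap t < I.worth t l
        · rw [if_pos ((hset l).2 h), if_pos ((hset l).2 h), max_eq_right (by linarith)]
          ring
        · rw [if_neg (mt (hset l).1 h), if_neg (mt (hset l).1 h), max_eq_left (by linarith)]
          ring
      unfold capBound at hcap
      split_ifs at hcap with hQ
      · rw [div_le_iff₀ hQ] at hcap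
        linarith
      · rw [not_lt] at hQ
        have hzero : ∀ l, (if I.worth t j ≤ I.worth t l then I.q l else 0) = 0 := by
          have hn : ∀ l, 0 ≤ (if I.worth t j ≤ I.worth t l then I.q l else 0) := fun l => by
            split_ifs
            exacts [I.q_nonneg l, le_rfl]
          intro l
          refine le_antisymm (le_trans ?_ hQ) (hn l)
          exact Finset.single_le_sum (fun l _ => hn l) (Finset.mem_univ l)
        have : ∀ l, (if I.worth t j ≤ I.worth t l then I.q l * I.worth t l else 0) = 0 := by
          intro l
          have := hzero l
          split_ifs at this ⊢ <;> simp [this]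
        rw [hsum]
        simp only [this, hzero, Finset.sum_const_zero, zero_mul, sub_zero]
        exact I.c_nonneg
    · have : I.overshoot t (I.cap t) = 0 := by
        refine Finset.sum_eq_zero fun j _ => ?_
        rw [Finset.not_nonempty_iff_eq_empty, Finset.filter_eq_empty_iff] at hne
        have := hne (Finset.mem_univ j)
        rw [max_eq_left (by linarith), mul_zero]
      rw [this]
      exact I.c_nonneg
  · obtain ⟨j, _, hj⟩ := Finset.exists_mem_eq_sup' Finset.univ_nonempty (I.capBound t)
    have hj : I.cap t = I.capBound t j := hj
    unfold capBound at hj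
    split_ifs at hj with hQ
    · have := I.partial_le_overshoot t (I.cap t) (fun l => I.worth t j ≤ I.worth t l)
      rw [eq_div_iff hQ.ne'] at hj
      linarith
    · have h₁ := I.partial_le_overshoot t (I.cap t) (fun _ => True)
      have h₂ : 0 ≤ ∑ l, I.q l * I.worth t l :=
        Finset.sum_nonneg fun l _ => mul_nonneg (I.q_nonneg l) (I.worth_nonneg ht l)
      simp only [if_true, I.q_sum, one_mul] at h₁
      linarith

theorem cap_mono {t t' : ℝ} (ht : 0 ≤ t) (h : t ≤ t') : I.cap t ≤ I.cap t' :=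
  I.cap_le ht ((I.overshoot_mono h _).trans (I.overshoot_cap (ht.trans h)).le)

/-- Payments that leave prize `0` below the basic cap do not change the cap. -/
theorem cap_eq_of_lt {t : ℝ} (ht : 0 ≤ t) (h : I.a 0 + t < I.cap 0) : I.cap t = I.cap 0 := by
  refine le_antisymm (I.cap_le ht ?_) (I.cap_mono le_rfl ht)
  rw [← I.overshoot_cap le_rfl, overshoot_eq, overshoot_eq, max_eq_left (by linarith),
    max_eq_left (by linarith)]

theorem cap_le_of_le {t : ℝ} (ht : 0 ≤ t) (h : I.cap 0 ≤ I.a 0 + t) : I.cap t ≤ I.a 0 + t := by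
  refine I.cap_le ht ?_
  refine le_trans ?_ ((I.overshoot_antitone 0 h).trans (I.overshoot_cap le_rfl).le)
  rw [overshoot_eq, overshoot_eq, max_eq_left (by linarith), max_eq_left (by linarith)]

/-- Once prize `0` reaches the basic cap, larger payments increase the cap strictly. -/
theorem cap_lt_cap {t t' : ℝ} (ht : 0 ≤ t) (h : t < t') (hq : 0 < I.q 0)
    (hphase : I.cap 0 ≤ I.a 0 + t) : I.cap t < I.cap t' := by
  refine lt_of_le_of_ne (I.cap_mono ht h.le) fun heq => ?_
  have h₁ := I.overshoot_cap ht
  have h₂ := I.overshoot_cap (ht.trans h.le)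
  have h₃ := I.cap_le_of_le ht hphase
  rw [← heq, overshoot_eq, max_eq_right (by linarith)] at h₂
  rw [overshoot_eq, max_eq_right (by linarith)] at h₁
  nlinarith

theorem cap_eq_of_q_zero {t : ℝ} (ht : 0 ≤ t) (hq : I.q 0 = 0) : I.cap t = I.cap 0 := by
  refine le_antisymm (I.cap_le ht ?_) (I.cap_mono le_rfl ht)
  rw [← I.overshoot_cap le_rfl, overshoot_eq, overshoot_eq, hq]
  simp

/-- The cap of the payment that solves the fairness equation for `x`. -/
theorem cap_eq {t x : ℝ} (ht : 0 ≤ t) (hq : 0 < I.q 0) (hx : x ≤ I.a 0 + t)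
    (h : I.overshoot t x = I.c) : I.cap t = x := by
  refine le_antisymm (I.cap_le ht h.le) ?_
  by_contra! hlt
  have h₁ := I.overshoot_cap ht
  rw [overshoot_eq, max_eq_right (by linarith)] at h h₁
  have : ∑ j : Fin I.m, I.q j.succ * max 0 (I.a j.succ - x) ≤
      ∑ j : Fin I.m, I.q j.succ * max 0 (I.a j.succ - I.cap t) := by
    refine Finset.sum_le_sum fun j _ => mul_le_mul_of_nonneg_left ?_ (I.q_nonneg _)
    exact max_le_max le_rfl (by linarith)
  nlinarith

theorem isFairCap_iff (t : Fin I.n → ℝ) (i : Fin I.n) (x : ℝ) :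
    I.toBoxes.IsFairCap (I.payments t) i x ↔ I.overshoot (t i) x = I.c := Iff.rfl

theorem below_nonneg (x : ℝ) : 0 ≤ I.below x := by
  refine Finset.sum_nonneg fun j _ => ?_
  split_ifs
  exacts [I.q_nonneg j, le_rfl]

theorem below_mono : Monotone I.below := by
  intro x y h
  refine Finset.sum_le_sum fun j _ => ?_
  have := I.q_nonneg j
  split_ifs with h₁ h₂
  exacts [le_rfl, absurd ⟨h₁.1, h₁.2.trans h⟩ h₂, this, le_rfl]

theorem below_add_above (x : ℝ) :
    I.below x + ∑ j, (if j = 0 ∨ x < I.a j then I.q j else 0) = 1 := by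
  rw [below, ← Finset.sum_add_distrib, ← I.q_sum]
  refine Finset.sum_congr rfl fun j _ => ?_
  by_cases h : j = 0 ∨ x < I.a j
  · rw [if_pos h, if_neg (by rcases h with h | h <;> simp [h]), zero_add]
  · rw [if_neg h, if_pos (by push Not at h; exact h), add_zero]

theorem below_add_q_le (x : ℝ) : I.below x + I.q 0 ≤ 1 := by
  rw [← I.below_add_above x]
  gcongr
  have := Finset.single_le_sum (s := Finset.univ)
    (f := fun j => if j = 0 ∨ x < I.a j then I.q j else 0)
    (fun j _ => by split_ifs; exacts [I.q_nonneg j, le_rfl]) (Finset.mem_univ 0)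
  simpa using this

theorem gain_nonneg {i : ℕ} {t : ℝ} (ht : t ≤ I.v) : 0 ≤ I.gain i t := by
  have h := I.below_nonneg
  have hq := I.q_nonneg 0
  unfold gain
  refine mul_nonneg (mul_nonneg hq (by linarith)) ?_
  split_ifs
  · exact pow_nonneg (h _) _
  · exact le_rfl
  · exact mul_nonneg (pow_nonneg (h _) _) (pow_nonneg (add_nonneg (h _) hq) _)

end IIDBoxes

/-! ### Optimal policies and the lexicographic Pandora problem -/

namespace Boxes

variable {n m : ℕ}

/-- The payoffs of the agent and, to break ties, of the principal. -/
def lexPayoff (B : Boxes n m) (T : Fin n → Fin m → ℝ) (i : Fin n) (j : Fin m) : ℝ ×ₗ ℝ :=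
  toLex (B.a i j + T i j, B.b i j - T i j)

/-- The opening costs are borne by the agent. -/
def lexCost (B : Boxes n m) (i : Fin n) : ℝ ×ₗ ℝ := toLex (B.cost i, 0)

/-- The second coordinate as an additive map. -/
def lexSnd : (ℝ ×ₗ ℝ) →+ ℝ where
  toFun x := (ofLex x).2
  map_zero' := rfl
  map_add' _ _ := rfl

/-- The first coordinate as an additive map. -/
def lexFst : (ℝ ×ₗ ℝ) →+ ℝ where
  toFun x := (ofLex x).1
  map_zero' := rfl
  map_add' _ _ := rfl

theorem lex_ext {x y : ℝ ×ₗ ℝ} (h₁ : lexFst x = lexFst y) (h₂ : lexSnd x = lexSnd y) : x = y :=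
  Prod.ext h₁ h₂

theorem lexFst_smul (r : ℝ) (x : ℝ ×ₗ ℝ) : lexFst (r • x) = r * lexFst x := rfl

theorem lexSnd_smul (r : ℝ) (x : ℝ ×ₗ ℝ) : lexSnd (r • x) = r * lexSnd x := rfl

theorem lexFst_toLex (x y : ℝ) : lexFst (toLex (x, y)) = x := rfl

theorem lexSnd_toLex (x y : ℝ) : lexSnd (toLex (x, y)) = y := rfl

theorem lex_le_iff {x y : ℝ ×ₗ ℝ} :
    x ≤ y ↔ lexFst x < lexFst y ∨ lexFst x = lexFst y ∧ lexSnd x ≤ lexSnd y :=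
  Prod.Lex.le_iff

theorem lexFst_mono : Monotone lexFst := fun _ _ h =>
  (lex_le_iff.1 h).elim le_of_lt fun h => h.1.le

theorem payoff_eq (B : Boxes n m) (T : Fin n → Fin m → ℝ) {s : Seen n m} (π : Policy s) :
    B.payoff (B.lexPayoff T) B.lexCost π =
      toLex (B.agentUtility T π, B.principalUtility T π) := by
  induction π with
  | quit => rfl
  | select i j h => rfl
  | inspect i h next ih =>
    simp only [payoff, agentUtility, principalUtility, ih]
    apply lex_ext
    · simp [map_sub, map_sum, lexFst_smul, lexFst_toLex, lexCost]
    · simp [map_sub, map_sum, lexSnd_smul, lexSnd_toLex, lexCost]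

/-- `θ` consists of caps that are fair for both coordinates. -/
def IsLexCap (B : Boxes n m) (T : Fin n → Fin m → ℝ) (θ : Fin n → ℝ ×ₗ ℝ) : Prop :=
  ∀ i, ∑ j, B.p i j • max 0 (B.lexPayoff T i j - θ i) = B.lexCost i

/-- The principal's expected utility from Weitzman's policy with caps `θ`. -/
noncomputable def weitzmanRevenue (B : Boxes n m) (T : Fin n → Fin m → ℝ) (θ : Fin n → ℝ ×ₗ ℝ) : ℝ :=
  ∑ ω : Fin n → Fin m, (∏ i, B.p i (ω i)) * lexSnd (maxCapped (B.lexPayoff T) θ ω)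

theorem lexSnd_expect (B : Boxes n m) (T : Fin n → Fin m → ℝ) (θ : Fin n → ℝ ×ₗ ℝ) :
    lexSnd (B.expect (Seen.start n m) (maxCapped (B.lexPayoff T) θ)) =
      B.weitzmanRevenue T θ := by
  simp only [expect, map_sum, lexSnd_smul]
  rfl

/-- A policy is optimal as soon as it attains Weitzman's bound in the lexicographic problem. -/
theorem isOptimalPolicy_of_payoff_eq (B : Boxes n m) {T : Fin n → Fin m → ℝ} {θ : Fin n → ℝ ×ₗ ℝ}
    (hθ : B.IsLexCap T θ) {π : Policy (Seen.start n m)}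
    (hπ : B.payoff (B.lexPayoff T) B.lexCost π =
      B.expect (Seen.start n m) (maxCapped (B.lexPayoff T) θ)) : B.IsOptimalPolicy T π := by
  have key : ∀ π' : Policy (Seen.start n m), B.agentUtility T π' < B.agentUtility T π ∨
      B.agentUtility T π' = B.agentUtility T π ∧
        B.principalUtility T π' ≤ B.principalUtility T π := by
    intro π'
    have h := B.payoff_le hθ π'
    have h₀ : excess (B.lexPayoff T) θ (Seen.start n m) = 0 := by simp [excess, Seen.start]
    rw [h₀, add_zero, ← hπ, payoff_eq, payoff_eq, lex_le_iff] at h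
    exact h
  refine ⟨fun π' => (key π').elim le_of_lt fun h => h.1.le, fun π' hπ' => ?_⟩
  rcases key π' with h | h
  · exact absurd (hπ' π) (not_le.2 h)
  · exact h.2

/-- In the lexicographic problem Weitzman's policy maximizes the agent's utility and, subject to
that, the principal's. -/
theorem exists_optimalPolicy {m : ℕ} (B : Boxes n (m + 1)) {T : Fin n → Fin (m + 1) → ℝ}
    {θ : Fin n → ℝ ×ₗ ℝ} (hθ : B.IsLexCap T θ) (k : ℕ)
    (hk : ∀ i : Fin n, (i : ℕ) < k → θ i ≤ B.lexPayoff T i 0) :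
    ∃ π : Policy (Seen.start n (m + 1)), B.IsOptimalPolicy T π ∧ (Antitone θ → π.InOrder) ∧
      π.AcceptsZeroAtOnce k ∧ B.principalUtility T π = B.weitzmanRevenue T θ := by
  obtain ⟨π, h₁, h₂, h₃⟩ := B.exists_policy hθ k hk (Seen.start n (m + 1))
    (fun i j h => by simp [Seen.start] at h)
  refine ⟨π, B.isOptimalPolicy_of_payoff_eq hθ h₁, h₂, h₃, ?_⟩
  rw [← B.lexSnd_expect, ← h₁, payoff_eq]
  rfl

theorem IsOptimalPolicy.principalUtility_eq {m : ℕ} {B : Boxes n (m + 1)}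
    {T : Fin n → Fin (m + 1) → ℝ} {θ : Fin n → ℝ ×ₗ ℝ} (hθ : B.IsLexCap T θ)
    {π : Policy (Seen.start n (m + 1))} (hπ : B.IsOptimalPolicy T π) :
    B.principalUtility T π = B.weitzmanRevenue T θ := by
  obtain ⟨π', h₁, -, -, h₂⟩ := B.exists_optimalPolicy hθ 0 (by simp)
  rw [← h₂]
  exact le_antisymm (h₁.2 π hπ.1) (hπ.2 π' h₁.1)

end Boxes

/-! ### The revenue of a contract for identically distributed boxes -/

namespace IIDBoxes

open Boxes

variable (I : IIDBoxes ℝ)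

/-- The secondary coordinate of the cap: what the principal gains, per unit of probability that a
box ends the search, if prize `0` is accepted at once.  It vanishes if prize `0` is worth less to
the agent than the cap. -/
noncomputable def bonus (t : ℝ) : ℝ :=
  if I.cap 0 ≤ I.a 0 + t then I.q 0 * (I.v - t) / (1 - I.below (I.cap t)) else 0

/-- The fair cap in the lexicographic problem. -/
noncomputable def lexCap (t : ℝ) : ℝ ×ₗ ℝ := toLex (I.cap t, I.bonus t)

/-- The lexicographic payoff of prize `j` in a box with payment `t`. -/
noncomputable def prizePayoff (t : ℝ) (j : Fin (I.m + 1)) : ℝ ×ₗ ℝ :=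
  toLex (I.worth t j, if j = 0 then I.v - t else 0)

/-- The lexicographic capped payoff of prize `0` in a box with payment `t`. -/
noncomputable def level (t : ℝ) : ℝ ×ₗ ℝ :=
  if I.cap 0 ≤ I.a 0 + t then I.lexCap t else toLex (I.a 0 + t, I.v - t)

/-- Prize `j` brings a box with payment `t` to its level. -/
def IsHit (t : ℝ) (j : Fin (I.m + 1)) : Prop :=
  j = 0 ∨ I.cap 0 ≤ I.a 0 + t ∧ I.cap t < I.a j

theorem lexPayoff_payments (t : Fin I.n → ℝ) (i : Fin I.n) (j : Fin (I.m + 1)) :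
    I.toBoxes.lexPayoff (I.payments t) i j = I.prizePayoff (t i) j := by
  unfold lexPayoff prizePayoff payments toBoxes worth
  by_cases hj : j = 0 <;> simp [hj]

theorem above_nonneg (x : ℝ) : 0 ≤ 1 - I.below x := by
  have := I.below_add_q_le x
  have := I.q_nonneg 0
  linarith

theorem bonus_nonneg {t : ℝ} (ht : t ≤ I.v) : 0 ≤ I.bonus t := by
  unfold bonus
  split_ifs
  · exact div_nonneg (mul_nonneg (I.q_nonneg 0) (by linarith)) (I.above_nonneg _)
  · exact le_rfl

theorem bonus_le {t : ℝ} (ht : t ≤ I.v) : I.bonus t ≤ I.v - t := by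
  unfold bonus
  have h₁ := I.below_add_q_le (I.cap t)
  split_ifs
  · refine div_le_of_le_mul₀ (I.above_nonneg _) (by linarith) ?_
    rw [mul_comm]
    exact mul_le_mul_of_nonneg_left (by linarith) (by linarith)
  · linarith

theorem bonus_mul {t : ℝ} (h : I.cap 0 ≤ I.a 0 + t) :
    I.bonus t * (1 - I.below (I.cap t)) = I.q 0 * (I.v - t) := by
  rw [bonus, if_pos h]
  by_cases h₀ : 1 - I.below (I.cap t) = 0
  · have h₁ := I.below_add_q_le (I.cap t)
    have h₂ := I.q_nonneg 0
    have : I.q 0 = 0 := by linarith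
    simp [this]
  · exact div_mul_cancel₀ _ h₀

/-- The caps with the bonus as secondary coordinate are fair: in the second coordinate, the expected
excess over the cap is `q₀ (v - t)` minus the bonus times the probability of a hit. -/
theorem isLexCap {t : Fin I.n → ℝ} (ht₀ : ∀ i, 0 ≤ t i) (ht : ∀ i, t i ≤ I.v) :
    I.toBoxes.IsLexCap (I.payments t) (fun i => I.lexCap (t i)) := by
  intro i
  simp only [lexPayoff_payments]
  change ∑ j, I.q j • max 0 (I.prizePayoff (t i) j - I.lexCap (t i)) = toLex (I.c, 0)
  have hfst : ∀ x : ℝ ×ₗ ℝ, lexFst (max 0 x) = max 0 (lexFst x) :=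
    fun x => lexFst_mono.map_max
  have hb₀ := I.bonus_nonneg (ht i)
  have hb := I.bonus_le (ht i)
  apply lex_ext
  · simp only [map_sum, lexFst_smul, hfst, map_sub]
    exact I.overshoot_cap (ht₀ i)
  · simp only [map_sum, lexSnd_smul, lexSnd_toLex]
    by_cases hphase : I.cap 0 ≤ I.a 0 + t i
    · have hcap := I.cap_le_of_le (ht₀ i) hphase
      -- a prize contributes to the second coordinate exactly if it is a hit
      have : ∀ j, I.q j * lexSnd (max 0 (I.prizePayoff (t i) j - I.lexCap (t i))) =
          (if j = 0 then I.q 0 * (I.v - t i) else 0) -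
            (if j = 0 ∨ I.cap (t i) < I.a j then I.q j else 0) * I.bonus (t i) := by
        intro j
        by_cases hj : j = 0
        · subst hj
          have : 0 ≤ I.prizePayoff (t i) 0 - I.lexCap (t i) := by
            rw [sub_nonneg, lex_le_iff]
            simp only [lexCap, prizePayoff, lexFst_toLex, lexSnd_toLex, worth, if_true]
            rcases hcap.lt_or_eq with h | h
            exacts [Or.inl h, Or.inr ⟨h, hb⟩]
          rw [max_eq_right this, map_sub]
          simp only [lexCap, prizePayoff, lexSnd_toLex, if_true, true_or]
          ring
        · by_cases hja : I.cap (t i) < I.a j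
          · have : 0 ≤ I.prizePayoff (t i) j - I.lexCap (t i) := by
              rw [sub_nonneg, lex_le_iff]
              simp only [lexCap, prizePayoff, lexFst_toLex, worth, hj, if_false, add_zero]
              exact Or.inl hja
            rw [max_eq_right this, map_sub]
            simp only [lexCap, prizePayoff, lexSnd_toLex, hj, if_false, hja, false_or, if_true]
            ring
          · have : I.prizePayoff (t i) j - I.lexCap (t i) ≤ 0 := by
              rw [sub_nonpos, lex_le_iff]
              simp only [lexCap, prizePayoff, lexFst_toLex, lexSnd_toLex, worth, hj, if_false,
                add_zero]
              rcases (not_lt.1 hja).lt_or_eq with h | h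
              exacts [Or.inl h, Or.inr ⟨h, hb₀⟩]
            rw [max_eq_left this, map_zero]
            simp [hj, hja]
      simp only [this, Finset.sum_sub_distrib, ← Finset.sum_mul]
      rw [Finset.sum_ite_eq' Finset.univ (0 : Fin (I.m + 1)) (fun _ => I.q 0 * (I.v - t i)),
        if_pos (Finset.mem_univ _), ← I.bonus_mul hphase, ← I.below_add_above (I.cap (t i))]
      ring
    · have hcap := I.cap_eq_of_lt (ht₀ i) (not_le.1 hphase)
      refine Finset.sum_eq_zero fun j _ => ?_
      have hbz : I.bonus (t i) = 0 := by rw [bonus, if_neg hphase]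
      by_cases hj : j = 0
      · subst hj
        have : I.prizePayoff (t i) 0 - I.lexCap (t i) ≤ 0 := by
          rw [sub_nonpos, lex_le_iff]
          simp only [lexCap, prizePayoff, lexFst_toLex, worth, if_true]
          exact Or.inl (by rw [hcap]; exact not_le.1 hphase)
        rw [max_eq_left this, map_zero, mul_zero]
      · have h0 : lexSnd (I.prizePayoff (t i) j - I.lexCap (t i)) = 0 := by
          rw [map_sub]
          simp [lexCap, prizePayoff, lexSnd_toLex, hj, hbz]
        rcases max_choice 0 (I.prizePayoff (t i) j - I.lexCap (t i)) with h | h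
        · rw [h, map_zero, mul_zero]
        · rw [h, h0, mul_zero]

/-- Boxes with larger payments have higher levels, so that in a contract with decreasing payments
the first hit decides. -/
theorem level_mono {t t' : ℝ} (ht : 0 ≤ t) (h : t ≤ t') (hv : t' ≤ I.v) :
    I.level t ≤ I.level t' := by
  rcases h.eq_or_lt with rfl | h
  · exact le_rfl
  have ht' : 0 ≤ t' := ht.trans h.le
  unfold level
  split_ifs with h₁ h₂ h₂
  · rcases (I.q_nonneg 0).eq_or_lt with hq | hq
    · have : ∀ s, I.bonus s = 0 := fun s => by simp [bonus, ← hq]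
      rw [lexCap, lexCap, this, this, I.cap_eq_of_q_zero ht hq.symm,
        I.cap_eq_of_q_zero ht' hq.symm]
    · exact lex_le_iff.2 (Or.inl (I.cap_lt_cap ht h hq h₁))
  · exact absurd (h₁.trans (by linarith)) h₂
  · exact lex_le_iff.2 (Or.inl ((not_le.1 h₁).trans_le (I.cap_mono le_rfl ht')))
  · exact lex_le_iff.2 (Or.inl (by simp only [lexFst_toLex]; linarith))

theorem level_snd_nonneg {t : ℝ} (hv : t ≤ I.v) : 0 ≤ lexSnd (I.level t) := by
  unfold level
  split_ifs
  · exact I.bonus_nonneg hv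
  · exact sub_nonneg.2 hv

theorem level_fst_le_cap {t : ℝ} (ht : 0 ≤ t) : lexFst (I.level t) ≤ I.cap t := by
  unfold level
  split_ifs with h
  · exact le_rfl
  · rw [I.cap_eq_of_lt ht (not_le.1 h)]
    exact (not_le.1 h).le

theorem min_of_isHit {t : ℝ} (ht : 0 ≤ t) (hv : t ≤ I.v) {j : Fin (I.m + 1)} (h : I.IsHit t j) :
    min (I.prizePayoff t j) (I.lexCap t) = I.level t := by
  unfold level
  split_ifs with hphase
  · refine min_eq_right (lex_le_iff.2 ?_)
    simp only [lexCap, prizePayoff, lexFst_toLex, lexSnd_toLex]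
    by_cases hj : j = 0
    · subst hj
      simp only [worth, if_true]
      rcases (I.cap_le_of_le ht hphase).lt_or_eq with h | h
      exacts [Or.inl h, Or.inr ⟨h, I.bonus_le hv⟩]
    · exact Or.inl (by simpa [worth, hj] using (h.resolve_left hj).2)
  · have hj : j = 0 := h.resolve_right fun h => hphase h.1
    subst hj
    have : I.prizePayoff t 0 = toLex (I.a 0 + t, I.v - t) := by simp [prizePayoff, worth]
    rw [this]
    refine min_eq_left (lex_le_iff.2 (Or.inl ?_))
    simp only [lexCap, lexFst_toLex]
    rw [I.cap_eq_of_lt ht (not_le.1 hphase)]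
    exact not_le.1 hphase

theorem min_of_not_isHit {t : ℝ} (hv : t ≤ I.v) {j : Fin (I.m + 1)} (h : ¬ I.IsHit t j) :
    min (I.prizePayoff t j) (I.lexCap t) = toLex (min (I.a j) (I.cap t), 0) := by
  unfold IsHit at h
  push Not at h
  obtain ⟨hj, h⟩ := h
  have hp : I.prizePayoff t j = toLex (I.a j, 0) := by simp [prizePayoff, worth, hj]
  rw [hp]
  by_cases hphase : I.cap 0 ≤ I.a 0 + t
  · have hle := h hphase
    rw [min_eq_left hle]
    refine min_eq_left (lex_le_iff.2 ?_)
    simp only [lexCap, lexFst_toLex, lexSnd_toLex]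
    rcases hle.lt_or_eq with h | h
    exacts [Or.inl h, Or.inr ⟨h, I.bonus_nonneg hv⟩]
  · have hb : I.bonus t = 0 := by rw [bonus, if_neg hphase]
    rw [lexCap, hb]
    rcases le_total (I.a j) (I.cap t) with h | h
    · rw [min_eq_left h]
      exact min_eq_left (Prod.Lex.toLex_mono ⟨h, le_rfl⟩)
    · rw [min_eq_right h]
      exact min_eq_right (Prod.Lex.toLex_mono ⟨h, le_rfl⟩)

end IIDBoxes

namespace IIDBoxes

open Boxes

variable (I : IIDBoxes ℝ)

/-- The condition on the prize `j` of box `i'` for box `i` to be the first box that attains the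
largest capped payoff with a hit. -/
def Supports (t : Fin I.n → ℝ) (i i' : Fin I.n) (j : Fin (I.m + 1)) : Prop :=
  if i' < i then ¬ I.IsHit (t i') j ∧
    lexFst (min (I.prizePayoff (t i') j) (I.lexCap (t i'))) ≤ lexFst (I.level (t i))
  else if i' = i then I.IsHit (t i) j
  else lexFst (min (I.prizePayoff (t i') j) (I.lexCap (t i'))) ≤ lexFst (I.level (t i))

open Classical in
/-- For decreasing payments, the principal obtains the secondary coordinate of the level of the
unique box that is supported by the prizes of all boxes.  If there is none, the largest capped
payoff is zero or comes from a prize that is worth nothing to her. -/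
theorem lexSnd_maxCapped {t : Fin I.n → ℝ} (ht₀ : ∀ i, 0 ≤ t i) (ht : ∀ i, t i ≤ I.v)
    (hanti : Antitone t) (ω : Fin I.n → Fin (I.m + 1)) :
    lexSnd (maxCapped (fun i => I.prizePayoff (t i)) (fun i => I.lexCap (t i)) ω) =
      ∑ i, (if 0 ≤ lexFst (I.level (t i)) then lexSnd (I.level (t i)) else 0) *
        if ∀ i', I.Supports t i i' (ω i') then 1 else 0 := by
  have hcapped := le_maxCapped (fun i => I.prizePayoff (t i)) (fun i => I.lexCap (t i)) ω
  have hzero := zero_le_maxCapped (fun i => I.prizePayoff (t i)) (fun i => I.lexCap (t i)) ω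
  by_cases hex : ∃ i, 0 ≤ lexFst (I.level (t i)) ∧ ∀ i', I.Supports t i i' (ω i')
  · obtain ⟨i, hpos, hi⟩ := hex
    have hhit : ∀ i, (∀ i', I.Supports t i i' (ω i')) → I.IsHit (t i) (ω i) := by
      intro i hi
      have := hi i
      rwa [Supports, if_neg (lt_irrefl _), if_pos rfl] at this
    have hmiss : ∀ i, (∀ i', I.Supports t i i' (ω i')) → ∀ i' < i, ¬ I.IsHit (t i') (ω i') := by
      intro i hi i' hlt
      have := hi i'
      rw [Supports, if_pos hlt] at this
      exact this.1
    rw [Finset.sum_eq_single i, if_pos hpos, if_pos hi, mul_one]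
    · congr 1
      apply le_antisymm
      · refine maxCapped_le (lex_le_iff.2 ?_) fun i' => ?_
        · rcases hpos.lt_or_eq with h | h
          exacts [Or.inl h, Or.inr ⟨h, I.level_snd_nonneg (ht i)⟩]
        · have hsupp := hi i'
          by_cases h : I.IsHit (t i') (ω i')
          · have hle : i ≤ i' := not_lt.1 fun hlt => hmiss i hi i' hlt h
            rw [I.min_of_isHit (ht₀ i') (ht i') h]
            exact I.level_mono (ht₀ i') (hanti hle) (ht i)
          · have hne : i' ≠ i := fun h' => h (h' ▸ hhit i hi)
            have hfst : lexFst (min (I.prizePayoff (t i') (ω i')) (I.lexCap (t i'))) ≤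
                lexFst (I.level (t i)) := by
              unfold Supports at hsupp
              split_ifs at hsupp
              exacts [hsupp.2, hsupp]
            rw [I.min_of_not_isHit (ht i') h] at hfst ⊢
            rcases hfst.lt_or_eq with h | h
            exacts [lex_le_iff.2 (Or.inl h),
              lex_le_iff.2 (Or.inr ⟨h, I.level_snd_nonneg (ht i)⟩)]
      · rw [← I.min_of_isHit (ht₀ i) (ht i) (hhit i hi)]
        exact hcapped i
    · intro i₁ _ hne
      rw [if_neg (c := ∀ i', I.Supports t i₁ i' (ω i')), mul_zero]
      intro hi₁
      rcases lt_or_gt_of_ne hne with h | h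
      · exact hmiss i hi i₁ h (hhit i₁ hi₁)
      · exact hmiss i₁ hi₁ i h (hhit i hi)
    · simp
  · have hsum : ∀ i, (if 0 ≤ lexFst (I.level (t i)) then lexSnd (I.level (t i)) else 0) *
        (if ∀ i', I.Supports t i i' (ω i') then (1 : ℝ) else 0) = 0 := by
      intro i
      by_cases h : 0 ≤ lexFst (I.level (t i))
      · rw [if_neg (c := ∀ i', I.Supports t i i' (ω i')) fun h' => hex ⟨i, h, h'⟩, mul_zero]
      · rw [if_neg h, zero_mul]
    rw [Finset.sum_eq_zero fun i _ => hsum i]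
    set M := maxCapped (fun i => I.prizePayoff (t i)) (fun i => I.lexCap (t i)) ω with hM
    by_cases hne : (Finset.univ.filter fun i => I.IsHit (t i) (ω i) ∧
        M = min (I.prizePayoff (t i) (ω i)) (I.lexCap (t i))).Nonempty
    · exfalso
      -- the first box that attains the maximum with a hit is supported by all others
      obtain ⟨hi, hMi⟩ := (Finset.mem_filter.1 (Finset.min'_mem _ hne)).2
      have hmin : ∀ i', I.IsHit (t i') (ω i') ∧
          M = min (I.prizePayoff (t i') (ω i')) (I.lexCap (t i')) → Finset.min' _ hne ≤ i' :=
        fun i' h => Finset.min'_le _ i' (Finset.mem_filter.2 ⟨Finset.mem_univ i', h⟩)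
      set i := Finset.min' _ hne
      rw [I.min_of_isHit (ht₀ i) (ht i) hi] at hMi
      refine hex ⟨i, ?_, fun i' => ?_⟩
      · rw [← hMi]
        exact lexFst_mono hzero
      · have hle : lexFst (min (I.prizePayoff (t i') (ω i')) (I.lexCap (t i'))) ≤
            lexFst (I.level (t i)) := by
          rw [← hMi]
          exact lexFst_mono (hcapped i')
        unfold Supports
        split_ifs with h₁ h₂
        · refine ⟨fun hhit => ?_, hle⟩
          have : M = min (I.prizePayoff (t i') (ω i')) (I.lexCap (t i')) := by
            refine le_antisymm ?_ (hcapped i')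
            rw [hMi, I.min_of_isHit (ht₀ i') (ht i') hhit]
            exact I.level_mono (ht₀ i) (hanti h₁.le) (ht i')
          exact absurd (hmin i' ⟨hhit, this⟩) (not_le.2 h₁)
        · rw [h₂] at *
          exact hi
        · exact hle
    · rcases maxCapped_eq (fun i => I.prizePayoff (t i)) (fun i => I.lexCap (t i)) ω with h | ⟨i, h⟩
      · rw [hM, h, map_zero]
      · have hmiss : ¬ I.IsHit (t i) (ω i) := fun hhit => hne ⟨i, by simp [hhit, hM, h]⟩
        rw [hM, h, I.min_of_not_isHit (ht i) hmiss, lexSnd_toLex]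

open Classical in
/-- The weight of a box is what its hits bring to the principal. -/
theorem level_snd_mul_hit {t : ℝ} :
    lexSnd (I.level t) * ∑ j, (if I.IsHit t j then I.q j else 0) = I.q 0 * (I.v - t) := by
  by_cases hphase : I.cap 0 ≤ I.a 0 + t
  · rw [level, if_pos hphase, ← I.bonus_mul hphase, ← I.below_add_above (I.cap t)]
    simp [IsHit, hphase, lexCap, lexSnd_toLex]
  · rw [level, if_neg hphase, mul_comm]
    simp [IsHit, hphase, lexSnd_toLex]

open Classical in
theorem sum_supports_of_lt {t : Fin I.n → ℝ} (ht₀ : ∀ i, 0 ≤ t i) (ht : ∀ i, t i ≤ I.v)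
    (hanti : Antitone t) {i i' : Fin I.n} (h : i' < i) :
    ∑ j, (if I.Supports t i i' j then I.q j else 0) = I.below (lexFst (I.level (t i))) := by
  refine Finset.sum_congr rfl fun j _ => ?_
  congr 1
  rw [Supports, if_pos h, eq_iff_iff]
  have hx : lexFst (I.level (t i)) ≤ lexFst (I.level (t i')) :=
    lexFst_mono (I.level_mono (ht₀ i) (hanti h.le) (ht i'))
  constructor
  · rintro ⟨hmiss, hle⟩
    rw [I.min_of_not_isHit (ht i') hmiss, lexFst_toLex] at hle
    unfold IsHit at hmiss
    push Not at hmiss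
    refine ⟨hmiss.1, ?_⟩
    by_cases hphase : I.cap 0 ≤ I.a 0 + t i'
    · rwa [min_eq_left (hmiss.2 hphase)] at hle
    · refine (min_le_iff.1 hle).resolve_right fun h => hphase ?_
      rw [level, level, if_neg hphase, lexFst_toLex] at hx
      · rw [I.cap_eq_of_lt (ht₀ i') (not_le.1 hphase)] at h
        exact h.trans hx
  · rintro ⟨hj, hle⟩
    have hmiss : ¬ I.IsHit (t i') j := by
      rintro (h | h)
      · exact hj h
      · exact absurd (hle.trans (hx.trans (I.level_fst_le_cap (ht₀ i')))) (not_le.2 h.2)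
    refine ⟨hmiss, ?_⟩
    rw [I.min_of_not_isHit (ht i') hmiss, lexFst_toLex]
    exact (min_le_left _ _).trans hle

open Classical in
theorem sum_supports_of_gt {t : Fin I.n → ℝ} (ht₀ : ∀ i, 0 ≤ t i) (ht : ∀ i, t i ≤ I.v)
    (hanti : Antitone t) {i i' : Fin I.n} (h : i < i') :
    ∑ j, (if I.Supports t i i' j then I.q j else 0) =
      if I.cap 0 ≤ I.a 0 + t i then 1 else I.below (I.a 0 + t i) + I.q 0 := by
  have hdef : ∀ j, I.Supports t i i' j ↔
      lexFst (min (I.prizePayoff (t i') j) (I.lexCap (t i'))) ≤ lexFst (I.level (t i)) := by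
    intro j
    rw [Supports, if_neg h.le.not_gt, if_neg h.ne']
  split_ifs with hphase
  · rw [← I.q_sum]
    refine Finset.sum_congr rfl fun j _ => if_pos ((hdef j).2 ?_)
    rw [level, if_pos hphase]
    exact (lexFst_mono (min_le_right _ _)).trans (I.cap_mono (ht₀ i') (hanti h.le))
  · have hle : t i' ≤ t i := hanti h.le
    have hphase' : ¬ I.cap 0 ≤ I.a 0 + t i' := fun h => hphase (by linarith)
    have hq : I.q 0 = ∑ j, if j = 0 then I.q j else 0 := by simp
    rw [below, hq, ← Finset.sum_add_distrib]
    refine Finset.sum_congr rfl fun j _ => ?_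
    by_cases hj : j = 0
    · subst hj
      rw [if_pos ((hdef 0).2 ?_)]
      · simp
      · rw [I.min_of_isHit (ht₀ i') (ht i') (Or.inl rfl)]
        exact lexFst_mono (I.level_mono (ht₀ i') hle (ht i))
    · have hmiss : ¬ I.IsHit (t i') j := by
        rintro (h | h)
        exacts [hj h, hphase' h.1]
      have : I.Supports t i i' j ↔ I.a j ≤ I.a 0 + t i := by
        rw [hdef, I.min_of_not_isHit (ht i') hmiss, level, if_neg hphase, lexFst_toLex,
          lexFst_toLex, min_le_iff, I.cap_eq_of_lt (ht₀ i') (not_le.1 hphase')]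
        simp [hphase]
      simp [this, hj]

/-- The principal's revenue is the sum of the gains of the boxes if the payments decrease. -/
theorem weitzmanRevenue_eq {t : Fin I.n → ℝ} (ht₀ : ∀ i, 0 ≤ t i) (ht : ∀ i, t i ≤ I.v)
    (hanti : Antitone t) :
    I.toBoxes.weitzmanRevenue (I.payments t) (fun i => I.lexCap (t i)) =
      ∑ i : Fin I.n, I.gain i (t i) := by
  classical
  have hpay : I.toBoxes.lexPayoff (I.payments t) = fun i => I.prizePayoff (t i) := by
    funext i j
    exact I.lexPayoff_payments t i j
  unfold weitzmanRevenue
  change ∑ ω : Fin I.n → Fin (I.m + 1), (∏ i, I.q (ω i)) * _ = _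
  rw [hpay]
  simp only [I.lexSnd_maxCapped ht₀ ht hanti, Finset.mul_sum]
  rw [Finset.sum_comm]
  refine Finset.sum_congr rfl fun i _ => ?_
  have hprod : ∑ ω : Fin I.n → Fin (I.m + 1),
      (∏ i', if I.Supports t i i' (ω i') then I.q (ω i') else 0) =
      ∏ i', ∑ j, if I.Supports t i i' j then I.q j else 0 := by
    rw [Finset.prod_univ_sum, Fintype.piFinset_univ]
  set x := lexFst (I.level (t i)) with hx
  set G := if I.cap 0 ≤ I.a 0 + t i then 1 else I.below (I.a 0 + t i) + I.q 0 with hG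
  calc ∑ ω : Fin I.n → Fin (I.m + 1), (∏ i, I.q (ω i)) *
        ((if 0 ≤ x then lexSnd (I.level (t i)) else 0) *
          if ∀ i', I.Supports t i i' (ω i') then 1 else 0)
      = (if 0 ≤ x then lexSnd (I.level (t i)) else 0) *
          ∏ i', ∑ j, if I.Supports t i i' j then I.q j else 0 := by
        rw [← hprod, Finset.mul_sum]
        refine Finset.sum_congr rfl fun ω _ => ?_
        rw [Finset.prod_ite_zero]
        simp only [Finset.mem_univ, true_imp_iff]
        split_ifs <;> ring
    _ = (if 0 ≤ x then lexSnd (I.level (t i)) else 0) *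
          ((∑ j, if I.IsHit (t i) j then I.q j else 0) *
            (I.below x ^ (i : ℕ) * G ^ (I.n - 1 - i))) := by
        congr 1
        rw [← Finset.mul_prod_erase _ _ (Finset.mem_univ i)]
        congr 1
        · refine Finset.sum_congr rfl fun j _ => ?_
          rw [Supports, if_neg (lt_irrefl _), if_pos rfl]
        · have hsplit : Finset.univ.erase i = Finset.Iio i ∪ Finset.Ioi i := by
            ext i'
            simp
          have hdisj : Disjoint (Finset.Iio i) (Finset.Ioi i) := by
            rw [Finset.disjoint_left]
            intro i' h₁ h₂
            rw [Finset.mem_Iio] at h₁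
            rw [Finset.mem_Ioi] at h₂
            exact lt_asymm h₁ h₂
          rw [hsplit, Finset.prod_union hdisj,
            Finset.prod_congr rfl fun i' hi' =>
              I.sum_supports_of_lt ht₀ ht hanti (Finset.mem_Iio.1 hi'),
            Finset.prod_congr rfl fun i' hi' =>
              I.sum_supports_of_gt ht₀ ht hanti (Finset.mem_Ioi.1 hi'),
            Finset.prod_const, Finset.prod_const, Fin.card_Iio, Fin.card_Ioi]
    _ = I.gain i (t i) := by
        unfold gain
        rw [← I.level_snd_mul_hit, hG, hx]
        have ha := I.a_nonneg 0
        have := ht₀ i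
        by_cases hphase : I.cap 0 ≤ I.a 0 + t i
        · have hfst : lexFst (I.level (t i)) = I.cap (t i) := by
            rw [level, if_pos hphase]
            rfl
          rw [hfst]
          simp only [if_pos hphase, one_pow, mul_one]
          by_cases h : 0 ≤ I.cap (t i)
          · rw [if_pos h, if_pos h]
            ring
          · rw [if_neg h, if_neg h]
            ring
        · have hfst : lexFst (I.level (t i)) = I.a 0 + t i := by
            rw [level, if_neg hphase]
            rfl
          have hpos : 0 ≤ I.a 0 + t i := by linarith
          rw [hfst]
          simp only [if_neg hphase, if_pos hpos]
          ring

/-- As the boxes are identically distributed, their order is immaterial. -/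
theorem weitzmanRevenue_comp (t : Fin I.n → ℝ) (σ : Equiv.Perm (Fin I.n)) :
    I.toBoxes.weitzmanRevenue (I.payments (t ∘ σ)) (fun i => I.lexCap ((t ∘ σ) i)) =
      I.toBoxes.weitzmanRevenue (I.payments t) (fun i => I.lexCap (t i)) := by
  have hpay : ∀ t, I.toBoxes.lexPayoff (I.payments t) = fun i => I.prizePayoff (t i) := by
    intro t
    funext i j
    exact I.lexPayoff_payments t i j
  have hmax : ∀ (t : Fin I.n → ℝ) (σ : Equiv.Perm (Fin I.n)) (ω : Fin I.n → Fin (I.m + 1)),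
      maxCapped (fun i => I.prizePayoff (t (σ i))) (fun i => I.lexCap (t (σ i))) (ω ∘ σ) ≤
        maxCapped (fun i => I.prizePayoff (t i)) (fun i => I.lexCap (t i)) ω := fun t σ ω =>
    maxCapped_le (zero_le_maxCapped _ _ _) fun i => le_maxCapped
      (fun i => I.prizePayoff (t i)) (fun i => I.lexCap (t i)) ω (σ i)
  unfold weitzmanRevenue
  simp only [hpay]
  symm
  refine Fintype.sum_equiv (Equiv.arrowCongr σ.symm (Equiv.refl _)) _ _ fun ω => ?_
  have : (Equiv.arrowCongr σ.symm (Equiv.refl _)) ω = ω ∘ σ := rfl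
  rw [this]
  congr 1
  · exact (Equiv.prod_comp σ (fun i => I.q (ω i))).symm
  · congr 1
    refine le_antisymm ?_ (hmax t σ ω)
    have := hmax (t ∘ σ) σ.symm (ω ∘ σ)
    simpa [Function.comp_def] using this

end IIDBoxes

/-! ### Contracts as decreasing payments -/

namespace IIDBoxes

open Boxes

variable (I : IIDBoxes ℝ)

/-- The payments lie between zero and the principal's value. -/
def IsFeasible (t : Fin I.n → ℝ) : Prop := ∀ i, 0 ≤ t i ∧ t i ≤ I.v

variable {I}

theorem IsFeasible.isContract {t : Fin I.n → ℝ} (ht : I.IsFeasible t) :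
    I.toBoxes.IsContract (I.payments t) := by
  intro i j
  by_cases hj : j = 0
  · simpa [payments, toBoxes, hj] using ht i
  · simp [payments, toBoxes, hj]

theorem exists_payments_of_isContract {T : Fin I.n → Fin (I.m + 1) → ℝ}
    (hT : I.toBoxes.IsContract T) : ∃ t, I.IsFeasible t ∧ T = I.payments t := by
  refine ⟨fun i => T i 0, fun i => by simpa [toBoxes] using hT i 0, ?_⟩
  funext i j
  by_cases hj : j = 0
  · simp [payments, hj]
  · have := hT i j
    simp only [toBoxes, hj, if_false] at this
    simp [payments, hj, le_antisymm this.2 this.1]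

theorem principalUtility_eq_sum_gain {t : Fin I.n → ℝ} (ht : I.IsFeasible t) (hanti : Antitone t)
    {π : Policy (Seen.start I.n (I.m + 1))} (hπ : I.toBoxes.IsOptimalPolicy (I.payments t) π) :
    I.toBoxes.principalUtility (I.payments t) π = ∑ i : Fin I.n, I.gain i (t i) := by
  rw [hπ.principalUtility_eq (I.isLexCap (fun i => (ht i).1) (fun i => (ht i).2)),
    I.weitzmanRevenue_eq (fun i => (ht i).1) (fun i => (ht i).2) hanti]

/-- Sorting the payments of a contract in decreasing order does not change its revenue. -/
theorem exists_antitone_of_isContract {T : Fin I.n → Fin (I.m + 1) → ℝ}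
    (hT : I.toBoxes.IsContract T) {π : Policy (Seen.start I.n (I.m + 1))}
    (hπ : I.toBoxes.IsOptimalPolicy T π) :
    ∃ t, I.IsFeasible t ∧ Antitone t ∧
      I.toBoxes.principalUtility T π = ∑ i : Fin I.n, I.gain i (t i) := by
  obtain ⟨t, ht, rfl⟩ := exists_payments_of_isContract hT
  have hmono := Tuple.monotone_sort (fun i => - t i)
  set σ := Tuple.sort (fun i => - t i)
  have hanti : Antitone (t ∘ σ) := fun i j h => by simpa using hmono h
  refine ⟨t ∘ σ, fun i => ht (σ i), hanti, ?_⟩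
  rw [hπ.principalUtility_eq (I.isLexCap (fun i => (ht i).1) (fun i => (ht i).2)),
    ← I.weitzmanRevenue_comp t σ]
  exact (I.weitzmanRevenue_eq (t := t ∘ σ) (fun i => (ht (σ i)).1) (fun i => (ht (σ i)).2) hanti)

theorem isOptimalContract_of_forall_le {t : Fin I.n → ℝ} (ht : I.IsFeasible t)
    (hanti : Antitone t)
    (hmax : ∀ t', I.IsFeasible t' → Antitone t' →
      ∑ i : Fin I.n, I.gain i (t' i) ≤ ∑ i : Fin I.n, I.gain i (t i)) :
    I.toBoxes.IsOptimalContract (I.payments t) := by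
  obtain ⟨π, hπ, -⟩ := I.toBoxes.exists_optimalPolicy
    (I.isLexCap (fun i => (ht i).1) (fun i => (ht i).2)) 0 (by simp)
  refine ⟨ht.isContract, π, hπ, fun T' π' hT' hπ' => ?_⟩
  obtain ⟨t', ht', hanti', h⟩ := exists_antitone_of_isContract hT' hπ'
  rw [h, principalUtility_eq_sum_gain ht hanti hπ]
  exact hmax t' ht' hanti'

/-! ### Pooling the payments within each phase -/

/-- If later rows prefer earlier columns in the sense of log-supermodularity, then the diagonal sum
is at most the sum of some column: of two columns, the later one is at least as good for all rows
down to the first one that prefers it strictly. -/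
theorem _root_.exists_sum_diagonal_le {f : ℕ → ℕ → ℝ} {k : ℕ} (hk : 0 < k)
    (hf : ∀ i l, i < k → l < k → 0 ≤ f i l)
    (hsup : ∀ i j l l', i ≤ j → j < k → l ≤ l' → l' < k → f i l * f j l' ≤ f i l' * f j l) :
    ∃ l < k, ∑ i ∈ Finset.range k, f i i ≤ ∑ i ∈ Finset.range k, f i l := by
  induction k with
  | zero => omega
  | succ k ih =>
    rcases Nat.eq_zero_or_pos k with rfl | hk
    · exact ⟨0, one_pos, le_rfl⟩
    obtain ⟨l, hl, h⟩ := ih hk (fun i l hi hl => hf i l (by omega) (by omega))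
      fun i j l l' h₁ h₂ h₃ h₄ => hsup i j l l' h₁ (by omega) h₃ (by omega)
    simp only [Finset.sum_range_succ]
    rcases le_or_gt (f k k) (f k l) with hle | hlt
    · exact ⟨l, by omega, add_le_add h hle⟩
    · refine ⟨k, by omega, add_le_add (h.trans (Finset.sum_le_sum fun i hi => ?_)) le_rfl⟩
      rw [Finset.mem_range] at hi
      have h₁ := hsup i k l k hi.le (by omega) hl.le (by omega)
      have h₂ := hf k l (by omega) (by omega)
      have h₃ := hf i k (by omega) (by omega)
      exact le_of_mul_le_mul_right (h₁.trans (mul_le_mul_of_nonneg_left hlt.le h₃))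
        (h₂.trans_lt hlt)

/-- Log-supermodularity in the first phase, where the gain of the `i`-th box is a factor depending on
the payment only times the `i`-th power of `below (cap t)`, which increases with `t`. -/
theorem gain_mul_gain_le_of_phase_one {t t' : ℝ} (ht' : 0 ≤ t') (h : t' ≤ t) (hv : t ≤ I.v)
    (hphase : I.cap 0 ≤ I.a 0 + t') {i j : ℕ} (hij : i ≤ j) :
    I.gain i t * I.gain j t' ≤ I.gain i t' * I.gain j t := by
  have hq := I.q_nonneg 0
  have hB := I.below_nonneg
  have hphase₂ : I.cap 0 ≤ I.a 0 + t := hphase.trans (by linarith)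
  have hform : ∀ (i : ℕ) (t : ℝ), I.cap 0 ≤ I.a 0 + t → I.gain i t =
      (I.q 0 * (I.v - t) * if 0 ≤ I.cap t then 1 else 0) * I.below (I.cap t) ^ i := by
    intro i t h
    rw [gain, if_pos h]
    split_ifs <;> ring
  have hA : ∀ t ≤ I.v, 0 ≤ I.q 0 * (I.v - t) * if 0 ≤ I.cap t then (1 : ℝ) else 0 := by
    intro t ht
    refine mul_nonneg (mul_nonneg hq (by linarith)) ?_
    split_ifs <;> norm_num
  rw [hform _ _ hphase, hform _ _ hphase, hform _ _ hphase₂, hform _ _ hphase₂]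
  have hpow : I.below (I.cap t) ^ i * I.below (I.cap t') ^ j ≤
      I.below (I.cap t') ^ i * I.below (I.cap t) ^ j := by
    obtain ⟨e, rfl⟩ := Nat.exists_eq_add_of_le hij
    have := pow_le_pow_left₀ (hB _) (I.below_mono (I.cap_mono ht' h)) e
    rw [pow_add, pow_add]
    nlinarith [mul_nonneg (pow_nonneg (hB (I.cap t)) i) (pow_nonneg (hB (I.cap t')) i)]
  have := mul_le_mul_of_nonneg_left hpow (mul_nonneg (hA t hv) (hA t' (h.trans hv)))
  linarith

/-- Log-supermodularity in the second phase, as the quotient of `below` and `below + q₀` increases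
with the payment. -/
theorem gain_mul_gain_le_of_phase_two {t t' : ℝ} (h : t' ≤ t) (hv : t ≤ I.v)
    (hphase : I.a 0 + t < I.cap 0) {i j : ℕ} (hij : i ≤ j) (hj : j < I.n) :
    I.gain i t * I.gain j t' ≤ I.gain i t' * I.gain j t := by
  have hq := I.q_nonneg 0
  have hform : ∀ (i : ℕ) (t : ℝ), I.a 0 + t < I.cap 0 → I.gain i t = I.q 0 * (I.v - t) *
      (I.below (I.a 0 + t) ^ i * (I.below (I.a 0 + t) + I.q 0) ^ (I.n - 1 - i)) := by
    intro i t h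
    rw [gain, if_neg (not_le.2 h)]
  have hphase₂ : I.a 0 + t' < I.cap 0 := lt_of_le_of_lt (by linarith) hphase
  rw [hform _ _ hphase, hform _ _ hphase, hform _ _ hphase₂, hform _ _ hphase₂]
  have hmono : I.below (I.a 0 + t') ≤ I.below (I.a 0 + t) := I.below_mono (by linarith)
  have hx := I.below_nonneg (I.a 0 + t')
  have hy := I.below_nonneg (I.a 0 + t)
  set x := I.below (I.a 0 + t')
  set y := I.below (I.a 0 + t)
  have hxq : 0 ≤ x + I.q 0 := add_nonneg hx hq
  have hyq : 0 ≤ y + I.q 0 := add_nonneg hy hq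
  obtain ⟨e, rfl⟩ := Nat.exists_eq_add_of_le hij
  obtain ⟨r, hr⟩ : ∃ r, I.n - 1 - i = r + e := ⟨I.n - 1 - (i + e), by omega⟩
  have hr' : I.n - 1 - (i + e) = r := by omega
  rw [hr, hr']
  have hbase : (y + I.q 0) * x ≤ (x + I.q 0) * y := by nlinarith
  have hpow : (y + I.q 0) ^ e * x ^ e ≤ (x + I.q 0) ^ e * y ^ e := by
    rw [← mul_pow, ← mul_pow]
    exact pow_le_pow_left₀ (mul_nonneg hyq hx) hbase e
  have hc : 0 ≤ (I.q 0 * (I.v - t)) * (I.q 0 * (I.v - t')) *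
      (x ^ i * y ^ i * ((x + I.q 0) ^ r * (y + I.q 0) ^ r)) := by
    have h₁ : 0 ≤ I.v - t := by linarith
    have h₂ : 0 ≤ I.v - t' := by linarith
    positivity
  have := mul_le_mul_of_nonneg_left hpow hc
  simp only [pow_add]
  linarith

end IIDBoxes

namespace IIDBoxes

section Definitions

variable {K : Type} [Field K] [LinearOrder K] (I : IIDBoxes K)

/-- The payment at which the fair cap of a box is `x`, for `x` at least the basic cap. -/
def payFor (x : K) : K :=
  x - I.a 0 + (I.c - ∑ j, if j ≠ 0 then I.q j * max 0 (I.a j - x) else 0) / I.q 0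

/-- The principal's revenue if the first `k` boxes have payment `t₁` and the others `t₂`. -/
def stepRevenue (k : ℕ) (t₁ t₂ : K) : K :=
  ∑ i ∈ Finset.range I.n, I.gain i (if i < k then t₁ else t₂)

end Definitions

variable {I : IIDBoxes ℝ}

/-! ### Rounding the payments down -/

theorem below_eq_of_forall {x y : ℝ} (hxy : x ≤ y) (h : ∀ j, j ≠ 0 → I.a j ≤ y → I.a j ≤ x) :
    I.below x = I.below y := by
  refine Finset.sum_congr rfl fun j _ => ?_
  congr 1
  rw [eq_iff_iff]
  exact ⟨fun h' => ⟨h'.1, h'.2.trans hxy⟩, fun h' => ⟨h'.1, h j h'.1 h'.2⟩⟩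

theorem overshoot_eq' (t x : ℝ) : I.overshoot t x = I.q 0 * max 0 (I.a 0 + t - x) +
    ∑ j, if j ≠ 0 then I.q j * max 0 (I.a j - x) else 0 := by
  rw [overshoot_eq, Fin.sum_univ_succ (fun j => if j ≠ 0 then I.q j * max 0 (I.a j - x) else 0)]
  simp

/-- A smaller cap between the basic cap and that of `t` is attained by a smaller payment. -/
theorem payFor_spec (hq : 0 < I.q 0) {t x : ℝ} (ht : 0 ≤ t) (hphase : I.cap 0 ≤ I.a 0 + t)
    (h₀ : I.cap 0 ≤ x) (hx : x ≤ I.cap t) :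
    0 ≤ I.payFor x ∧ I.payFor x ≤ t ∧ x ≤ I.a 0 + I.payFor x ∧ I.cap (I.payFor x) = x := by
  obtain ⟨R, hR⟩ : ∃ R, R = ∑ j, if j ≠ 0 then I.q j * max 0 (I.a j - x) else 0 := ⟨_, rfl⟩
  have hpay : I.q 0 * (I.a 0 + I.payFor x - x) = I.c - R := by
    rw [payFor, ← hR]
    field_simp
    ring
  have hover : ∀ t, I.overshoot t x = I.q 0 * max 0 (I.a 0 + t - x) + R := by
    intro t
    rw [overshoot_eq', hR]
  have h₁ : I.overshoot 0 x ≤ I.c :=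
    (I.overshoot_antitone 0 h₀).trans (I.overshoot_cap le_rfl).le
  have h₂ : I.c ≤ I.overshoot t x := (I.overshoot_cap ht).ge.trans (I.overshoot_antitone t hx)
  have h₃ := I.cap_le_of_le ht hphase
  rw [hover] at h₁ h₂
  rw [max_eq_right (by linarith)] at h₂
  have hge : x ≤ I.a 0 + I.payFor x := by
    have : 0 ≤ I.q 0 * (I.a 0 + I.payFor x - x) := by
      have := mul_nonneg hq.le (le_max_left 0 (I.a 0 + 0 - x))
      linarith
    have := nonneg_of_mul_nonneg_right this hq
    linarith
  have hnn : 0 ≤ I.payFor x := by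
    have := mul_le_mul_of_nonneg_left (le_max_right 0 (I.a 0 + 0 - x)) hq.le
    have : I.q 0 * (I.a 0 + 0 - x) ≤ I.q 0 * (I.a 0 + I.payFor x - x) := by linarith
    have := le_of_mul_le_mul_left this hq
    linarith
  refine ⟨hnn, ?_, hge, I.cap_eq hnn hq hge ?_⟩
  · have : I.q 0 * (I.a 0 + I.payFor x - x) ≤ I.q 0 * (I.a 0 + t - x) := by linarith
    have := le_of_mul_le_mul_left this hq
    linarith
  · rw [hover, max_eq_right (by linarith), hpay]
    ring

/-- In the first phase, a payment can be lowered until the cap is one of finitely many numbers: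
between two of them `below (cap t)` and the sign of the cap do not change. -/
theorem exists_round_phase_one (hq : 0 < I.q 0) {t : ℝ} (ht : 0 ≤ t) (hv : t ≤ I.v)
    (hphase : I.cap 0 ≤ I.a 0 + t) :
    ∃ t₁, 0 ≤ t₁ ∧ t₁ ≤ I.v ∧ I.cap 0 ≤ I.a 0 + t₁ ∧ t₁ = I.payFor (I.cap t₁) ∧
      (I.cap t₁ = I.cap 0 ∨ I.cap t₁ = 0 ∨ ∃ j ≠ 0, I.cap t₁ = I.a j) ∧
      ∀ i, I.gain i t ≤ I.gain i t₁ := by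
  classical
  have hmono := I.cap_mono le_rfl ht
  have main : ∀ x, I.cap 0 ≤ x → x ≤ I.cap t → (x = I.cap 0 ∨ x = 0 ∨ ∃ j ≠ 0, x = I.a j) →
      (∀ i, I.gain i t ≤ I.q 0 * (I.v - t) * if 0 ≤ x then I.below x ^ i else 0) →
      ∃ t₁, 0 ≤ t₁ ∧ t₁ ≤ I.v ∧ I.cap 0 ≤ I.a 0 + t₁ ∧ t₁ = I.payFor (I.cap t₁) ∧
        (I.cap t₁ = I.cap 0 ∨ I.cap t₁ = 0 ∨ ∃ j ≠ 0, I.cap t₁ = I.a j) ∧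
        ∀ i, I.gain i t ≤ I.gain i t₁ := by
    intro x h₀ hx hcand hgain
    obtain ⟨h₁, h₂, h₃, h₄⟩ := payFor_spec hq ht hphase h₀ hx
    refine ⟨I.payFor x, h₁, h₂.trans hv, h₀.trans h₃, by rw [h₄], by rwa [h₄], fun i => ?_⟩
    refine (hgain i).trans ?_
    rw [gain, if_pos (h₀.trans h₃), h₄]
    refine mul_le_mul_of_nonneg_right (mul_le_mul_of_nonneg_left (by linarith) hq.le) ?_
    split_ifs
    exacts [pow_nonneg (I.below_nonneg _) _, le_rfl]
  by_cases hneg : 0 ≤ I.cap t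
  · -- round down to the largest candidate that is at least `max (cap 0) 0`
    let S : Finset ℝ := (insert (I.cap 0) (insert 0 ((Finset.univ.filter (· ≠ 0)).image I.a))).filter
      fun x => I.cap 0 ≤ x ∧ 0 ≤ x ∧ x ≤ I.cap t
    have hS : ∀ x, x ∈ S ↔ (x = I.cap 0 ∨ x = 0 ∨ ∃ j ≠ 0, x = I.a j) ∧
        I.cap 0 ≤ x ∧ 0 ≤ x ∧ x ≤ I.cap t := by
      intro x
      simp [S, eq_comm]
    have hne : S.Nonempty := by
      rcases le_total (I.cap 0) 0 with h | h
      · exact ⟨0, (hS 0).2 ⟨by simp, h, le_rfl, hneg⟩⟩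
      · exact ⟨I.cap 0, (hS _).2 ⟨by simp, le_rfl, h, hmono⟩⟩
    obtain ⟨hcand, h₀, hpos, hx⟩ := (hS _).1 (S.max'_mem hne)
    refine main _ h₀ hx hcand fun i => ?_
    rw [gain, if_pos hphase, if_pos hneg, if_pos hpos]
    refine le_of_eq ?_
    congr 2
    refine (below_eq_of_forall hx fun j hj hja => ?_).symm
    by_cases hj' : I.cap 0 ≤ I.a j
    · exact S.le_max' _ ((hS _).2 ⟨Or.inr (Or.inr ⟨j, hj, rfl⟩), hj', I.a_nonneg j, hja⟩)
    · exact (not_le.1 hj').le.trans h₀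
  · refine main (I.cap 0) le_rfl hmono (Or.inl rfl) fun i => ?_
    rw [gain, if_pos hphase, if_neg hneg, if_neg fun h => hneg (h.trans hmono)]

/-- In the second phase, a payment can be lowered until it is zero or prize `0` is worth as much as
another prize: in between `below (a₀ + t)` does not change. -/
theorem exists_round_phase_two {t : ℝ} (ht : 0 ≤ t) (hv : t ≤ I.v)
    (hphase : I.a 0 + t < I.cap 0) :
    ∃ t₂, 0 ≤ t₂ ∧ t₂ ≤ I.v ∧ I.a 0 + t₂ < I.cap 0 ∧
      (t₂ = 0 ∨ ∃ j ≠ 0, I.a 0 + t₂ = I.a j) ∧ ∀ i, I.gain i t ≤ I.gain i t₂ := by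
  classical
  let S : Finset ℝ := (insert (I.a 0) ((Finset.univ.filter (· ≠ 0)).image I.a)).filter
    fun x => I.a 0 ≤ x ∧ x ≤ I.a 0 + t
  have hS : ∀ x, x ∈ S ↔ (x = I.a 0 ∨ ∃ j ≠ 0, x = I.a j) ∧ I.a 0 ≤ x ∧ x ≤ I.a 0 + t := by
    intro x
    simp [S, eq_comm]
  have hne : S.Nonempty := ⟨I.a 0, (hS _).2 ⟨by simp, le_rfl, by linarith⟩⟩
  have hmem := (hS _).1 (S.max'_mem hne)
  obtain ⟨x, hx⟩ : ∃ x, x = S.max' hne := ⟨_, rfl⟩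
  rw [← hx] at hmem
  obtain ⟨hcand, h₀, hle⟩ := hmem
  have hbelow : I.below x = I.below (I.a 0 + t) := by
    refine below_eq_of_forall hle fun j hj hja => ?_
    by_cases hj' : I.a 0 ≤ I.a j
    · rw [hx]
      exact S.le_max' _ ((hS _).2 ⟨Or.inr ⟨j, hj, rfl⟩, hj', hja⟩)
    · exact (not_le.1 hj').le.trans h₀
  have hx' : I.a 0 + (x - I.a 0) = x := by ring
  refine ⟨x - I.a 0, by linarith, by linarith, by linarith, ?_, fun i => ?_⟩
  · rw [hx']
    rcases hcand with h | h
    exacts [Or.inl (by linarith), Or.inr h]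
  · rw [gain, gain, if_neg (by linarith), if_neg (by linarith), hx', hbelow]
    have hB := I.below_nonneg (I.a 0 + t)
    have hq := I.q_nonneg 0
    refine mul_le_mul_of_nonneg_right (mul_le_mul_of_nonneg_left (by linarith) hq) ?_
    positivity

variable (I) in
/-- The two-phase contracts among which an optimal one is found: the first `k` boxes have payment
`t₁` and are accepted at once, the others have payment `t₂`.  The payment of an empty phase is
set to zero, so that there are finitely many of them. -/
structure IsPlan (k : ℕ) (t₁ t₂ : ℝ) : Prop where
  le : k ≤ I.n
  first : 0 < k → 0 ≤ t₁ ∧ t₁ ≤ I.v ∧ I.cap 0 ≤ I.a 0 + t₁ ∧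
    (0 < I.q 0 → t₁ = I.payFor (I.cap t₁)) ∧
    (I.cap t₁ = I.cap 0 ∨ I.cap t₁ = 0 ∨ ∃ j ≠ 0, I.cap t₁ = I.a j)
  second : k < I.n → 0 ≤ t₂ ∧ t₂ ≤ I.v ∧ I.a 0 + t₂ < I.cap 0 ∧
    (t₂ = 0 ∨ ∃ j ≠ 0, I.a 0 + t₂ = I.a j)
  first_eq : k = 0 → t₁ = 0
  second_eq : k = I.n → t₂ = 0

theorem exists_isPlan_of_q_zero (hq : I.q 0 = 0) : ∃ k t₁ t₂, I.IsPlan k t₁ t₂ := by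
  by_cases h : I.cap 0 ≤ I.a 0
  · exact ⟨I.n, 0, 0, le_rfl, fun _ => ⟨le_rfl, I.v_nonneg, by simpa using h,
      fun hq' => absurd hq hq'.ne', Or.inl rfl⟩, fun h => absurd h (lt_irrefl _), fun _ => rfl,
      fun _ => rfl⟩
  · exact ⟨0, 0, 0, Nat.zero_le _, fun h => absurd h (lt_irrefl _), fun _ => ⟨le_rfl, I.v_nonneg,
      by simpa using h, Or.inl rfl⟩, fun _ => rfl, fun _ => rfl⟩

theorem gain_eq_zero (hq : I.q 0 = 0) (i : ℕ) (t : ℝ) : I.gain i t = 0 := by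
  simp [gain, hq]

/-- Every contract is dominated by one of the two-phase contracts considered. -/
theorem exists_isPlan_ge (hq : 0 < I.q 0) {t : Fin I.n → ℝ} (ht : I.IsFeasible t)
    (hanti : Antitone t) : ∃ k t₁ t₂, I.IsPlan k t₁ t₂ ∧
      ∑ i : Fin I.n, I.gain i (t i) ≤ I.stepRevenue k t₁ t₂ := by
  classical
  obtain ⟨τ, hτ⟩ : ∃ τ : ℕ → ℝ, ∀ i : Fin I.n, τ i = t i :=
    ⟨fun i => if h : i < I.n then t ⟨i, h⟩ else 0, fun i => by simp⟩
  have hτ₀ : ∀ i < I.n, 0 ≤ τ i ∧ τ i ≤ I.v := fun i hi => by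
    simpa [← hτ] using ht ⟨i, hi⟩
  have hτanti : ∀ i j, i ≤ j → j < I.n → τ j ≤ τ i := fun i j hij hj => by
    have : (⟨i, hij.trans_lt hj⟩ : Fin I.n) ≤ ⟨j, hj⟩ := hij
    simpa [← hτ] using hanti this
  -- the boxes of the first phase are the first `k` ones
  have hex : ∃ i, I.n ≤ i ∨ I.a 0 + τ i < I.cap 0 := ⟨I.n, Or.inl le_rfl⟩
  obtain ⟨k, hk⟩ : ∃ k, k = Nat.find hex := ⟨_, rfl⟩
  have hkn : k ≤ I.n := hk ▸ Nat.find_min' hex (Or.inl le_rfl)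
  have hfirst : ∀ i < k, I.cap 0 ≤ I.a 0 + τ i := fun i hi => by
    have := Nat.find_min hex (hk ▸ hi)
    push Not at this
    exact this.2
  have hsecond : ∀ i, k ≤ i → i < I.n → I.a 0 + τ i < I.cap 0 := fun i hki hi => by
    have h := (hk ▸ Nat.find_spec hex : I.n ≤ k ∨ I.a 0 + τ k < I.cap 0)
    have h := h.resolve_left (by omega)
    have := hτanti k i hki hi
    linarith
  have hone : ∃ t₁, (0 < k → 0 ≤ t₁ ∧ t₁ ≤ I.v ∧ I.cap 0 ≤ I.a 0 + t₁ ∧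
      (0 < I.q 0 → t₁ = I.payFor (I.cap t₁)) ∧
      (I.cap t₁ = I.cap 0 ∨ I.cap t₁ = 0 ∨ ∃ j ≠ 0, I.cap t₁ = I.a j)) ∧ (k = 0 → t₁ = 0) ∧
      ∑ i ∈ Finset.range k, I.gain i (τ i) ≤ ∑ i ∈ Finset.range k, I.gain i t₁ := by
    rcases Nat.eq_zero_or_pos k with h | h
    · exact ⟨0, fun h' => absurd h' (by omega), fun _ => rfl, by simp [h]⟩
    · obtain ⟨l, hl, hsum⟩ := exists_sum_diagonal_le (f := fun i l => I.gain i (τ l)) h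
        (fun i l hi hl => I.gain_nonneg (hτ₀ l (by omega)).2)
        (fun i j l l' hij hj hl hl' => gain_mul_gain_le_of_phase_one (hτ₀ l' (by omega)).1
          (hτanti l l' hl (by omega)) (hτ₀ l (by omega)).2 (hfirst l' hl') hij)
      obtain ⟨t₁, h₁, h₂, h₃, h₄, h₅, h₆⟩ := exists_round_phase_one hq (hτ₀ l (by omega)).1
        (hτ₀ l (by omega)).2 (hfirst l hl)
      exact ⟨t₁, fun _ => ⟨h₁, h₂, h₃, fun _ => h₄, h₅⟩, fun h' => absurd h' (by omega),
        hsum.trans (Finset.sum_le_sum fun i _ => h₆ i)⟩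
  have htwo : ∃ t₂, (k < I.n → 0 ≤ t₂ ∧ t₂ ≤ I.v ∧ I.a 0 + t₂ < I.cap 0 ∧
      (t₂ = 0 ∨ ∃ j ≠ 0, I.a 0 + t₂ = I.a j)) ∧ (k = I.n → t₂ = 0) ∧
      ∑ i ∈ Finset.range (I.n - k), I.gain (k + i) (τ (k + i)) ≤
        ∑ i ∈ Finset.range (I.n - k), I.gain (k + i) t₂ := by
    rcases Nat.eq_zero_or_pos (I.n - k) with h | h
    · exact ⟨0, fun h' => absurd h' (by omega), fun _ => rfl, by simp [h]⟩
    · obtain ⟨l, hl, hsum⟩ := exists_sum_diagonal_le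
        (f := fun i l => I.gain (k + i) (τ (k + l))) h
        (fun i l hi hl => I.gain_nonneg (hτ₀ (k + l) (by omega)).2)
        (fun i j l l' hij hj hl hl' => gain_mul_gain_le_of_phase_two
          (hτanti (k + l) (k + l') (by omega) (by omega)) (hτ₀ (k + l) (by omega)).2
          (hsecond (k + l) (by omega) (by omega)) (by omega) (by omega))
      obtain ⟨t₂, h₁, h₂, h₃, h₄, h₅⟩ := exists_round_phase_two (hτ₀ (k + l) (by omega)).1
        (hτ₀ (k + l) (by omega)).2 (hsecond (k + l) (by omega) (by omega))
      exact ⟨t₂, fun _ => ⟨h₁, h₂, h₃, h₄⟩, fun h' => absurd h' (by omega),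
        hsum.trans (Finset.sum_le_sum fun i _ => h₅ _)⟩
  obtain ⟨t₁, h₁, h₁', hsum₁⟩ := hone
  obtain ⟨t₂, h₂, h₂', hsum₂⟩ := htwo
  refine ⟨k, t₁, t₂, ⟨hkn, h₁, h₂, h₁', h₂'⟩, ?_⟩
  have hn : I.n = k + (I.n - k) := by omega
  have hsplit : ∀ g : ℕ → ℝ, ∑ i ∈ Finset.range I.n, g i =
      ∑ i ∈ Finset.range k, g i + ∑ i ∈ Finset.range (I.n - k), g (k + i) := by
    intro g
    conv_lhs => rw [hn]
    exact Finset.sum_range_add _ _ _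
  have hleft : ∑ i : Fin I.n, I.gain i (t i) = ∑ i ∈ Finset.range I.n, I.gain i (τ i) := by
    rw [Finset.sum_range]
    exact Finset.sum_congr rfl fun i _ => by rw [hτ]
  rw [hleft, stepRevenue, hsplit, hsplit]
  refine add_le_add (hsum₁.trans (Finset.sum_le_sum fun i hi => ?_))
    (hsum₂.trans (Finset.sum_le_sum fun i hi => ?_))
  · rw [if_pos (Finset.mem_range.1 hi)]
  · rw [if_neg (by omega)]

/-! ### Existence of an optimal two-phase contract -/

theorem stepRevenue_eq (k : ℕ) (t₁ t₂ : ℝ) :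
    I.stepRevenue k t₁ t₂ = ∑ i : Fin I.n, I.gain i (if (i : ℕ) < k then t₁ else t₂) :=
  Finset.sum_range _

/-- The candidate contracts are finitely many, so one of them is best. -/
theorem exists_best_isPlan : ∃ k t₁ t₂, I.IsPlan k t₁ t₂ ∧ ∀ t, I.IsFeasible t → Antitone t →
    ∑ i : Fin I.n, I.gain i (t i) ≤ I.stepRevenue k t₁ t₂ := by
  classical
  -- without prize `0` all revenues vanish, and `payFor` would divide by zero
  rcases (I.q_nonneg 0).eq_or_lt with hq | hq
  · obtain ⟨k, t₁, t₂, h⟩ := exists_isPlan_of_q_zero hq.symm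
    exact ⟨k, t₁, t₂, h, fun t _ _ => by simp [stepRevenue, gain_eq_zero hq.symm]⟩
  let S : Finset (ℕ × ℝ × ℝ) := ((Finset.range (I.n + 1)) ×ˢ
    ((insert 0 ((insert (I.cap 0) (insert 0 (Finset.univ.image I.a))).image I.payFor)) ×ˢ
      (insert 0 (Finset.univ.image fun j => I.a j - I.a 0)))).filter
    fun x => I.IsPlan x.1 x.2.1 x.2.2
  have hS : ∀ k t₁ t₂, I.IsPlan k t₁ t₂ → (k, t₁, t₂) ∈ S := by
    intro k t₁ t₂ h
    refine Finset.mem_filter.2 ⟨Finset.mem_product.2 ⟨?_, Finset.mem_product.2 ⟨?_, ?_⟩⟩, h⟩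
    · exact Finset.mem_range.2 (Nat.lt_succ_of_le h.le)
    · rcases Nat.eq_zero_or_pos k with hk | hk
      · exact Finset.mem_insert.2 (Or.inl (h.first_eq hk))
      · obtain ⟨-, -, -, h₁, h₂⟩ := h.first hk
        refine Finset.mem_insert_of_mem (Finset.mem_image.2 ⟨I.cap t₁, ?_, (h₁ hq).symm⟩)
        rcases h₂ with h₂ | h₂ | ⟨j, -, h₂⟩ <;> simp [h₂]
    · rcases h.le.eq_or_lt with hk | hk
      · exact Finset.mem_insert.2 (Or.inl (h.second_eq hk))
      · obtain ⟨-, -, -, h₁⟩ := h.second hk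
        rcases h₁ with h₁ | ⟨j, -, h₁⟩
        · exact Finset.mem_insert.2 (Or.inl h₁)
        · exact Finset.mem_insert_of_mem (Finset.mem_image.2 ⟨j, Finset.mem_univ j, by
            rw [← h₁]; ring⟩)
  obtain ⟨k₀, u₁, u₂, h₀, -⟩ := exists_isPlan_ge hq (t := fun _ => 0)
    (fun _ => ⟨le_rfl, I.v_nonneg⟩) (fun _ _ _ => le_rfl)
  obtain ⟨⟨k, t₁, t₂⟩, hmem, hmax⟩ := S.exists_max_image
    (fun x => I.stepRevenue x.1 x.2.1 x.2.2) ⟨_, hS _ _ _ h₀⟩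
  refine ⟨k, t₁, t₂, (Finset.mem_filter.1 hmem).2, fun t ht hanti => ?_⟩
  obtain ⟨k', t₁', t₂', h', hle⟩ := exists_isPlan_ge hq ht hanti
  exact hle.trans (hmax _ (hS _ _ _ h'))

theorem exists_optimal_isTwoPhase (I : IIDBoxes ℝ) : ∃ t : Fin I.n → ℝ,
    I.toBoxes.IsOptimalContract (I.payments t) ∧ I.IsTwoPhase t := by
  obtain ⟨k, t₁, t₂, h, hmax⟩ := exists_best_isPlan (I := I)
  obtain ⟨t, ht⟩ : ∃ t : Fin I.n → ℝ, ∀ i, t i = if (i : ℕ) < k then t₁ else t₂ := ⟨_, fun _ => rfl⟩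
  have hone : ∀ i : Fin I.n, (i : ℕ) < k → t i = t₁ := fun i hi => by rw [ht, if_pos hi]
  have htwo : ∀ i : Fin I.n, k ≤ (i : ℕ) → t i = t₂ := fun i hi => by rw [ht, if_neg (by omega)]
  have hfeas : I.IsFeasible t := by
    intro i
    rcases lt_or_ge (i : ℕ) k with hi | hi
    · have := h.first (by omega)
      rw [hone i hi]
      exact ⟨this.1, this.2.1⟩
    · have := h.second (by omega)
      rw [htwo i hi]
      exact ⟨this.1, this.2.1⟩
  have hanti : Antitone t := by
    intro i j hij
    have hij : (i : ℕ) ≤ j := hij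
    rcases lt_or_ge (j : ℕ) k with hj | hj
    · rw [hone i (by omega), hone j hj]
    · rcases lt_or_ge (i : ℕ) k with hi | hi
      · rw [hone i hi, htwo j hj]
        have h₁ := h.first (by omega)
        have h₂ := h.second (by omega)
        linarith [h₁.2.2.1, h₂.2.2.1]
      · rw [htwo i hi, htwo j hj]
  have hsum : ∑ i : Fin I.n, I.gain i (t i) = I.stepRevenue k t₁ t₂ := by
    simp only [ht, stepRevenue_eq]
  have hlex : Antitone fun i => I.lexCap (t i) := by
    intro i j hij
    have hij' : (i : ℕ) ≤ j := hij
    dsimp only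
    rcases lt_or_ge (j : ℕ) k with hj | hj
    · rw [hone i (by omega), hone j hj]
    · rcases lt_or_ge (i : ℕ) k with hi | hi
      · have h₂ := h.second (by omega)
        have hb : I.bonus (t j) = 0 := by
          rw [htwo j hj, bonus, if_neg (not_le.2 h₂.2.2.1)]
        refine Prod.Lex.toLex_mono ⟨I.cap_mono (hfeas j).1 (hanti hij), ?_⟩
        simp only [hb]
        exact I.bonus_nonneg (hfeas i).2
      · rw [htwo i hi, htwo j hj]
  obtain ⟨π, h₁, h₂, h₃, -⟩ := I.toBoxes.exists_optimalPolicy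
    (I.isLexCap (fun i => (hfeas i).1) (fun i => (hfeas i).2)) k (by
      intro i hi
      rw [lexPayoff_payments]
      have hphase : I.cap 0 ≤ I.a 0 + t i := by
        rw [hone i hi]
        exact (h.first (by omega)).2.2.1
      have := I.min_of_isHit (hfeas i).1 (hfeas i).2 (j := 0) (Or.inl rfl)
      rw [level, if_pos hphase] at this
      exact min_eq_right_iff.1 this)
  refine ⟨t, isOptimalContract_of_forall_le hfeas hanti (by rwa [hsum]), k, I.cap 0,
    if k = 0 then I.cap 0 else I.cap t₁, t₂, π, h.le, ?_, ?_, ?_, ?_, ?_, ?_, h₁, h₂ hlex, h₃⟩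
  · split_ifs with hk
    · exact le_rfl
    · exact I.cap_mono le_rfl (h.first (by omega)).1
  · exact fun i => I.overshoot_cap le_rfl
  · intro i hi
    obtain ⟨h₁, -, h₃, -⟩ := h.first (by omega)
    rw [if_neg (by omega), isFairCap_iff, hone i hi]
    exact ⟨I.overshoot_cap h₁, I.cap_le_of_le h₁ h₃⟩
  · intro i hi
    obtain ⟨h₁, -, h₃, -⟩ := h.second (by omega)
    rw [isFairCap_iff, htwo i hi, ← I.cap_eq_of_lt h₁ h₃]
    exact ⟨I.overshoot_cap h₁, rfl, by rwa [I.cap_eq_of_lt h₁ h₃]⟩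
  · intro hk
    rw [if_neg (by omega)]
    exact (h.first hk).2.2.2.2
  · exact fun hk => (h.second hk).2.2.2

end IIDBoxes

/-! ### Binary lengths of rational numbers -/

theorem Nat.size_mul_le (a b : ℕ) : (a * b).size ≤ a.size + b.size := by
  rw [Nat.size_le, pow_add]
  exact Nat.mul_lt_mul'' (Nat.lt_size_self a) (Nat.lt_size_self b)

theorem Nat.size_add_le (a b : ℕ) : (a + b).size ≤ a.size + b.size + 1 := by
  rw [Nat.size_le]
  have ha := Nat.lt_size_self a
  have hb := Nat.lt_size_self b
  have h₁ : 2 ^ a.size ≤ 2 ^ (a.size + b.size) := Nat.pow_le_pow_right two_pos (by omega)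
  have h₂ : 2 ^ b.size ≤ 2 ^ (a.size + b.size) := Nat.pow_le_pow_right two_pos (by omega)
  rw [pow_succ]
  omega

theorem bitLength_le_of_eq_div {x : ℚ} {a b : ℤ} (hb : b ≠ 0) (h : x = a / b) :
    bitLength x ≤ a.natAbs.size + b.natAbs.size := by
  rw [← Rat.divInt_eq_div] at h
  subst h
  refine add_le_add (Nat.size_le_size ?_) (Nat.size_le_size ?_)
  · rcases eq_or_ne a 0 with rfl | ha
    · simp
    · exact Nat.le_of_dvd (Int.natAbs_pos.2 ha) (Int.natAbs_dvd_natAbs.2 (Rat.num_dvd a hb))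
  · exact Nat.le_of_dvd (Int.natAbs_pos.2 hb) (by
      have := Int.natAbs_dvd_natAbs.2 (Rat.den_dvd a b)
      simpa using this)

theorem bitLength_zero : bitLength 0 = 1 := by simp [bitLength, Nat.size_one]

theorem bitLength_one : bitLength 1 = 2 := by simp [bitLength, Nat.size_one]

theorem bitLength_natCast (n : ℕ) : bitLength (n : ℚ) ≤ n + 1 := by
  have : n.size ≤ n := Nat.size_le.2 n.lt_two_pow_self
  simpa [bitLength, Nat.size_one] using this

theorem bitLength_add_le (x y : ℚ) :
    bitLength (x + y) ≤ 2 * (bitLength x + bitLength y) + 1 := by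
  have hx : (x.den : ℤ) ≠ 0 := by simp
  have hy : (y.den : ℤ) ≠ 0 := by simp
  have h := bitLength_le_of_eq_div (x := x + y) (a := x.num * y.den + y.num * x.den)
    (b := x.den * y.den) (mul_ne_zero hx hy) (by
      push_cast
      conv_lhs => rw [← Rat.num_div_den x, ← Rat.num_div_den y]
      field_simp)
  have h₁ : (x.num * y.den + y.num * x.den).natAbs ≤
      x.num.natAbs * y.den + y.num.natAbs * x.den :=
    (Int.natAbs_add_le _ _).trans (by simp [Int.natAbs_mul])
  have h₂ := (Nat.size_le_size h₁).trans (Nat.size_add_le _ _)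
  have h₃ := Nat.size_mul_le x.num.natAbs y.den
  have h₄ := Nat.size_mul_le y.num.natAbs x.den
  have h₅ := Nat.size_mul_le x.den y.den
  simp only [Int.natAbs_mul, Int.natAbs_natCast] at h
  unfold bitLength at *
  omega

theorem bitLength_neg (x : ℚ) : bitLength (-x) = bitLength x := by simp [bitLength]

theorem bitLength_sub_le (x y : ℚ) :
    bitLength (x - y) ≤ 2 * (bitLength x + bitLength y) + 1 := by
  rw [sub_eq_add_neg, ← bitLength_neg y]
  exact bitLength_add_le x (-y)

theorem bitLength_mul_le (x y : ℚ) : bitLength (x * y) ≤ bitLength x + bitLength y := by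
  have hx : (x.den : ℤ) ≠ 0 := by simp
  have hy : (y.den : ℤ) ≠ 0 := by simp
  have h := bitLength_le_of_eq_div (x := x * y) (a := x.num * y.num)
    (b := x.den * y.den) (mul_ne_zero hx hy) (by
      push_cast
      conv_lhs => rw [← Rat.num_div_den x, ← Rat.num_div_den y]
      field_simp)
  have h₃ := Nat.size_mul_le x.num.natAbs y.num.natAbs
  have h₅ := Nat.size_mul_le x.den y.den
  simp only [Int.natAbs_mul, Int.natAbs_natCast] at h
  unfold bitLength at *
  omega

theorem bitLength_div_le (x y : ℚ) : bitLength (x / y) ≤ bitLength x + bitLength y := by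
  rcases eq_or_ne y 0 with rfl | h0
  · simp [bitLength_zero]
  have hx : (x.den : ℤ) ≠ 0 := by simp
  have hy : y.num ≠ 0 := by simpa using h0
  have hy' : (y.num : ℚ) ≠ 0 := by exact_mod_cast hy
  have h := bitLength_le_of_eq_div (x := x / y) (a := x.num * y.den)
    (b := x.den * y.num) (mul_ne_zero hx hy) (by
      push_cast
      conv_lhs => rw [← Rat.num_div_den x, ← Rat.num_div_den y]
      field_simp)
  have h₃ := Nat.size_mul_le x.num.natAbs y.den
  have h₅ := Nat.size_mul_le x.den y.num.natAbs
  simp only [Int.natAbs_mul, Int.natAbs_natCast] at h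
  unfold bitLength at *
  omega

/-- Sums stay short because all terms have a common denominator of length at most `i * b`. -/
theorem bitLength_sum_le {x : ℕ → ℚ} {b i : ℕ} (h : ∀ l < i, bitLength (x l) ≤ b) :
    bitLength (∑ l ∈ Finset.range i, x l) ≤ 2 * (i * b) + i + 1 := by
  have key : ∃ (p : ℤ) (q : ℕ), q ≠ 0 ∧ ∑ l ∈ Finset.range i, x l = p / q ∧ q ≤ 2 ^ (i * b) ∧
      p.natAbs ≤ i * 2 ^ (i * b) := by
    induction i with
    | zero => exact ⟨0, 1, one_ne_zero, by simp, by simp, by simp⟩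
    | succ i ih =>
      obtain ⟨p, q, h₁, h₂, h₃, h₄⟩ := ih fun l hl => h l (by omega)
      have hb := h i (by omega)
      have hnum : (x i).num.natAbs ≤ 2 ^ b :=
        (Nat.lt_size_self _).le.trans (Nat.pow_le_pow_right two_pos (by unfold bitLength at hb; omega))
      have hden : (x i).den ≤ 2 ^ b :=
        (Nat.lt_size_self _).le.trans (Nat.pow_le_pow_right two_pos (by unfold bitLength at hb; omega))
      refine ⟨p * (x i).den + (x i).num * q, q * (x i).den, mul_ne_zero h₁ (x i).den_nz, ?_, ?_, ?_⟩
      · rw [Finset.sum_range_succ, h₂]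
        have : (q : ℚ) ≠ 0 := by exact_mod_cast h₁
        conv_lhs => rw [← Rat.num_div_den (x i)]
        push_cast
        field_simp
      · rw [add_mul, one_mul, pow_add]
        exact Nat.mul_le_mul h₃ hden
      · refine (Int.natAbs_add_le _ _).trans ?_
        simp only [Int.natAbs_mul, Int.natAbs_natCast]
        rw [add_mul i 1 b, one_mul, pow_add, add_mul, one_mul, ← mul_assoc]
        refine add_le_add (Nat.mul_le_mul h₄ hden) ?_
        rw [mul_comm]
        exact Nat.mul_le_mul h₃ hnum
  obtain ⟨p, q, h₁, h₂, h₃, h₄⟩ := key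
  have hq : (q : ℤ) ≠ 0 := by exact_mod_cast h₁
  have hlen := bitLength_le_of_eq_div hq (by simpa using h₂)
  have hp : p.natAbs.size ≤ i + i * b := by
    rw [Nat.size_le, pow_add]
    refine h₄.trans_lt ?_
    exact Nat.mul_lt_mul_of_pos_right i.lt_two_pow_self (by positivity)
  have hq' : q.size ≤ i * b + 1 := by
    rw [Nat.size_le, pow_succ]
    have : 0 < 2 ^ (i * b) := by positivity
    omega
  simp only [Int.natAbs_natCast] at hlen
  omega

theorem bitLength_prod_le {x : ℕ → ℚ} {b i : ℕ} (h : ∀ l < i, bitLength (x l) ≤ b) :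
    bitLength (∏ l ∈ Finset.range i, x l) ≤ i * b + 2 := by
  induction i with
  | zero => simp [bitLength_one]
  | succ i ih =>
    rw [Finset.prod_range_succ, add_mul, one_mul]
    have h₁ := ih fun l hl => h l (by omega)
    have h₂ := h i (by omega)
    have := bitLength_mul_le (∏ l ∈ Finset.range i, x l) (x i)
    omega

/-! ### Functions computable in polynomial time -/

open Polynomial in
theorem Polynomial.eval_mono_nat (p : ℕ[X]) {a b : ℕ} (h : a ≤ b) : p.eval a ≤ p.eval b := by
  rw [Polynomial.eval_eq_sum, Polynomial.eval_eq_sum]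
  exact Finset.sum_le_sum fun i _ => Nat.mul_le_mul_left _ (Nat.pow_le_pow_left h i)

namespace RAM

open Polynomial

/-- Cell `r` of the working array. -/
def cell (r : ℕ) : Expr := .load 4 (.const r)

/-- Writes a value to cell `r` of the working array. -/
def setCell (r : ℕ) (e : Expr) : Program := .store 4 (.const r) e

theorem eval_cell (μ : Memory) (r : ℕ) : (cell r).eval μ = μ 4 r := by simp [cell, Expr.eval]

theorem cost_cell (μ : Memory) (r : ℕ) :
    (cell r).cost μ = bitLength r + bitLength (μ 4 r) + 2 := by
  simp [cell, Expr.cost, Expr.eval]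
  ring

theorem runs_setCell (μ : Memory) (r : ℕ) (e : Expr) :
    Runs (setCell r e) μ (μ.write 4 r (e.eval μ)) (bitLength r + e.cost μ + 2) := by
  have := Runs.store 4 (.const r) e μ
  simp only [Expr.eval, Expr.cost, Nat.floor_natCast] at this
  rw [show bitLength r + e.cost μ + 2 = 1 + bitLength r + e.cost μ + 1 by ring]
  exact this

theorem write_same (μ : Memory) (k i : ℕ) (x : ℚ) : μ.write k i x k i = x := by
  simp [Memory.write]

theorem write_of_ne (μ : Memory) {k i k' i' : ℕ} (x : ℚ) (h : k' ≠ k ∨ i' ≠ i) :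
    μ.write k i x k' i' = μ k' i' := by
  unfold Memory.write
  by_cases hk : k' = k
  · subst hk
    rw [Function.update_self, Function.update_of_ne (h.resolve_left (by simp))]
  · rw [Function.update_of_ne hk]

/-- The memories differ at most in the cells of the working array from `r` on. -/
def Same (r : ℕ) (μ μ' : Memory) : Prop := ∀ k i, k ≠ 4 ∨ i < r → μ' k i = μ k i

theorem Same.trans {r r' : ℕ} {μ μ' μ'' : Memory} (h : Same r μ μ') (h' : Same r' μ' μ'')
    (hr : r ≤ r') : Same r μ μ'' := fun k i hi =>
  (h' k i (hi.imp_right fun hi => hi.trans_le hr)).trans (h k i hi)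

theorem same_write (μ : Memory) {r i : ℕ} (h : r ≤ i) (x : ℚ) : Same r μ (μ.write 4 i x) := by
  intro k i' hi
  refine write_of_ne μ x ?_
  omega

/-- The memory contains the input, and the natural number `ρ k` in cell `ℓ k` of the working
array. -/
def Reads {d : ℕ} (I : IIDBoxes ℚ) (ℓ : Fin d → ℕ) (ρ : Fin d → ℕ) (μ : Memory) : Prop :=
  (∀ k < 3, ∀ i, μ k i = I.input k i) ∧ ∀ k, μ 4 (ℓ k) = ρ k

theorem Reads.of_same {d : ℕ} {I : IIDBoxes ℚ} {ℓ : Fin d → ℕ} {ρ : Fin d → ℕ} {μ μ' : Memory}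
    {r : ℕ} (h : Reads I ℓ ρ μ) (hr : ∀ k, ℓ k < r) (hs : Same r μ μ') : Reads I ℓ ρ μ' :=
  ⟨fun k hk i => (hs k i (Or.inl (by omega))).trans (h.1 k hk i),
    fun k => (hs 4 (ℓ k) (Or.inr (hr k))).trans (h.2 k)⟩

theorem Reads.cons {d : ℕ} {I : IIDBoxes ℚ} {ℓ : Fin d → ℕ} {ρ : Fin d → ℕ} {μ : Memory}
    (h : Reads I ℓ ρ μ) {r i : ℕ} (hi : μ 4 r = i) :
    Reads I (Fin.cons r ℓ) (Fin.cons i ρ : Fin (d + 1) → ℕ) μ := by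
  refine ⟨h.1, fun k => ?_⟩
  refine Fin.cases ?_ (fun k => ?_) k
  · simpa using hi
  · simpa using h.2 k

/-- The size of the input and of the variables, which are counted in unary. -/
def sz {d : ℕ} (I : IIDBoxes ℚ) (ρ : Fin d → ℕ) : ℕ := I.size + ∑ k, ρ k

theorem sz_cons {d : ℕ} (I : IIDBoxes ℚ) (i : ℕ) (ρ : Fin d → ℕ) :
    sz I (Fin.cons i ρ : Fin (d + 1) → ℕ) = sz I ρ + i := by
  simp only [sz, Fin.sum_univ_succ, Fin.cons_zero, Fin.cons_succ]
  ring

/-- Variables that range up to the size of the input change the size polynomially. -/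
theorem eval_sz_cons_le {d : ℕ} (p : ℕ[X]) (I : IIDBoxes ℚ) {i : ℕ} (hi : i ≤ I.size + 3)
    (ρ : Fin d → ℕ) :
    p.eval (sz I (Fin.cons i ρ : Fin (d + 1) → ℕ)) ≤ (p.comp (2 * X + 3)).eval (sz I ρ) := by
  rw [sz_cons, Polynomial.eval_comp]
  refine p.eval_mono_nat ?_
  have : I.size ≤ sz I ρ := Nat.le_add_right _ _
  simp only [eval_add, eval_mul, eval_X, eval_ofNat]
  omega

/-- `f` is computable in polynomial time: for any placement `ℓ` of the variables in the working
array there is a program that leaves the value of `f` in a prescribed later cell, without changing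
anything before that cell.  The variables are natural numbers, and time is polynomial in the size
of the input plus the values of the variables; also the length of the value is polynomial. -/
structure PolyTime {d : ℕ} (f : IIDBoxes ℚ → (Fin d → ℕ) → ℚ) : Prop where
  length_le : ∃ p : ℕ[X], ∀ I ρ, bitLength (f I ρ) ≤ p.eval (sz I ρ)
  exists_program : ∀ (ℓ : Fin d → ℕ) (r : ℕ), (∀ k, ℓ k < r) → ∃ (P : Program) (p : ℕ[X]),
    ∀ I ρ μ, Reads I ℓ ρ μ → ∃ μ' w, Runs P μ μ' w ∧ w ≤ p.eval (sz I ρ) ∧ Same r μ μ' ∧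
      μ' 4 r = f I ρ

namespace PolyTime

variable {d : ℕ} {f g f₁ f₂ : IIDBoxes ℚ → (Fin d → ℕ) → ℚ}

theorem congr (hf : PolyTime f) (h : ∀ I ρ, g I ρ = f I ρ) : PolyTime g := by
  have : g = f := by funext I ρ; exact h I ρ
  rwa [this]

theorem const (x : ℚ) : PolyTime (d := d) fun _ _ => x where
  length_le := ⟨C (bitLength x), fun I ρ => by simp⟩
  exists_program ℓ r _ := by
    refine ⟨setCell r (.const x), C (bitLength (r : ℚ) + bitLength x + 3), fun I ρ μ _ =>
      ⟨_, _, runs_setCell μ r _, ?_, same_write μ le_rfl _, write_same _ _ _ _⟩⟩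
    simp only [Expr.cost, eval_C]
    omega

theorem var (k : Fin d) : PolyTime fun _ ρ => (ρ k : ℚ) where
  length_le := ⟨X + 1, fun I ρ => by
    refine (bitLength_natCast _).trans ?_
    have : ρ k ≤ ∑ k, ρ k := Finset.single_le_sum (fun _ _ => Nat.zero_le _) (Finset.mem_univ k)
    simp only [eval_add, eval_X, eval_one, sz]
    omega⟩
  exists_program ℓ r hr := by
    refine ⟨setCell r (cell (ℓ k)), X + C (bitLength (r : ℚ) + bitLength (ℓ k : ℚ) + 5),
      fun I ρ μ h => ⟨_, _, runs_setCell μ r _, ?_, same_write μ le_rfl _, ?_⟩⟩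
    · have h₁ := bitLength_natCast (ρ k)
      have h₂ : ρ k ≤ ∑ k, ρ k :=
        Finset.single_le_sum (fun _ _ => Nat.zero_le _) (Finset.mem_univ k)
      rw [cost_cell, h.2 k]
      simp only [eval_add, eval_X, eval_C, sz]
      omega
    · rw [write_same, eval_cell, h.2 k]

/-- A function may ignore variables. -/
theorem tail (hf : PolyTime f) : PolyTime fun I (ρ : Fin (d + 1) → ℕ) => f I (Fin.tail ρ) := by
  have hsz : ∀ (I : IIDBoxes ℚ) (ρ : Fin (d + 1) → ℕ), sz I (Fin.tail ρ) ≤ sz I ρ := by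
    intro I ρ
    simp only [sz, Fin.sum_univ_succ, Fin.tail]
    omega
  obtain ⟨⟨p, hp⟩, hprog⟩ := hf
  refine ⟨⟨p, fun I ρ => (hp I _).trans (p.eval_mono_nat (hsz I ρ))⟩, fun ℓ r hr => ?_⟩
  obtain ⟨P, q, h⟩ := hprog (Fin.tail ℓ) r fun k => hr _
  refine ⟨P, q, fun I ρ μ hμ => ?_⟩
  obtain ⟨μ', w, h₁, h₂, h₃, h₄⟩ := h I (Fin.tail ρ) μ ⟨hμ.1, fun k => hμ.2 k.succ⟩
  exact ⟨μ', w, h₁, h₂.trans (q.eval_mono_nat (hsz I ρ)), h₃, h₄⟩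

/-- Two functions can be computed into consecutive cells. -/
theorem exists_program_pair (hf : PolyTime f) (hg : PolyTime g) (ℓ : Fin d → ℕ) (r : ℕ)
    (hr : ∀ k, ℓ k < r) : ∃ (P : Program) (p : ℕ[X]), ∀ I ρ μ, Reads I ℓ ρ μ →
      ∃ μ' w, Runs P μ μ' w ∧ w ≤ p.eval (sz I ρ) ∧ Same r μ μ' ∧
        μ' 4 r = f I ρ ∧ μ' 4 (r + 1) = g I ρ := by
  obtain ⟨P, p, hP⟩ := hf.exists_program ℓ r hr
  obtain ⟨Q, q, hQ⟩ := hg.exists_program ℓ (r + 1) fun k => (hr k).trans (Nat.lt_succ_self r)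
  refine ⟨.seq P Q, p + q + 1, fun I ρ μ h => ?_⟩
  obtain ⟨μ₁, w₁, h₁, h₂, h₃, h₄⟩ := hP I ρ μ h
  obtain ⟨μ₂, w₂, k₁, k₂, k₃, k₄⟩ := hQ I ρ μ₁ (h.of_same hr h₃)
  refine ⟨μ₂, _, .seq h₁ k₁, ?_, h₃.trans k₃ (Nat.le_succ r), ?_, k₄⟩
  · simp only [eval_add, eval_one]
    omega
  · rw [k₃ 4 r (Or.inr (Nat.lt_succ_self r)), h₄]

/-- The arithmetic operations of the machine, which increase the length at most linearly. -/
theorem binary {op : ℚ → ℚ → ℚ} {e : Expr → Expr → Expr}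
    (heval : ∀ μ x y, (e x y).eval μ = op (x.eval μ) (y.eval μ))
    (hcost : ∀ μ x y, (e x y).cost μ = x.cost μ + y.cost μ + 1 + bitLength ((e x y).eval μ))
    (hop : ∀ x y, bitLength (op x y) ≤ 2 * (bitLength x + bitLength y) + 1)
    (hf : PolyTime f) (hg : PolyTime g) : PolyTime fun I ρ => op (f I ρ) (g I ρ) := by
  obtain ⟨p, hp⟩ := hf.length_le
  obtain ⟨q, hq⟩ := hg.length_le
  refine ⟨⟨2 * (p + q) + 1, fun I ρ => ?_⟩, fun ℓ r hr => ?_⟩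
  · have h₁ := hop (f I ρ) (g I ρ)
    have h₂ := hp I ρ
    have h₃ := hq I ρ
    simp only [eval_add, eval_mul, eval_ofNat, eval_one]
    omega
  · obtain ⟨P, s, hP⟩ := exists_program_pair hf hg ℓ r hr
    refine ⟨.seq P (setCell r (e (cell r) (cell (r + 1)))),
      s + 3 * (p + q) + C (2 * bitLength (r : ℚ) + bitLength ((r + 1 : ℕ) : ℚ) + 9),
      fun I ρ μ h => ?_⟩
    obtain ⟨μ', w, h₁, h₂, h₃, h₄, h₅⟩ := hP I ρ μ h
    refine ⟨_, _, .seq h₁ (runs_setCell μ' r _), ?_, h₃.trans (same_write μ' le_rfl _) le_rfl, ?_⟩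
    · have k₁ := hop (f I ρ) (g I ρ)
      have k₂ := hp I ρ
      have k₃ := hq I ρ
      rw [hcost, heval, cost_cell, cost_cell, eval_cell, eval_cell, h₄, h₅]
      simp only [eval_add, eval_mul, eval_ofNat, eval_C]
      omega
    · rw [write_same, heval, eval_cell, eval_cell, h₄, h₅]

theorem add (hf : PolyTime f) (hg : PolyTime g) : PolyTime fun I ρ => f I ρ + g I ρ :=
  binary (e := .add) (fun _ _ _ => rfl) (fun _ _ _ => rfl) bitLength_add_le hf hg

theorem sub (hf : PolyTime f) (hg : PolyTime g) : PolyTime fun I ρ => f I ρ - g I ρ :=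
  binary (e := .sub) (fun _ _ _ => rfl) (fun _ _ _ => rfl) bitLength_sub_le hf hg

theorem mul (hf : PolyTime f) (hg : PolyTime g) : PolyTime fun I ρ => f I ρ * g I ρ :=
  binary (e := .mul) (fun _ _ _ => rfl) (fun _ _ _ => rfl)
    (fun x y => (bitLength_mul_le x y).trans (by omega)) hf hg

theorem div (hf : PolyTime f) (hg : PolyTime g) : PolyTime fun I ρ => f I ρ / g I ρ :=
  binary (e := .div) (fun _ _ _ => rfl) (fun _ _ _ => rfl)
    (fun x y => (bitLength_div_le x y).trans (by omega)) hf hg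

theorem ite_lt (hf : PolyTime f) (hg : PolyTime g) (h₁ : PolyTime f₁) (h₂ : PolyTime f₂) :
    PolyTime fun I ρ => if f I ρ < g I ρ then f₁ I ρ else f₂ I ρ := by
  obtain ⟨p, hp⟩ := hf.length_le
  obtain ⟨q, hq⟩ := hg.length_le
  obtain ⟨p₁, hp₁⟩ := h₁.length_le
  obtain ⟨p₂, hp₂⟩ := h₂.length_le
  refine ⟨⟨p₁ + p₂, fun I ρ => ?_⟩, fun ℓ r hr => ?_⟩
  · have := hp₁ I ρ
    have := hp₂ I ρ
    rw [eval_add]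
    split_ifs <;> omega
  -- the values compared are no longer needed when a branch is run, so it may overwrite them
  · obtain ⟨P, s, hP⟩ := exists_program_pair hf hg ℓ r hr
    obtain ⟨P₁, s₁, hP₁⟩ := h₁.exists_program ℓ r hr
    obtain ⟨P₂, s₂, hP₂⟩ := h₂.exists_program ℓ r hr
    refine ⟨.seq P (.cond (.sub (cell (r + 1)) (cell r)) P₁ P₂),
      s + s₁ + s₂ + 3 * (p + q) + C (bitLength (r : ℚ) + bitLength ((r + 1 : ℕ) : ℚ) + 9),
      fun I ρ μ h => ?_⟩
    obtain ⟨μ', w, h₁, h₂, h₃, h₄, h₅⟩ := hP I ρ μ h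
    have hμ' := h.of_same hr h₃
    have heval : (Expr.sub (cell (r + 1)) (cell r)).eval μ' = g I ρ - f I ρ := by
      simp only [Expr.eval, eval_cell, h₄, h₅]
    have hcost : (Expr.sub (cell (r + 1)) (cell r)).cost μ' ≤ 3 * (p + q).eval (sz I ρ) +
        (bitLength (r : ℚ) + bitLength ((r + 1 : ℕ) : ℚ) + 6) := by
      have k₁ := bitLength_sub_le (g I ρ) (f I ρ)
      have k₂ := hp I ρ
      have k₃ := hq I ρ
      rw [Expr.cost, heval, cost_cell, cost_cell, h₄, h₅, eval_add]
      omega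
    simp only [eval_add, eval_mul, eval_ofNat, eval_C] at hcost ⊢
    by_cases hlt : f I ρ < g I ρ
    · obtain ⟨μ'', w', k₁, k₂, k₃, k₄⟩ := hP₁ I ρ μ' hμ'
      refine ⟨μ'', _, .seq h₁ (.condTrue (by rw [heval]; linarith) k₁), ?_,
        h₃.trans k₃ le_rfl, by rw [if_pos hlt, k₄]⟩
      omega
    · obtain ⟨μ'', w', k₁, k₂, k₃, k₄⟩ := hP₂ I ρ μ' hμ'
      refine ⟨μ'', _, .seq h₁ (.condFalse (by rw [heval]; linarith) k₁), ?_,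
        h₃.trans k₃ le_rfl, by rw [if_neg hlt, k₄]⟩
      omega

theorem ite_le (hf : PolyTime f) (hg : PolyTime g) (h₁ : PolyTime f₁) (h₂ : PolyTime f₂) :
    PolyTime fun I ρ => if f I ρ ≤ g I ρ then f₁ I ρ else f₂ I ρ :=
  (ite_lt hg hf h₂ h₁).congr fun I ρ => by
    by_cases h : f I ρ ≤ g I ρ
    · rw [if_pos h, if_neg (not_lt.2 h)]
    · rw [if_neg h, if_pos (not_le.1 h)]

theorem max (hf : PolyTime f) (hg : PolyTime g) :
    PolyTime fun I ρ => Max.max (f I ρ) (g I ρ) :=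
  (ite_le hf hg hg hf).congr fun _ _ => max_def _ _

theorem min (hf : PolyTime f) (hg : PolyTime g) :
    PolyTime fun I ρ => Min.min (f I ρ) (g I ρ) :=
  (ite_le hf hg hf hg).congr fun _ _ => min_def _ _

theorem bitLength_input_le (I : IIDBoxes ℚ) (k i : ℕ) : bitLength (I.input k i) ≤ I.size + 1 := by
  have h0 : bitLength 0 ≤ I.size + 1 := by rw [bitLength_zero]; omega
  have hsum : ∀ j : Fin (I.m + 1), bitLength (I.a j) + bitLength (I.q j) ≤
      ∑ j, (bitLength (I.a j) + bitLength (I.q j)) := fun j =>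
    Finset.single_le_sum (f := fun j => bitLength (I.a j) + bitLength (I.q j))
      (fun _ _ => Nat.zero_le _) (Finset.mem_univ j)
  unfold IIDBoxes.input
  split
  · split
    · refine (bitLength_natCast _).trans ?_
      unfold IIDBoxes.size
      omega
    · refine (bitLength_natCast _).trans ?_
      unfold IIDBoxes.size
      omega
    · unfold IIDBoxes.size
      omega
    · unfold IIDBoxes.size
      omega
    · exact h0
  · split_ifs with h
    · have := hsum ⟨i, h⟩
      unfold IIDBoxes.size
      omega
    · exact h0
  · split_ifs with h
    · have := hsum ⟨i, h⟩
      unfold IIDBoxes.size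
      omega
    · exact h0
  · exact h0

/-- The input can be read at computed positions. -/
theorem input {j : IIDBoxes ℚ → (Fin d → ℕ) → ℕ} (hj : PolyTime fun I ρ => (j I ρ : ℚ)) {k : ℕ}
    (hk : k < 3) : PolyTime fun I ρ => I.input k (j I ρ) := by
  obtain ⟨p, hp⟩ := hj.length_le
  refine ⟨⟨X + 1, fun I ρ => ?_⟩, fun ℓ r hr => ?_⟩
  · refine (bitLength_input_le I _ _).trans ?_
    simp only [eval_add, eval_X, eval_one, sz]
    omega
  · obtain ⟨P, s, hP⟩ := hj.exists_program ℓ r hr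
    refine ⟨.seq P (setCell r (.load k (cell r))),
      s + p + X + C (2 * bitLength (r : ℚ) + 7), fun I ρ μ h => ?_⟩
    obtain ⟨μ', w, h₁, h₂, h₃, h₄⟩ := hP I ρ μ h
    have heval : (Expr.load k (cell r)).eval μ' = I.input k (j I ρ) := by
      rw [Expr.eval, eval_cell, h₄, Nat.floor_natCast]
      exact (h.of_same hr h₃).1 k hk _
    refine ⟨_, _, .seq h₁ (runs_setCell μ' r _), ?_, h₃.trans (same_write μ' le_rfl _) le_rfl, ?_⟩
    · have k₁ := bitLength_input_le I k (j I ρ)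
      have k₂ := hp I ρ
      rw [Expr.cost, heval, cost_cell, h₄]
      simp only [eval_add, eval_X, eval_C, sz] at *
      omega
    · rw [write_same, heval]

end PolyTime

end RAM

/-! ### Bounded loops -/

namespace RAM

open Polynomial

/-- The loop behind `PolyTime.fold`: cell `r + 1` counts up to the bound in cell `r + 2`. -/
theorem runs_count {r N c : ℕ} {P : Program} {R : Memory → Prop} {a : ℕ → ℚ}
    (hR : ∀ μ μ', R μ → Same r μ μ' → R μ')
    (hstep : ∀ i μ, i < N → R μ → μ 4 r = a i → μ 4 (r + 1) = i → ∃ μ' w, Runs P μ μ' w ∧ w ≤ c ∧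
      Same r μ μ' ∧ μ' 4 r = a (i + 1) ∧ μ' 4 (r + 1) = i ∧ μ' 4 (r + 2) = μ 4 (r + 2))
    (j i : ℕ) (hij : i + j = N) (μ : Memory) (hμ : R μ) (h₀ : μ 4 r = a i) (h₁ : μ 4 (r + 1) = i)
    (h₂ : μ 4 (r + 2) = N) :
    ∃ μ' w, Runs (.loop (.sub (cell (r + 2)) (cell (r + 1)))
        (.seq P (setCell (r + 1) (.add (cell (r + 1)) (.const 1))))) μ μ' w ∧
      w ≤ (j + 1) * (c + 5 * N + 3 * bitLength ((r + 1 : ℕ) : ℚ) + bitLength ((r + 2 : ℕ) : ℚ) +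
        22) ∧ Same r μ μ' ∧ μ' 4 r = a N := by
  induction j generalizing i μ with
  | zero =>
    obtain rfl : i = N := by omega
    have heval : (Expr.sub (cell (r + 2)) (cell (r + 1))).eval μ = 0 := by
      simp only [Expr.eval, eval_cell, h₁, h₂, sub_self]
    refine ⟨μ, _, .loopFalse (by rw [heval]; simp), ?_, fun _ _ _ => rfl, h₀⟩
    have := bitLength_natCast i
    rw [Expr.cost, heval, cost_cell, cost_cell, h₁, h₂, bitLength_zero]
    omega
  | succ j ih =>
    have heval : (Expr.sub (cell (r + 2)) (cell (r + 1))).eval μ = ((j + 1 : ℕ) : ℚ) := by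
      simp only [Expr.eval, eval_cell, h₁, h₂, ← hij]
      push_cast
      ring
    obtain ⟨μ₁, w₁, k₁, k₂, k₃, k₄, k₅, k₆⟩ := hstep i μ (by omega) hμ h₀ h₁
    have heval' : (Expr.add (cell (r + 1)) (.const 1)).eval μ₁ = ((i + 1 : ℕ) : ℚ) := by
      simp only [Expr.eval, eval_cell, k₅]
      push_cast
      ring
    have hs : Same r μ (μ₁.write 4 (r + 1) ((i + 1 : ℕ) : ℚ)) :=
      k₃.trans (same_write μ₁ (Nat.le_succ r) _) le_rfl
    obtain ⟨μ₂, w₂, l₁, l₂, l₃, l₄⟩ := ih (i + 1) (by omega)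
      (μ₁.write 4 (r + 1) ((i + 1 : ℕ) : ℚ)) (hR _ _ hμ hs)
      (by rw [write_of_ne _ _ (Or.inr (by omega)), k₄]) (write_same _ _ _ _)
      (by rw [write_of_ne _ _ (Or.inr (by omega)), k₆, h₂])
    have hset := runs_setCell μ₁ (r + 1) (.add (cell (r + 1)) (.const 1))
    rw [heval'] at hset
    refine ⟨μ₂, _, .loopTrue (by rw [heval]; positivity) (.seq k₁ hset) l₁, ?_,
      hs.trans l₃ le_rfl, l₄⟩
    have b₁ := bitLength_natCast i
    have b₂ := bitLength_natCast N
    have b₃ := bitLength_natCast (i + 1)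
    have b₄ := bitLength_natCast (j + 1)
    have e₁ : (Expr.sub (cell (r + 2)) (cell (r + 1))).cost μ ≤ 3 * N +
        bitLength ((r + 1 : ℕ) : ℚ) + bitLength ((r + 2 : ℕ) : ℚ) + 8 := by
      rw [Expr.cost, heval, cost_cell, cost_cell, h₁, h₂]
      omega
    have e₂ : (Expr.add (cell (r + 1)) (.const 1)).cost μ₁ ≤ 2 * N +
        bitLength ((r + 1 : ℕ) : ℚ) + 8 := by
      rw [Expr.cost, heval', cost_cell, k₅, Expr.cost, bitLength_one]
      omega
    rw [add_mul (j + 1) 1, one_mul]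
    omega

namespace PolyTime

variable {d : ℕ}

/-- Bounded recursion: if each step of the sequence `a I ρ` takes polynomial time and its members
have polynomial length, then its `N I`-th member is computable in polynomial time. -/
theorem fold {a : IIDBoxes ℚ → (Fin d → ℕ) → ℕ → ℚ} {N : IIDBoxes ℚ → ℕ}
    (hN : PolyTime fun I (_ : Fin d → ℕ) => (N I : ℚ)) (hN_le : ∀ I, N I ≤ I.size + 3)
    (hinit : PolyTime fun I ρ => a I ρ 0)
    (hlen : ∃ p : ℕ[X], ∀ I ρ i, i ≤ N I → bitLength (a I ρ i) ≤ p.eval (sz I ρ))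
    (hstep : ∀ (ℓ : Fin d → ℕ) (r : ℕ), (∀ k, ℓ k < r) → ∃ (P : Program) (p : ℕ[X]),
      ∀ I ρ i μ, i < N I → Reads I ℓ ρ μ → μ 4 r = a I ρ i → μ 4 (r + 1) = i →
        ∃ μ' w, Runs P μ μ' w ∧ w ≤ p.eval (sz I ρ) ∧ Same r μ μ' ∧ μ' 4 r = a I ρ (i + 1) ∧
          μ' 4 (r + 1) = i ∧ μ' 4 (r + 2) = μ 4 (r + 2)) :
    PolyTime fun I ρ => a I ρ (N I) := by
  obtain ⟨p, hp⟩ := hlen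
  refine ⟨⟨p, fun I ρ => hp I ρ _ le_rfl⟩, fun ℓ r hr => ?_⟩
  obtain ⟨P₀, p₀, h₀⟩ := hinit.exists_program ℓ r hr
  obtain ⟨P₁, p₁, h₁⟩ := hN.exists_program ℓ (r + 2) fun k => (hr k).trans (by omega)
  obtain ⟨P₂, p₂, h₂⟩ := hstep ℓ r hr
  refine ⟨.seq P₀ (.seq (setCell (r + 1) (.const 0)) (.seq P₁
    (.loop (.sub (cell (r + 2)) (cell (r + 1)))
      (.seq P₂ (setCell (r + 1) (.add (cell (r + 1)) (.const 1))))))),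
    p₀ + p₁ + C (bitLength ((r + 1 : ℕ) : ℚ) + 7) + (X + 4) * (p₂ + 5 * (X + 3) +
      C (3 * bitLength ((r + 1 : ℕ) : ℚ) + bitLength ((r + 2 : ℕ) : ℚ) + 22)), fun I ρ μ h => ?_⟩
  obtain ⟨μ₁, w₁, k₁, k₂, k₃, k₄⟩ := h₀ I ρ μ h
  have hset := runs_setCell μ₁ (r + 1) (.const 0)
  simp only [Expr.eval] at hset
  set μ₂ := μ₁.write 4 (r + 1) 0 with hμ₂
  have hs₂ : Same r μ μ₂ := k₃.trans (same_write μ₁ (Nat.le_succ r) _) le_rfl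
  obtain ⟨μ₃, w₃, l₁, l₂, l₃, l₄⟩ := h₁ I ρ μ₂ (h.of_same hr hs₂)
  have hs₃ : Same r μ μ₃ := hs₂.trans l₃ (by omega)
  obtain ⟨μ₄, w₄, m₁, m₂, m₃, m₄⟩ := runs_count (R := Reads I ℓ ρ) (a := a I ρ) (P := P₂)
    (c := p₂.eval (sz I ρ)) (fun μ μ' h hs => h.of_same hr hs) (fun i μ => h₂ I ρ i μ)
    (N I) 0 (by omega) μ₃ (h.of_same hr hs₃)
    (by rw [l₃ 4 r (Or.inr (by omega)), hμ₂, write_of_ne _ _ (Or.inr (by omega)), k₄])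
    (by rw [l₃ 4 (r + 1) (Or.inr (by omega)), hμ₂, write_same]; simp) l₄
  refine ⟨μ₄, _, .seq k₁ (.seq hset (.seq l₁ m₁)), ?_, hs₃.trans m₃ le_rfl, m₄⟩
  have hNs : N I ≤ sz I ρ + 3 := (hN_le I).trans (by unfold sz; omega)
  have hmul : (N I + 1) * (p₂.eval (sz I ρ) + 5 * N I + 3 * bitLength ((r + 1 : ℕ) : ℚ) +
      bitLength ((r + 2 : ℕ) : ℚ) + 22) ≤ (sz I ρ + 4) * (p₂.eval (sz I ρ) + 5 * (sz I ρ + 3) +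
      (3 * bitLength ((r + 1 : ℕ) : ℚ) + bitLength ((r + 2 : ℕ) : ℚ) + 22)) :=
    Nat.mul_le_mul (by omega) (by omega)
  simp only [eval_add, eval_mul, eval_X, eval_C, eval_ofNat, Expr.cost, bitLength_zero]
  omega

/-- A step of a fold that combines the accumulator with the value of a function. -/
theorem exists_program_step {op : ℚ → ℚ → ℚ} {e : Expr → Expr → Expr}
    (heval : ∀ μ x y, (e x y).eval μ = op (x.eval μ) (y.eval μ))
    (hcost : ∀ μ x y, (e x y).cost μ = x.cost μ + y.cost μ + 1 + bitLength ((e x y).eval μ))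
    {a f : IIDBoxes ℚ → (Fin d → ℕ) → ℕ → ℚ} {N : IIDBoxes ℚ → ℕ} (hN_le : ∀ I, N I ≤ I.size + 3)
    (ha : ∀ I ρ i, a I ρ (i + 1) = op (a I ρ i) (f I ρ i))
    (hlen : ∃ p : ℕ[X], ∀ I ρ i, i ≤ N I → bitLength (a I ρ i) ≤ p.eval (sz I ρ))
    (hf : PolyTime fun I (ρ : Fin (d + 1) → ℕ) => f I (Fin.tail ρ) (ρ 0))
    (ℓ : Fin d → ℕ) (r : ℕ) (hr : ∀ k, ℓ k < r) : ∃ (P : Program) (p : ℕ[X]),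
      ∀ I ρ i μ, i < N I → Reads I ℓ ρ μ → μ 4 r = a I ρ i → μ 4 (r + 1) = i →
        ∃ μ' w, Runs P μ μ' w ∧ w ≤ p.eval (sz I ρ) ∧ Same r μ μ' ∧ μ' 4 r = a I ρ (i + 1) ∧
          μ' 4 (r + 1) = i ∧ μ' 4 (r + 2) = μ 4 (r + 2) := by
  obtain ⟨p, hp⟩ := hlen
  obtain ⟨q, hq⟩ := hf.length_le
  obtain ⟨P, s, hP⟩ := hf.exists_program (Fin.cons (r + 1) ℓ) (r + 3) fun k => by
    refine Fin.cases ?_ (fun k => ?_) k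
    · simp
    · simpa using (hr k).trans (by omega)
  refine ⟨.seq P (setCell r (e (cell r) (cell (r + 3)))), s.comp (2 * X + 3) + 2 * p +
    q.comp (2 * X + 3) + C (2 * bitLength (r : ℚ) + bitLength ((r + 3 : ℕ) : ℚ) + 8),
    fun I ρ i μ hi h h₀ h₁ => ?_⟩
  have hi' : i ≤ I.size + 3 := hi.le.trans (hN_le I)
  obtain ⟨μ', w, k₁, k₂, k₃, k₄⟩ := hP I (Fin.cons i ρ) μ (h.cons h₁)
  simp only [Fin.tail_cons, Fin.cons_zero] at k₄
  have hr₀ : μ' 4 r = a I ρ i := by rw [k₃ 4 r (Or.inr (by omega)), h₀]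
  have hval : (e (cell r) (cell (r + 3))).eval μ' = a I ρ (i + 1) := by
    rw [heval, eval_cell, eval_cell, hr₀, k₄, ha]
  refine ⟨_, _, .seq k₁ (runs_setCell μ' r _), ?_,
    Same.trans (fun k c hc => k₃ k c (hc.imp_right fun h => by omega))
      (same_write μ' le_rfl _) le_rfl, by rw [write_same, hval], ?_, ?_⟩
  · have b₁ := hp I ρ i hi.le
    have b₂ := hp I ρ (i + 1) hi
    have b₃ := (hq I (Fin.cons i ρ)).trans (eval_sz_cons_le q I hi' ρ)
    have b₄ := k₂.trans (eval_sz_cons_le s I hi' ρ)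
    simp only [Fin.tail_cons, Fin.cons_zero] at b₃
    rw [hcost, hval, cost_cell, cost_cell, hr₀, k₄]
    simp only [eval_add, eval_mul, eval_ofNat, eval_C]
    omega
  · rw [write_of_ne _ _ (Or.inr (by omega)), k₃ 4 (r + 1) (Or.inr (by omega)), h₁]
  · rw [write_of_ne _ _ (Or.inr (by omega)), k₃ 4 (r + 2) (Or.inr (by omega))]

theorem sum {f : IIDBoxes ℚ → (Fin d → ℕ) → ℕ → ℚ} {N : IIDBoxes ℚ → ℕ}
    (hN : PolyTime fun I (_ : Fin d → ℕ) => (N I : ℚ)) (hN_le : ∀ I, N I ≤ I.size + 3)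
    (hf : PolyTime fun I (ρ : Fin (d + 1) → ℕ) => f I (Fin.tail ρ) (ρ 0)) :
    PolyTime fun I ρ => ∑ i ∈ Finset.range (N I), f I ρ i := by
  have hlen : ∃ p : ℕ[X], ∀ I ρ i, i ≤ N I →
      bitLength (∑ l ∈ Finset.range i, f I ρ l) ≤ p.eval (sz I ρ) := by
    obtain ⟨q, hq⟩ := hf.length_le
    refine ⟨2 * ((X + 3) * q.comp (2 * X + 3)) + (X + 3) + 1, fun I ρ i hi => ?_⟩
    have hi' := hi.trans (hN_le I)
    have hi'' : i ≤ sz I ρ + 3 := hi'.trans (by unfold sz; omega)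
    have h := bitLength_sum_le (x := f I ρ) (i := i) (b := (q.comp (2 * X + 3)).eval (sz I ρ))
      fun l hl => by
        simpa only [Fin.tail_cons, Fin.cons_zero] using
          (hq I (Fin.cons l ρ)).trans (eval_sz_cons_le q I (hl.le.trans hi') ρ)
    have := Nat.mul_le_mul_right ((q.comp (2 * X + 3)).eval (sz I ρ)) hi''
    simp only [eval_add, eval_mul, eval_ofNat, eval_X, eval_one]
    omega
  exact fold (a := fun I ρ i => ∑ l ∈ Finset.range i, f I ρ l) hN hN_le
    ((const 0).congr fun _ _ => by simp) hlen
    (exists_program_step (e := .add) (op := (· + ·)) (fun _ _ _ => rfl) (fun _ _ _ => rfl) hN_le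
      (fun I ρ i => Finset.sum_range_succ _ _) hlen hf)

theorem prod {f : IIDBoxes ℚ → (Fin d → ℕ) → ℕ → ℚ} {N : IIDBoxes ℚ → ℕ}
    (hN : PolyTime fun I (_ : Fin d → ℕ) => (N I : ℚ)) (hN_le : ∀ I, N I ≤ I.size + 3)
    (hf : PolyTime fun I (ρ : Fin (d + 1) → ℕ) => f I (Fin.tail ρ) (ρ 0)) :
    PolyTime fun I ρ => ∏ i ∈ Finset.range (N I), f I ρ i := by
  have hlen : ∃ p : ℕ[X], ∀ I ρ i, i ≤ N I →
      bitLength (∏ l ∈ Finset.range i, f I ρ l) ≤ p.eval (sz I ρ) := by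
    obtain ⟨q, hq⟩ := hf.length_le
    refine ⟨(X + 3) * q.comp (2 * X + 3) + 2, fun I ρ i hi => ?_⟩
    have hi' := hi.trans (hN_le I)
    have hi'' : i ≤ sz I ρ + 3 := hi'.trans (by unfold sz; omega)
    have h := bitLength_prod_le (x := f I ρ) (i := i) (b := (q.comp (2 * X + 3)).eval (sz I ρ))
      fun l hl => by
        simpa only [Fin.tail_cons, Fin.cons_zero] using
          (hq I (Fin.cons l ρ)).trans (eval_sz_cons_le q I (hl.le.trans hi') ρ)
    have := Nat.mul_le_mul_right ((q.comp (2 * X + 3)).eval (sz I ρ)) hi''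
    simp only [eval_add, eval_mul, eval_ofNat, eval_X]
    omega
  exact fold (a := fun I ρ i => ∏ l ∈ Finset.range i, f I ρ l) hN hN_le
    ((const 1).congr fun _ _ => by simp) hlen
    (exists_program_step (e := .mul) (op := (· * ·)) (fun _ _ _ => rfl) (fun _ _ _ => rfl) hN_le
      (fun I ρ i => Finset.prod_range_succ _ _) hlen hf)

end PolyTime

end RAM

/-! ### Linear search and tables -/

/-- The first index below `N` at which `g` is largest, found by a linear search. -/
def best {K : Type} [LinearOrder K] (g : ℕ → K) : ℕ → ℕ
  | 0 => 0
  | N + 1 => if g (best g N) < g N then N else best g N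

section Best

variable {K : Type} [LinearOrder K] (g : ℕ → K)

theorem best_le (N : ℕ) : best g N ≤ N - 1 := by
  induction N with
  | zero => rfl
  | succ N ih =>
    rw [best]
    split_ifs <;> omega

theorem le_best {N i : ℕ} (hi : i < N) : g i ≤ g (best g N) := by
  induction N with
  | zero => omega
  | succ N ih =>
    rw [best]
    rcases Nat.lt_succ_iff_lt_or_eq.1 hi with h | rfl
    · split_ifs with h'
      exacts [(ih h).trans h'.le, ih h]
    · split_ifs with h'
      exacts [le_rfl, not_lt.1 h']

end Best

namespace RAM

open Polynomial

/-- Maximizing by linear search takes polynomial time. -/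
theorem PolyTime.best {d : ℕ} {f : IIDBoxes ℚ → (Fin d → ℕ) → ℕ → ℚ} {N : IIDBoxes ℚ → ℕ}
    (hN : PolyTime fun I (_ : Fin d → ℕ) => (N I : ℚ)) (hN_le : ∀ I, N I ≤ I.size + 3)
    (hf : PolyTime fun I (ρ : Fin (d + 1) → ℕ) => f I (Fin.tail ρ) (ρ 0)) :
    PolyTime fun I ρ => (best (f I ρ) (N I) : ℚ) := by
  refine fold (a := fun I ρ i => (_root_.best (f I ρ) i : ℚ)) hN hN_le (const 0) ?_ fun ℓ r hr => ?_
  · refine ⟨X + 4, fun I ρ i hi => (bitLength_natCast _).trans ?_⟩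
    have h₁ := best_le (f I ρ) i
    have h₂ := hN_le I
    simp only [eval_add, eval_ofNat, eval_X, sz]
    omega
  obtain ⟨q, hq⟩ := hf.length_le
  obtain ⟨P, s, hP⟩ := hf.exists_program (Fin.cons (r + 1) ℓ) (r + 3) fun k => by
    refine Fin.cases ?_ (fun k => ?_) k
    · simp
    · simpa using (hr k).trans (by omega)
  obtain ⟨P', s', hP'⟩ := hf.exists_program (Fin.cons r ℓ) (r + 4) fun k => by
    refine Fin.cases ?_ (fun k => ?_) k
    · simp
    · simpa using (hr k).trans (by omega)
  refine ⟨.seq P (.seq P' (.cond (.sub (cell (r + 3)) (cell (r + 4)))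
    (setCell r (cell (r + 1))) .skip)), s.comp (2 * X + 3) + s'.comp (2 * X + 3) +
      6 * q.comp (2 * X + 3) + X + C (bitLength (r : ℚ) + bitLength ((r + 1 : ℕ) : ℚ) +
      bitLength ((r + 3 : ℕ) : ℚ) + bitLength ((r + 4 : ℕ) : ℚ) + 20), fun I ρ i μ hi h h₀ h₁ => ?_⟩
  obtain ⟨μ₁, w₁, k₁, k₂, k₃, k₄⟩ := hP I (Fin.cons i ρ) μ (h.cons h₁)
  have h' : Reads I ℓ ρ μ₁ := h.of_same hr fun k c hc => k₃ k c (hc.imp_right fun h => by omega)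
  obtain ⟨μ₂, w₂, l₁, l₂, l₃, l₄⟩ := hP' I (Fin.cons (_root_.best (f I ρ) i) ρ) μ₁
    (h'.cons (by rw [k₃ 4 r (Or.inr (by omega)), h₀]))
  simp only [Fin.tail_cons, Fin.cons_zero] at k₄ l₄
  have hs : Same (r + 3) μ μ₂ := k₃.trans l₃ (by omega)
  have hs' : Same r μ μ₂ := fun k c hc => hs k c (hc.imp_right fun h => by omega)
  have heval : (Expr.sub (cell (r + 3)) (cell (r + 4))).eval μ₂ =
      f I ρ i - f I ρ (_root_.best (f I ρ) i) := by
    simp only [Expr.eval, eval_cell, l₄]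
    rw [l₃ 4 (r + 3) (Or.inr (by omega)), k₄]
  have hi' : i ≤ I.size + 3 := hi.le.trans (hN_le I)
  have hb' : _root_.best (f I ρ) i ≤ I.size + 3 := by
    have := best_le (f I ρ) i
    omega
  have b₁ := (hq I (Fin.cons i ρ)).trans (eval_sz_cons_le q I hi' ρ)
  have b₂ := (hq I (Fin.cons (_root_.best (f I ρ) i) ρ)).trans (eval_sz_cons_le q I hb' ρ)
  have b₃ := k₂.trans (eval_sz_cons_le s I hi' ρ)
  have b₄ := l₂.trans (eval_sz_cons_le s' I hb' ρ)
  simp only [Fin.tail_cons, Fin.cons_zero] at b₁ b₂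
  have hcost : (Expr.sub (cell (r + 3)) (cell (r + 4))).cost μ₂ ≤
      6 * (q.comp (2 * X + 3)).eval (sz I ρ) +
        (bitLength ((r + 3 : ℕ) : ℚ) + bitLength ((r + 4 : ℕ) : ℚ) + 6) := by
    have := bitLength_sub_le (f I ρ i) (f I ρ (_root_.best (f I ρ) i))
    rw [Expr.cost, heval, cost_cell, cost_cell, l₄, l₃ 4 (r + 3) (Or.inr (by omega)), k₄]
    omega
  have hr₁ : μ₂ 4 (r + 1) = i := by rw [hs 4 (r + 1) (Or.inr (by omega)), h₁]
  by_cases hlt : f I ρ (_root_.best (f I ρ) i) < f I ρ i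
  · refine ⟨_, _, .seq k₁ (.seq l₁ (.condTrue (by rw [heval]; linarith) (runs_setCell μ₂ r _))), ?_,
      hs'.trans (same_write μ₂ le_rfl _) le_rfl, ?_, ?_, ?_⟩
    · have := bitLength_natCast i
      have : I.size ≤ sz I ρ := Nat.le_add_right _ _
      rw [cost_cell, hr₁]
      simp only [eval_add, eval_mul, eval_X, eval_ofNat, eval_C]
      omega
    · rw [write_same, eval_cell, hr₁, _root_.best, if_pos hlt]
    · rw [write_of_ne _ _ (Or.inr (by omega)), hr₁]
    · rw [write_of_ne _ _ (Or.inr (by omega)), hs 4 (r + 2) (Or.inr (by omega))]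
  · refine ⟨_, _, .seq k₁ (.seq l₁ (.condFalse (by rw [heval]; linarith) (.skip μ₂))), ?_, hs',
      ?_, hr₁, hs 4 (r + 2) (Or.inr (by omega))⟩
    · simp only [eval_add, eval_mul, eval_X, eval_ofNat, eval_C]
      omega
    · rw [hs 4 r (Or.inr (by omega)), h₀, _root_.best, if_neg hlt]

/-- A polynomial-time function of a box index can be tabulated in array `3`. -/
theorem exists_program_tabulate {f : IIDBoxes ℚ → ℕ → ℚ}
    (hf : PolyTime fun I (ρ : Fin 1 → ℕ) => f I (ρ 0)) :
    ∃ (P : Program) (p : ℕ[X]), ∀ I : IIDBoxes ℚ, ∃ μ w, Runs P I.input μ w ∧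
      w ≤ p.eval I.size ∧ ∀ i < I.n, μ 3 i = f I i := by
  obtain ⟨q, hq⟩ := hf.length_le
  obtain ⟨P, s, hP⟩ := hf.exists_program (fun _ => 0) 1 fun _ => one_pos
  have hsz : ∀ (I : IIDBoxes ℚ) (p : ℕ[X]) i, i < I.n →
      p.eval (sz I fun _ : Fin 1 => i) ≤ (p.comp (2 * X)).eval I.size := by
    intro I p i hi
    rw [Polynomial.eval_comp]
    refine p.eval_mono_nat ?_
    simp only [sz, Finset.univ_unique, Finset.sum_singleton, eval_mul, eval_ofNat, eval_X,
      IIDBoxes.size] at *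
    omega
  have hloop : ∀ (I : IIDBoxes ℚ) (j i : ℕ) (μ : Memory), i + j = I.n →
      (∀ k < 3, ∀ c, μ k c = I.input k c) → μ 4 0 = i → (∀ l < i, μ 3 l = f I l) →
      ∃ μ' w, Runs (.loop (.sub (.load 0 (.const 0)) (cell 0))
        (.seq P (.seq (.store 3 (cell 0) (cell 1)) (setCell 0 (.add (cell 0) (.const 1)))))) μ μ' w ∧
        w ≤ (j + 1) * ((s.comp (2 * X)).eval I.size + (q.comp (2 * X)).eval I.size +
          6 * I.size + 50) ∧ ∀ l < I.n, μ' 3 l = f I l := by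
    intro I j
    have hn : I.n ≤ I.size := by unfold IIDBoxes.size; omega
    have hinput : I.input 0 0 = I.n := rfl
    have b0 : bitLength ((0 : ℕ) : ℚ) = 1 := by rw [Nat.cast_zero, bitLength_zero]
    have b1 : bitLength ((1 : ℕ) : ℚ) = 2 := by rw [Nat.cast_one, bitLength_one]
    have bn := bitLength_natCast I.n
    have hbound : ∀ (μ : Memory), μ 0 0 = I.n →
        (Expr.load 0 (.const 0)).eval μ = I.n ∧ (Expr.load 0 (.const 0)).cost μ ≤ I.n + 4 := by
      intro μ hμ
      have : (Expr.load 0 (.const 0)).eval μ = I.n := by simp [Expr.eval, hμ]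
      refine ⟨this, ?_⟩
      rw [Expr.cost, this, Expr.cost, bitLength_zero]
      omega
    induction j with
    | zero =>
      intro i μ hi hμ h₀ h₁
      obtain rfl : i = I.n := by omega
      obtain ⟨hv, hc⟩ := hbound μ (hμ 0 (by omega) 0)
      have heval : (Expr.sub (.load 0 (.const 0)) (cell 0)).eval μ = 0 := by
        rw [Expr.eval, hv, eval_cell, h₀, sub_self]
      refine ⟨μ, _, .loopFalse (by rw [heval]; simp), ?_, h₁⟩
      rw [Expr.cost, heval, cost_cell, h₀, b0, bitLength_zero]
      omega
    | succ j ih =>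
      intro i μ hi hμ h₀ h₁
      obtain ⟨hv, hc⟩ := hbound μ (hμ 0 (by omega) 0)
      have heval : (Expr.sub (.load 0 (.const 0)) (cell 0)).eval μ = ((j + 1 : ℕ) : ℚ) := by
        rw [Expr.eval, hv, eval_cell, h₀, ← hi]
        push_cast
        ring
      obtain ⟨μ₁, w₁, k₁, k₂, k₃, k₄⟩ := hP I (fun _ => i) μ ⟨hμ, fun _ => h₀⟩
      have h₀' : μ₁ 4 0 = i := by rw [k₃ 4 0 (Or.inr one_pos), h₀]
      have hstore := Runs.store 3 (cell 0) (cell 1) μ₁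
      rw [eval_cell, eval_cell, h₀', Nat.floor_natCast, k₄] at hstore
      set μ₂ := μ₁.write 3 i (f I i) with hμ₂
      have h₀'' : μ₂ 4 0 = i := by rw [hμ₂, write_of_ne _ _ (Or.inl (by omega)), h₀']
      have hset := runs_setCell μ₂ 0 (.add (cell 0) (.const 1))
      have heval' : (Expr.add (cell 0) (.const 1)).eval μ₂ = ((i + 1 : ℕ) : ℚ) := by
        simp only [Expr.eval, eval_cell, h₀'']
        push_cast
        ring
      rw [heval'] at hset
      obtain ⟨μ₃, w₃, l₁, l₂, l₃⟩ := ih (i + 1) (μ₂.write 4 0 ((i + 1 : ℕ) : ℚ)) (by omega)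
        (fun k hk c => by
          rw [write_of_ne _ _ (Or.inl (by omega)), hμ₂, write_of_ne _ _ (Or.inl (by omega)),
            k₃ k c (Or.inl (by omega)), hμ k hk c])
        (write_same _ _ _ _)
        (fun l hl => by
          rw [write_of_ne _ _ (Or.inl (by omega))]
          rcases Nat.lt_succ_iff_lt_or_eq.1 hl with h | rfl
          · rw [hμ₂, write_of_ne _ _ (Or.inr (by omega)), k₃ 3 l (Or.inl (by omega)), h₁ l h]
          · rw [hμ₂, write_same])
      refine ⟨μ₃, _, .loopTrue (by rw [heval]; positivity) (.seq k₁ (.seq hstore hset)) l₁, ?_, l₃⟩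
      have c₁ : (Expr.sub (.load 0 (.const 0)) (cell 0)).cost μ ≤ 3 * I.n + 12 := by
        have := bitLength_natCast (j + 1)
        have := bitLength_natCast i
        rw [Expr.cost, heval, cost_cell, h₀, b0]
        omega
      have c₂ : (cell 0).cost μ₁ + (cell 1).cost μ₁ ≤
          (q.comp (2 * X)).eval I.size + I.n + 10 := by
        have b₁ := (hq I fun _ => i).trans (hsz I q i (by omega))
        have b₂ := bitLength_natCast i
        rw [cost_cell, cost_cell, h₀', k₄, b0, b1]
        omega
      have c₃ : (Expr.add (cell 0) (.const 1)).cost μ₂ ≤ 2 * I.n + 12 := by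
        have := bitLength_natCast i
        have := bitLength_natCast (i + 1)
        rw [Expr.cost, heval', cost_cell, h₀'', Expr.cost, bitLength_one, b0]
        omega
      have c₄ := k₂.trans (hsz I s i (by omega))
      rw [add_mul (j + 1) 1, one_mul, b0]
      omega
  refine ⟨.loop (.sub (.load 0 (.const 0)) (cell 0))
    (.seq P (.seq (.store 3 (cell 0) (cell 1)) (setCell 0 (.add (cell 0) (.const 1))))),
    (X + 1) * (s.comp (2 * X) + q.comp (2 * X) + 6 * X + 50), fun I => ?_⟩
  obtain ⟨μ, w, h₁, h₂, h₃⟩ := hloop I I.n 0 I.input (by omega) (fun _ _ _ => rfl) (by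
    simp [IIDBoxes.input]) (fun l hl => by omega)
  refine ⟨μ, w, h₁, h₂.trans ?_, h₃⟩
  have hn : I.n ≤ I.size := by unfold IIDBoxes.size; omega
  simp only [eval_add, eval_mul, eval_ofNat, eval_X, eval_one]
  exact Nat.mul_le_mul_right _ (by omega)

end RAM

/-! ### Enumerating the two-phase contracts -/

namespace IIDBoxes

section Definitions

variable {K : Type} [Field K] [LinearOrder K] (I : IIDBoxes K)

/-- The agent's value of prize `j`, and zero if there is no such prize. -/
def value (j : ℕ) : K := if h : j < I.m + 1 then I.a ⟨j, h⟩ else 0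

/-- The number `x` moved into the interval of feasible payments. -/
def clamp (x : K) : K := max 0 (min I.v x)

/-- The candidates for the payment in the first phase: they produce the caps `a₀, …, aₘ`, zero and
the basic cap. -/
def firstPay (x : ℕ) : K := I.clamp (I.payFor (if x < I.m + 2 then I.value x else I.cap 0))

/-- The candidates for the payment in the second phase: they lift the worth of prize `0` to the
value of another prize. -/
def secondPay (y : ℕ) : K := I.clamp (I.value y - I.a 0)

/-- The revenue of the contract with `k` boxes in the first phase and the given candidates for the
payments, the first of which is increased to the second if necessary. -/
def planRevenue (k x y : ℕ) : K :=
  I.stepRevenue k (max (I.firstPay x) (I.secondPay y)) (I.secondPay y)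

end Definitions

section Enumeration

variable {I : IIDBoxes ℝ}

theorem clamp_mem (x : ℝ) : 0 ≤ I.clamp x ∧ I.clamp x ≤ I.v :=
  ⟨le_max_left _ _, max_le I.v_nonneg (min_le_left _ _)⟩

theorem clamp_eq {x : ℝ} (h₀ : 0 ≤ x) (h : x ≤ I.v) : I.clamp x = x := by
  rw [clamp, min_eq_right h, max_eq_right h₀]

theorem value_coe (j : Fin (I.m + 1)) : I.value j = I.a j := by
  have := j.isLt
  rw [value, dif_pos this]

/-- The enumeration meets every plan. -/
theorem IsPlan.exists_planRevenue_eq (hq : 0 < I.q 0) {k : ℕ} {t₁ t₂ : ℝ}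
    (h : I.IsPlan k t₁ t₂) : ∃ x < I.m + 3, ∃ y < I.m + 1,
      I.planRevenue k x y = I.stepRevenue k t₁ t₂ := by
  have hone : ∃ x < I.m + 3, 0 < k → I.firstPay x = t₁ := by
    rcases Nat.eq_zero_or_pos k with hk | hk
    · exact ⟨0, by omega, fun h => by omega⟩
    obtain ⟨h₁, h₂, -, h₃, h₄⟩ := h.first hk
    have h₃ := h₃ hq
    suffices ∃ x < I.m + 3, (if x < I.m + 2 then I.value x else I.cap 0) = I.cap t₁ by
      obtain ⟨x, hx, hx'⟩ := this
      refine ⟨x, hx, fun _ => ?_⟩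
      rw [firstPay, hx', ← h₃, clamp_eq h₁ h₂]
    rcases h₄ with h₄ | h₄ | ⟨j, -, h₄⟩
    · exact ⟨I.m + 2, by omega, by rw [if_neg (by omega), h₄]⟩
    · exact ⟨I.m + 1, by omega, by rw [if_pos (by omega), h₄, value, dif_neg (by omega)]⟩
    · have := j.isLt
      exact ⟨j, by omega, by rw [if_pos (by omega), h₄, value_coe]⟩
  have htwo : ∃ y < I.m + 1, I.secondPay y = t₂ := by
    suffices ∃ y < I.m + 1, I.value y - I.a 0 = t₂ ∧ 0 ≤ t₂ ∧ t₂ ≤ I.v by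
      obtain ⟨y, hy, hy', h₁, h₂⟩ := this
      exact ⟨y, hy, by rw [secondPay, hy', clamp_eq h₁ h₂]⟩
    have hzero : I.value 0 - I.a 0 = 0 := by
      have := value_coe (I := I) 0
      rw [Fin.val_zero] at this
      rw [this, sub_self]
    rcases h.le.eq_or_lt with hk | hk
    · rw [h.second_eq hk]
      exact ⟨0, by omega, hzero, le_rfl, I.v_nonneg⟩
    · obtain ⟨h₁, h₂, -, h₃⟩ := h.second hk
      rcases h₃ with rfl | ⟨j, -, h₃⟩
      · exact ⟨0, by omega, hzero, h₁, h₂⟩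
      · exact ⟨j, j.isLt, by rw [value_coe, ← h₃]; ring, h₁, h₂⟩
  obtain ⟨x, hx, hx'⟩ := hone
  obtain ⟨y, hy, hy'⟩ := htwo
  refine ⟨x, hx, y, hy, ?_⟩
  rw [planRevenue, hy']
  refine Finset.sum_congr rfl fun i hi => ?_
  congr 1
  split_ifs with hik
  · have hk : 0 < k := by omega
    rw [hx' hk]
    obtain ⟨h₁, -, h₂, -⟩ := h.first hk
    rcases h.le.eq_or_lt with hk' | hk'
    · rw [h.second_eq hk', max_eq_left h₁]
    · obtain ⟨-, -, h₃, -⟩ := h.second hk'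
      rw [max_eq_left (by linarith)]
  · rfl

/-- A best contract of the enumeration is optimal. -/
theorem isOptimalContract_of_planRevenue {k x y : ℕ}
    (hbest : ∀ k' ≤ I.n, ∀ x' < I.m + 3, ∀ y' < I.m + 1,
      I.planRevenue k' x' y' ≤ I.planRevenue k x y) {t : Fin I.n → ℝ}
    (ht : ∀ i : Fin I.n, t i = if (i : ℕ) < k then max (I.firstPay x) (I.secondPay y)
      else I.secondPay y) : I.toBoxes.IsOptimalContract (I.payments t) := by
  have h₁ := clamp_mem (I := I) (I.payFor (if x < I.m + 2 then I.value x else I.cap 0))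
  have h₂ := clamp_mem (I := I) (I.value y - I.a 0)
  refine isOptimalContract_of_forall_le (fun i => ?_) (fun i j hij => ?_) fun t' ht' hanti => ?_
  · rw [ht]
    split_ifs
    · exact ⟨le_max_of_le_left h₁.1, max_le h₁.2 h₂.2⟩
    · exact h₂
  · have hij : (i : ℕ) ≤ j := hij
    rw [ht, ht]
    split_ifs with hj hi hi
    · exact le_rfl
    · omega
    · exact le_max_right _ _
    · exact le_rfl
  · rcases (I.q_nonneg 0).eq_or_lt with hq | hq
    · simp [gain_eq_zero hq.symm]
    · obtain ⟨k', t₁, t₂, hplan, hle⟩ := exists_isPlan_ge hq ht' hanti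
      obtain ⟨x', hx', y', hy', heq⟩ := hplan.exists_planRevenue_eq hq
      refine hle.trans (heq.symm.le.trans ((hbest k' hplan.le x' hx' y' hy').trans (le_of_eq ?_)))
      rw [planRevenue, stepRevenue_eq]
      simp only [ht]

end Enumeration

section Cast

variable (I : IIDBoxes ℚ)

theorem ite_eq_cast {p p' : Prop} {_ : Decidable p} {_ : Decidable p'} {x y : ℝ} {x' y' : ℚ}
    (h : p ↔ p') (hx : x = x') (hy : y = y') :
    (if p then x else y) = ((if p' then x' else y' : ℚ) : ℝ) := by
  by_cases hp : p'
  · rw [if_pos hp, if_pos (h.2 hp), hx]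
  · rw [if_neg hp, if_neg (mt h.1 hp), hy]

theorem toReal_worth (t : ℚ) (j : Fin (I.m + 1)) :
    I.toReal.worth t j = (I.worth t j : ℝ) := by
  refine Eq.trans ?_ (Rat.cast_add _ _).symm
  exact congrArg _ (ite_eq_cast Iff.rfl rfl Rat.cast_zero.symm)

theorem toReal_capBound (t : ℚ) (j : Fin (I.m + 1)) :
    I.toReal.capBound t j = (I.capBound t j : ℝ) := by
  have h₀ : ∀ l : Fin (I.m + 1), I.toReal.worth t j ≤ I.toReal.worth t l ↔
      I.worth t j ≤ I.worth t l := fun l => by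
    rw [toReal_worth, toReal_worth, Rat.cast_le]
  have h₁ : ∑ l, (if I.toReal.worth t j ≤ I.toReal.worth t l then I.toReal.q l else 0) =
      ((∑ l, (if I.worth t j ≤ I.worth t l then I.q l else 0) : ℚ) : ℝ) := by
    rw [Rat.cast_sum]
    exact Finset.sum_congr rfl fun l _ => ite_eq_cast (h₀ l) rfl Rat.cast_zero.symm
  have h₂ : ∑ l, (if I.toReal.worth t j ≤ I.toReal.worth t l then
      I.toReal.q l * I.toReal.worth t l else 0) =
      ((∑ l, (if I.worth t j ≤ I.worth t l then I.q l * I.worth t l else 0) : ℚ) : ℝ) := by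
    rw [Rat.cast_sum]
    refine Finset.sum_congr rfl fun (l : Fin (I.m + 1)) _ =>
      ite_eq_cast (h₀ l) ?_ Rat.cast_zero.symm
    rw [Rat.cast_mul, ← toReal_worth]
    rfl
  unfold capBound
  rw [h₁, h₂]
  refine ite_eq_cast Rat.cast_pos ?_ ?_
  · rw [Rat.cast_div, Rat.cast_sub]
    rfl
  · rw [Rat.cast_neg]
    rfl

theorem toReal_cap (t : ℚ) : I.toReal.cap t = (I.cap t : ℝ) := by
  refine Eq.trans ?_ (Finset.apply_sup'_eq_sup'_comp Finset.univ_nonempty ((↑) : ℚ → ℝ)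
    (fun x y => Rat.cast_max x y)).symm
  exact Finset.sup'_congr _ rfl fun j _ => I.toReal_capBound t j

theorem toReal_below (x : ℚ) : I.toReal.below x = (I.below x : ℝ) := by
  unfold below
  rw [Rat.cast_sum]
  exact Finset.sum_congr rfl fun (j : Fin (I.m + 1)) _ =>
    ite_eq_cast (and_congr Iff.rfl Rat.cast_le) rfl Rat.cast_zero.symm

theorem toReal_gain (i : ℕ) (t : ℚ) : I.toReal.gain i t = (I.gain i t : ℝ) := by
  have h₀ : I.toReal.cap 0 = (I.cap 0 : ℝ) := by simpa using I.toReal_cap 0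
  have h₁ : I.toReal.a 0 + t = ((I.a 0 + t : ℚ) : ℝ) := by
    rw [Rat.cast_add]
    rfl
  unfold gain
  rw [h₀, h₁, toReal_cap, toReal_below, toReal_below, Rat.cast_mul]
  congr 1
  · rw [Rat.cast_mul, Rat.cast_sub]
    rfl
  · refine ite_eq_cast Rat.cast_le (ite_eq_cast Rat.cast_nonneg ?_ Rat.cast_zero.symm) ?_
    · rw [Rat.cast_pow]
    · rw [Rat.cast_mul, Rat.cast_pow, Rat.cast_pow, Rat.cast_add]
      rfl

theorem toReal_payFor (x : ℚ) : I.toReal.payFor x = (I.payFor x : ℝ) := by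
  have h : (∑ j, if j ≠ 0 then I.toReal.q j * max 0 (I.toReal.a j - x) else 0) =
      ((∑ j, if j ≠ 0 then I.q j * max 0 (I.a j - x) else 0 : ℚ) : ℝ) := by
    rw [Rat.cast_sum]
    refine Finset.sum_congr rfl fun (j : Fin (I.m + 1)) _ =>
      ite_eq_cast Iff.rfl ?_ Rat.cast_zero.symm
    push_cast
    rfl
  unfold payFor
  rw [h]
  push_cast
  rfl

theorem toReal_value (j : ℕ) : I.toReal.value j = (I.value j : ℝ) := by
  unfold value
  by_cases h : j < I.m + 1
  · rw [dif_pos h, dif_pos (show j < I.toReal.m + 1 from h)]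
    rfl
  · rw [dif_neg h, dif_neg (show ¬ j < I.toReal.m + 1 from h), Rat.cast_zero]

theorem toReal_clamp (x : ℚ) : I.toReal.clamp x = (I.clamp x : ℝ) := by
  change max 0 (min (I.v : ℝ) x) = _
  unfold clamp
  push_cast
  rfl

theorem toReal_firstPay (x : ℕ) : I.toReal.firstPay x = (I.firstPay x : ℝ) := by
  have h : (if x < I.toReal.m + 2 then I.toReal.value x else I.toReal.cap 0) =
      ((if x < I.m + 2 then I.value x else I.cap 0 : ℚ) : ℝ) := by
    refine ite_eq_cast Iff.rfl (I.toReal_value x) ?_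
    simpa using I.toReal_cap 0
  rw [firstPay, h, toReal_payFor, toReal_clamp, firstPay]

theorem toReal_secondPay (y : ℕ) : I.toReal.secondPay y = (I.secondPay y : ℝ) := by
  have h : I.toReal.value y - I.toReal.a 0 = ((I.value y - I.a 0 : ℚ) : ℝ) := by
    rw [toReal_value]
    push_cast
    rfl
  rw [secondPay, h, toReal_clamp, secondPay]

theorem toReal_planRevenue (k x y : ℕ) :
    I.toReal.planRevenue k x y = (I.planRevenue k x y : ℝ) := by
  unfold planRevenue stepRevenue
  rw [Rat.cast_sum]
  refine Finset.sum_congr rfl fun i _ => ?_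
  rw [← toReal_gain, toReal_firstPay, toReal_secondPay]
  exact congrArg _ (ite_eq_cast Iff.rfl (Rat.cast_max _ _).symm rfl)

end Cast

/-! ### The algorithm -/

section Algorithm

variable (I : IIDBoxes ℚ)

/-- The best payment of the second phase, given the first phase. -/
def bestSecond (k x : ℕ) : ℕ := best (I.planRevenue k x) (I.m + 1)

/-- The best payment of the first phase, given its length. -/
def bestFirst (k : ℕ) : ℕ := best (fun x => I.planRevenue k x (I.bestSecond k x)) (I.m + 3)

/-- The best length of the first phase. -/
def bestLength : ℕ :=
  best (fun k => I.planRevenue k (I.bestFirst k) (I.bestSecond k (I.bestFirst k))) (I.n + 1)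

/-- The payment in box `i` of a best contract of the enumeration. -/
def bestPay (i : ℕ) : ℚ :=
  if i < I.bestLength then
    max (I.firstPay (I.bestFirst I.bestLength))
      (I.secondPay (I.bestSecond I.bestLength (I.bestFirst I.bestLength)))
  else I.secondPay (I.bestSecond I.bestLength (I.bestFirst I.bestLength))

theorem isOptimalContract_bestPay :
    I.toReal.toBoxes.IsOptimalContract
      (I.toReal.payments fun i => ((I.bestPay i : ℚ) : ℝ)) := by
  refine isOptimalContract_of_planRevenue (k := I.bestLength) (x := I.bestFirst I.bestLength)
    (y := I.bestSecond I.bestLength (I.bestFirst I.bestLength))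
    (fun k hk x hx y hy => ?_) fun i => ?_
  · rw [toReal_planRevenue, toReal_planRevenue, Rat.cast_le]
    have h₁ := le_best (I.planRevenue k x) hy
    have h₂ := le_best (fun x => I.planRevenue k x (I.bestSecond k x)) hx
    have h₃ := le_best (fun k => I.planRevenue k (I.bestFirst k) (I.bestSecond k (I.bestFirst k)))
      (Nat.lt_succ_of_le hk)
    exact h₁.trans (h₂.trans h₃)
  · rw [toReal_firstPay, toReal_secondPay, bestPay]
    exact (ite_eq_cast Iff.rfl (Rat.cast_max _ _).symm rfl).symm

end Algorithm

end IIDBoxes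

/-! ### The running time of the algorithm -/

namespace RAM.PolyTime

open IIDBoxes

variable {d : ℕ} {f t x : IIDBoxes ℚ → (Fin d → ℕ) → ℚ} {j k y z : IIDBoxes ℚ → (Fin d → ℕ) → ℕ}

theorem boxCount : PolyTime fun I (_ : Fin d → ℕ) => (I.n : ℚ) :=
  (input (j := fun _ _ => 0) (const ((0 : ℕ) : ℚ)) (k := 0) (by omega)).congr fun _ _ => rfl

theorem prizeCount : PolyTime fun I (_ : Fin d → ℕ) => (I.m : ℚ) :=
  (input (j := fun _ _ => 1) (const ((1 : ℕ) : ℚ)) (k := 0) (by omega)).congr fun _ _ => rfl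

theorem openingCost : PolyTime fun I (_ : Fin d → ℕ) => I.c :=
  (input (j := fun _ _ => 2) (const ((2 : ℕ) : ℚ)) (k := 0) (by omega)).congr fun _ _ => rfl

theorem principalValue : PolyTime fun I (_ : Fin d → ℕ) => I.v :=
  (input (j := fun _ _ => 3) (const ((3 : ℕ) : ℚ)) (k := 0) (by omega)).congr fun _ _ => rfl

theorem value (hj : PolyTime fun I ρ => (j I ρ : ℚ)) : PolyTime fun I ρ => I.value (j I ρ) :=
  (input hj (k := 1) (by omega)).congr fun _ _ => rfl

theorem value_zero (I : IIDBoxes ℚ) : I.value 0 = I.a 0 := by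
  rw [IIDBoxes.value, dif_pos (Nat.succ_pos _)]
  rfl

theorem agentValue : PolyTime fun I (_ : Fin d → ℕ) => I.a 0 :=
  (value (j := fun _ _ => 0) (const ((0 : ℕ) : ℚ))).congr fun I _ => (value_zero I).symm

theorem input_two (I : IIDBoxes ℚ) (j : Fin (I.m + 1)) : I.input 2 j = I.q j := by
  have := j.isLt
  simp only [IIDBoxes.input]
  rw [dif_pos this]

theorem input_one (I : IIDBoxes ℚ) (j : Fin (I.m + 1)) : I.input 1 j = I.a j := by
  have := j.isLt
  simp only [IIDBoxes.input]
  rw [dif_pos this]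

theorem zeroProbability : PolyTime fun I (_ : Fin d → ℕ) => I.q 0 :=
  (input (j := fun _ _ => 0) (const ((0 : ℕ) : ℚ)) (k := 2) (by omega)).congr
    fun I _ => (input_two I 0).symm

theorem sum_prizes {f : IIDBoxes ℚ → (Fin d → ℕ) → ℕ → ℚ}
    {g : (I : IIDBoxes ℚ) → (Fin d → ℕ) → Fin (I.m + 1) → ℚ}
    (hf : PolyTime fun I (ρ : Fin (d + 1) → ℕ) => f I (Fin.tail ρ) (ρ 0))
    (h : ∀ I ρ j, g I ρ j = f I ρ j) : PolyTime fun I ρ => ∑ j, g I ρ j :=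
  (sum (N := fun I => I.m + 1) (((prizeCount (d := d)).add (const 1)).congr fun I _ => by simp)
    (fun I => by unfold IIDBoxes.size; omega) hf).congr fun I ρ => by
      rw [Finset.sum_range]
      exact Finset.sum_congr rfl fun j _ => h I ρ j

theorem cast_pos_iff {m : ℕ} (j : Fin (m + 1)) : (0 : ℚ) < ((j : ℕ) : ℚ) ↔ j ≠ 0 := by
  rw [Nat.cast_pos, Nat.pos_iff_ne_zero, ne_eq, ne_eq, Fin.val_eq_zero_iff]

theorem below (hx : PolyTime x) : PolyTime fun I ρ => I.below (x I ρ) := by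
  refine sum_prizes (f := fun I ρ j => if (0 : ℚ) < j then
    (if I.input 1 j ≤ x I ρ then I.input 2 j else 0) else 0) ?_ fun I ρ j => ?_
  · exact ite_lt (const 0) (var 0) (ite_le (input (var 0) (by omega)) hx.tail
      (input (var 0) (by omega)) (const 0)) (const 0)
  · simp only [cast_pos_iff, input_one, input_two]
    by_cases h : j = 0
    · simp [h]
    · simp [h]

/-- The worth of a prize given by a natural number. -/
def worthAt (I : IIDBoxes ℚ) (t : ℚ) (j : ℕ) : ℚ := I.input 1 j + if (0 : ℚ) < j then 0 else t

theorem worthAt_coe (I : IIDBoxes ℚ) (t : ℚ) (j : Fin (I.m + 1)) :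
    worthAt I t j = I.worth t j := by
  rw [worthAt, worth, input_one]
  simp only [cast_pos_iff]
  by_cases h : j = 0
  · simp [h]
  · simp [h]

theorem polyTime_worthAt (ht : PolyTime t) (hj : PolyTime fun I ρ => (j I ρ : ℚ)) :
    PolyTime fun I ρ => worthAt I (t I ρ) (j I ρ) :=
  (input hj (by omega)).add (ite_lt (const 0) hj (const 0) ht)

/-- The bound `capBound` for a prize given by a natural number. -/
def capBoundAt (I : IIDBoxes ℚ) (t : ℚ) (j : ℕ) : ℚ :=
  if 0 < ∑ l : Fin (I.m + 1), (if worthAt I t j ≤ I.worth t l then I.q l else 0) then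
    ((∑ l : Fin (I.m + 1), if worthAt I t j ≤ I.worth t l then I.q l * I.worth t l else 0) - I.c) /
      ∑ l : Fin (I.m + 1), (if worthAt I t j ≤ I.worth t l then I.q l else 0)
  else 0 - I.c

theorem capBoundAt_coe (I : IIDBoxes ℚ) (t : ℚ) (j : Fin (I.m + 1)) :
    capBoundAt I t j = I.capBound t j := by
  rw [capBoundAt, worthAt_coe, capBound, zero_sub]

theorem polyTime_capBoundAt (ht : PolyTime t) (hj : PolyTime fun I ρ => (j I ρ : ℚ)) :
    PolyTime fun I ρ => capBoundAt I (t I ρ) (j I ρ) := by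
  have h₁ : PolyTime fun I ρ => ∑ l : Fin (I.m + 1),
      (if worthAt I (t I ρ) (j I ρ) ≤ I.worth (t I ρ) l then I.q l else 0) := by
    refine sum_prizes (f := fun I ρ l => if worthAt I (t I ρ) (j I ρ) ≤ worthAt I (t I ρ) l then
      I.input 2 l else 0) ?_ fun I ρ l => ?_
    · exact ite_le (polyTime_worthAt ht.tail (j := fun I ρ => j I (Fin.tail ρ)) hj.tail)
        (polyTime_worthAt ht.tail (var 0)) (input (var 0) (by omega)) (const 0)
    · rw [worthAt_coe, input_two]
  have h₂ : PolyTime fun I ρ => ∑ l : Fin (I.m + 1),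
      (if worthAt I (t I ρ) (j I ρ) ≤ I.worth (t I ρ) l then I.q l * I.worth (t I ρ) l else 0) := by
    refine sum_prizes (f := fun I ρ l => if worthAt I (t I ρ) (j I ρ) ≤ worthAt I (t I ρ) l then
      I.input 2 l * worthAt I (t I ρ) l else 0) ?_ fun I ρ l => ?_
    · exact ite_le (polyTime_worthAt ht.tail (j := fun I ρ => j I (Fin.tail ρ)) hj.tail)
        (polyTime_worthAt ht.tail (var 0)) ((input (var 0) (by omega)).mul (polyTime_worthAt ht.tail (var 0)))
        (const 0)
    · rw [worthAt_coe, input_two]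
  exact ite_lt (const 0) h₁ ((h₂.sub openingCost).div h₁) ((const 0).sub openingCost)

/-- The cap, a maximum over the prizes, is found by linear search. -/
theorem cap_eq_best (I : IIDBoxes ℚ) (t : ℚ) :
    I.cap t = capBoundAt I t (_root_.best (capBoundAt I t) (I.m + 1)) := by
  have hlt : _root_.best (capBoundAt I t) (I.m + 1) < I.m + 1 := by
    have := best_le (capBoundAt I t) (I.m + 1)
    omega
  apply le_antisymm
  · refine Finset.sup'_le _ _ fun j _ => ?_
    rw [← capBoundAt_coe]
    exact le_best _ j.isLt
  · have := Finset.le_sup' (I.capBound t)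
      (Finset.mem_univ ⟨_root_.best (capBoundAt I t) (I.m + 1), hlt⟩)
    rwa [← capBoundAt_coe] at this

theorem cap (ht : PolyTime t) : PolyTime fun I ρ => I.cap (t I ρ) := by
  have hbest : PolyTime fun I ρ => (_root_.best (capBoundAt I (t I ρ)) (I.m + 1) : ℚ) :=
    best (f := fun I ρ => capBoundAt I (t I ρ)) (N := fun I => I.m + 1)
      (((prizeCount (d := d)).add (const 1)).congr fun I _ => by simp)
      (fun I => by unfold IIDBoxes.size; omega) (polyTime_capBoundAt ht.tail (var 0))
  exact (polyTime_capBoundAt ht hbest).congr fun I ρ => cap_eq_best I (t I ρ)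

theorem prod_ite_lt_eq_pow (x : ℚ) {e n : ℕ} (h : e ≤ n) :
    (∏ l ∈ Finset.range n, if (l : ℚ) < (e : ℚ) then x else 1) = x ^ e := by
  simp only [Nat.cast_lt]
  rw [Finset.prod_ite, Finset.prod_const, Finset.prod_const_one, mul_one]
  congr 1
  have : (Finset.range n).filter (· < e) = Finset.range e := by
    ext l
    simp only [Finset.mem_filter, Finset.mem_range]
    omega
  rw [this, Finset.card_range]

/-- Powers with exponents up to the number of boxes, as products over all boxes. -/
theorem pow (hx : PolyTime x) (hf : PolyTime f) :
    PolyTime fun I ρ => ∏ l ∈ Finset.range I.n, if (l : ℚ) < f I ρ then x I ρ else 1 :=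
  prod (f := fun I ρ l => if (l : ℚ) < f I ρ then x I ρ else 1) boxCount
    (fun I => by unfold IIDBoxes.size; omega) (ite_lt (var 0) hf.tail hx.tail (const 1))

/-- The gain of a box, with the powers written as products over all boxes. -/
def gainAt (I : IIDBoxes ℚ) (i : ℕ) (t : ℚ) : ℚ :=
  I.q 0 * (I.v - t) * if I.cap 0 ≤ I.a 0 + t then
      (if 0 ≤ I.cap t then
        ∏ l ∈ Finset.range I.n, (if (l : ℚ) < (i : ℚ) then I.below (I.cap t) else 1) else 0)
    else (∏ l ∈ Finset.range I.n, (if (l : ℚ) < (i : ℚ) then I.below (I.a 0 + t) else 1)) *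
      ∏ l ∈ Finset.range I.n,
        (if (l : ℚ) < (I.n : ℚ) - 1 - i then I.below (I.a 0 + t) + I.q 0 else 1)

theorem gainAt_eq (I : IIDBoxes ℚ) {i : ℕ} (hi : i < I.n) (t : ℚ) : gainAt I i t = I.gain i t := by
  have h : (I.n : ℚ) - 1 - i = ((I.n - 1 - i : ℕ) : ℚ) := by
    rw [Nat.cast_sub (by omega), Nat.cast_sub (by omega), Nat.cast_one]
  rw [gainAt, h, prod_ite_lt_eq_pow _ hi.le, prod_ite_lt_eq_pow _ hi.le,
    prod_ite_lt_eq_pow _ (by omega), gain]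

theorem polyTime_gainAt (hj : PolyTime fun I ρ => (j I ρ : ℚ)) (ht : PolyTime t) :
    PolyTime fun I ρ => gainAt I (j I ρ) (t I ρ) := by
  have hsum := agentValue.add ht
  exact (zeroProbability.mul (principalValue.sub ht)).mul
    (ite_le (cap (const 0)) hsum
      (ite_le (const 0) (cap ht) (pow (below (cap ht)) hj) (const 0))
      ((pow (below hsum) hj).mul
        (pow ((below hsum).add zeroProbability) ((boxCount.sub (const 1)).sub hj))))

theorem payFor (hx : PolyTime x) : PolyTime fun I ρ => I.payFor (x I ρ) := by
  have hsum : PolyTime fun I ρ => ∑ j, if j ≠ 0 then I.q j * Max.max 0 (I.a j - x I ρ) else 0 := by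
    refine sum_prizes (f := fun I ρ j => if (0 : ℚ) < j then
      I.input 2 j * Max.max 0 (I.input 1 j - x I ρ) else 0) ?_ fun I ρ j => ?_
    · exact ite_lt (const 0) (var 0) ((input (var 0) (by omega)).mul
        (max (const 0) ((input (var 0) (by omega)).sub hx.tail))) (const 0)
    · simp only [cast_pos_iff, input_one, input_two]
  exact (hx.sub agentValue).add ((openingCost.sub hsum).div zeroProbability)

theorem clamp (hx : PolyTime x) : PolyTime fun I ρ => I.clamp (x I ρ) :=
  max (const 0) (min principalValue hx)

theorem firstPay (hj : PolyTime fun I ρ => (j I ρ : ℚ)) :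
    PolyTime fun I ρ => I.firstPay (j I ρ) :=
  clamp <| payFor <| (ite_lt hj (prizeCount.add (const 2)) (value hj) (cap (const 0))).congr
    fun I ρ => by
      have : j I ρ < I.m + 2 ↔ (j I ρ : ℚ) < I.m + 2 := by
        rw [← Nat.cast_lt (α := ℚ)]
        push_cast
        rfl
      simp only [this]

theorem secondPay (hj : PolyTime fun I ρ => (j I ρ : ℚ)) :
    PolyTime fun I ρ => I.secondPay (j I ρ) :=
  clamp ((value hj).sub agentValue)

theorem planRevenue (hk : PolyTime fun I ρ => (k I ρ : ℚ)) (hy : PolyTime fun I ρ => (y I ρ : ℚ))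
    (hz : PolyTime fun I ρ => (z I ρ : ℚ)) :
    PolyTime fun I ρ => I.planRevenue (k I ρ) (y I ρ) (z I ρ) := by
  refine (sum (f := fun I ρ i => gainAt I i (if (i : ℚ) < (k I ρ : ℚ) then
      Max.max (I.firstPay (y I ρ)) (I.secondPay (z I ρ)) else I.secondPay (z I ρ)))
    boxCount (fun I => by unfold IIDBoxes.size; omega) ?_).congr fun I ρ => ?_
  · exact polyTime_gainAt (var 0) (ite_lt (var 0) hk.tail
      (max (firstPay (j := fun I ρ => y I (Fin.tail ρ)) hy.tail)
        (secondPay (j := fun I ρ => z I (Fin.tail ρ)) hz.tail))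
      (secondPay (j := fun I ρ => z I (Fin.tail ρ)) hz.tail))
  · rw [IIDBoxes.planRevenue, IIDBoxes.stepRevenue]
    refine Finset.sum_congr rfl fun i hi => ?_
    rw [gainAt_eq I (Finset.mem_range.1 hi)]
    simp only [Nat.cast_lt]

theorem bestSecond (hk : PolyTime fun I ρ => (k I ρ : ℚ)) (hy : PolyTime fun I ρ => (y I ρ : ℚ)) :
    PolyTime fun I ρ => (I.bestSecond (k I ρ) (y I ρ) : ℚ) :=
  best (f := fun I ρ => I.planRevenue (k I ρ) (y I ρ)) (N := fun I => I.m + 1)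
    (((prizeCount (d := d)).add (const 1)).congr fun I _ => by simp)
    (fun I => by unfold IIDBoxes.size; omega)
    (planRevenue (k := fun I ρ => k I (Fin.tail ρ)) (y := fun I ρ => y I (Fin.tail ρ))
      hk.tail hy.tail (var 0))

theorem bestFirst (hk : PolyTime fun I ρ => (k I ρ : ℚ)) :
    PolyTime fun I ρ => (I.bestFirst (k I ρ) : ℚ) :=
  best (f := fun I ρ x => I.planRevenue (k I ρ) x (I.bestSecond (k I ρ) x))
    (N := fun I => I.m + 3) (((prizeCount (d := d)).add (const 3)).congr fun I _ => by simp)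
    (fun I => by unfold IIDBoxes.size; omega)
    (planRevenue (k := fun I ρ => k I (Fin.tail ρ)) hk.tail (var 0)
      (bestSecond (k := fun I ρ => k I (Fin.tail ρ)) hk.tail (var 0)))

theorem bestLength : PolyTime fun I (_ : Fin d → ℕ) => (I.bestLength : ℚ) :=
  best (f := fun I _ k => I.planRevenue k (I.bestFirst k) (I.bestSecond k (I.bestFirst k)))
    (N := fun I => I.n + 1) (((boxCount (d := d)).add (const 1)).congr fun I _ => by simp)
    (fun I => by unfold IIDBoxes.size; omega)
    (planRevenue (var 0) (bestFirst (var 0)) (bestSecond (var 0) (bestFirst (var 0))))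

theorem bestPay : PolyTime fun I (ρ : Fin 1 → ℕ) => I.bestPay (ρ 0) := by
  have hsecond := secondPay (bestSecond (d := 1) bestLength (bestFirst bestLength))
  refine (ite_lt (var 0) bestLength (max (firstPay (bestFirst bestLength)) hsecond) hsecond).congr
    fun I ρ => ?_
  simp only [Nat.cast_lt]
  rfl

end RAM.PolyTime

theorem theorem5 :
    (∃ (P : Program) (f : Polynomial ℕ), ∀ I : IIDBoxes ℚ, ∃ (μ : Memory) (w : ℕ),
      Runs P I.input μ w ∧ w ≤ f.eval I.size ∧
        I.toReal.toBoxes.IsOptimalContract (I.toReal.payments (I.output μ))) ∧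
    (∀ I : IIDBoxes ℝ, ∃ t : Fin I.n → ℝ,
      I.toBoxes.IsOptimalContract (I.payments t) ∧ I.IsTwoPhase t) := by
  refine ⟨?_, IIDBoxes.exists_optimal_isTwoPhase⟩
  obtain ⟨P, p, h⟩ := RAM.exists_program_tabulate RAM.PolyTime.bestPay
  refine ⟨P, p, fun I => ?_⟩
  obtain ⟨μ, w, h₁, h₂, h₃⟩ := h I
  refine ⟨μ, w, h₁, h₂, ?_⟩
  have : I.output μ = fun i : Fin I.toReal.n => ((I.bestPay i : ℚ) : ℝ) := by
    funext i
    exact congrArg _ (h₃ i i.isLt)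
  rw [this]
  exact I.isOptimalContract_bestPay
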